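/- Consider $n$ jobs $1,\dots,n$ with nonnegative integer processing times $p_j$ and weights $w_j$, and a nonempty set $J^r$ of jobs that require an external resource; put $P=\sum_j p_j$. The jobs are processed one after the other, from time $0$ on and without idle time, in the order of a sequence (permutation) $\sigma$. Let $C_j^\sigma$ be the completion time of job $j$, let $\mathrm{TWC}(\sigma)=\sum_j w_jC_j^\sigma$ be the total weighted completion time, and let $er(\sigma)=\max_{j\in J^r}C_j^\sigma-\min_{j\in J^r}(C_j^\sigma-p_j)$ be the length of the period for which the resource has to be rented. A sequence is Pareto optimal if no other sequence is at least as good in both objectives $\mathrm{TWC}$ and $er$ (both to be minimized) and strictly better in one of them. The problem $1||(\sum w_jC_j,er)$ can be solved in $O(nP^2)$ time: there are an algorithm (a program for a random access machine with unit-cost addition, subtraction, comparison and memory access on natural numbers) and a constant $C$ such that, on every such instance, the algorithm halts after at most $C\,n\max\{P,1\}^2$ steps (that is, at most $C\,nP^2$ steps whenever $P\ge 1$) and outputs a list of Pareto-optimal sequences that contains, for every Pareto-optimal pair of values $(\mathrm{TWC},er)$, exactly one sequence that attains it. -/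

import Mathlib

namespace ERSched

/-! ### Single-machine instances with an external resource -/

/-- An instance: jobs `0, …, n - 1` with nonnegative integer processing times `p` and weights `w`,
and the nonempty set `R` of jobs that need the external resource (the r-jobs). -/
structure Inst where
  n : ℕ
  p : Fin n → ℕ
  w : Fin n → ℕ
  R : Finset (Fin n)
  R_nonempty : R.Nonempty

namespace Inst

variable (I : Inst)

/-- Total processing time `P`. -/
def P : ℕ := ∑ j, I.p j

/-- A sequence of the jobs; `σ k` is the job in position `k`. -/
abbrev Sequence : Type := Equiv.Perm (Fin I.n)

variable {I}

/-- Completion time of job `j`: the total processing time of all jobs up to and including `j`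
in the sequence `σ` (the jobs are processed from time `0` on, without idle time). -/
def completion (σ : I.Sequence) (j : Fin I.n) : ℕ :=
  ∑ k ∈ Finset.univ.filter (fun k => k ≤ σ.symm j), I.p (σ k)

/-- Total weighted completion time. -/
def twc (σ : I.Sequence) : ℕ := ∑ j, I.w j * completion σ j

/-- Length of the renting period, `max_{j ∈ R} C_j - min_{j ∈ R} (C_j - p_j)`. -/
def er (σ : I.Sequence) : ℤ :=
  I.R.sup' I.R_nonempty (fun j => (completion σ j : ℤ)) -
    I.R.inf' I.R_nonempty (fun j => (completion σ j : ℤ) - (I.p j : ℤ))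

/-- `σ` dominates `τ`: at least as good in both objectives and better in one of them. -/
def Dominates (σ τ : I.Sequence) : Prop :=
  twc σ ≤ twc τ ∧ er σ ≤ er τ ∧ (twc σ < twc τ ∨ er σ < er τ)

/-- No sequence dominates `σ`. -/
def ParetoOptimal (σ : I.Sequence) : Prop := ∀ τ : I.Sequence, ¬ Dominates τ σ

/-- The listed sequences are Pareto optimal, and each Pareto-optimal pair of objective values is
attained by exactly one of them. -/
def IsParetoFront {m : ℕ} (front : Fin m → I.Sequence) : Prop :=
  (∀ i, ParetoOptimal (front i)) ∧
    ∀ τ : I.Sequence, ParetoOptimal τ →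
      ∃! i, twc (front i) = twc τ ∧ er (front i) = er τ

end Inst

/-! ### A random access machine with step count

Programs are written in a structured language over natural-number variables and arrays of natural
numbers. A program is a finite text, so it names only finitely many variables and arrays. Its
only arithmetic operations are addition and (truncated) subtraction: there is no multiplication,
so that unit cost is an honest measure. -/

/-- Memory: variable `x` holds `var x`, and cell `i` of array `a` holds `arr a i`. -/
structure Mem where
  var : ℕ → ℕ
  arr : ℕ → ℕ → ℕ

namespace Mem

/-- Overwrite a variable. -/
def setVar (s : Mem) (x v : ℕ) : Mem :=
  { s with var := Function.update s.var x v }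

/-- Overwrite one cell of an array. -/
def setArr (s : Mem) (a i v : ℕ) : Mem :=
  { s with arr := Function.update s.arr a (Function.update (s.arr a) i v) }

end Mem

/-- Expressions. -/
inductive Expr where
  | const (c : ℕ)
  | var (x : ℕ)
  | arr (a : ℕ) (i : Expr)
  | add (e f : Expr)
  | sub (e f : Expr)

namespace Expr

/-- Value of an expression; `sub` is truncated subtraction. -/
def eval (s : Mem) : Expr → ℕ
  | const c => c
  | var x => s.var x
  | arr a i => s.arr a (i.eval s)
  | add e f => e.eval s + f.eval s
  | sub e f => e.eval s - f.eval s

/-- Cost of evaluation: one step for each constant, memory access and operation. -/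
def cost : Expr → ℕ
  | const _ => 1
  | var _ => 1
  | arr _ i => i.cost + 1
  | add e f => e.cost + f.cost + 1
  | sub e f => e.cost + f.cost + 1

end Expr

/-- Tests. -/
inductive Test where
  | le (e f : Expr)
  | eq (e f : Expr)
  | neg (b : Test)
  | conj (b c : Test)

namespace Test

/-- Truth of a test. -/
def holds (s : Mem) : Test → Prop
  | le e f => e.eval s ≤ f.eval s
  | eq e f => e.eval s = f.eval s
  | neg b => ¬ b.holds s
  | conj b c => b.holds s ∧ c.holds s

/-- Cost of a test: one step for each comparison and connective, plus the expressions. -/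
def cost : Test → ℕ
  | le e f => e.cost + f.cost + 1
  | eq e f => e.cost + f.cost + 1
  | neg b => b.cost + 1
  | conj b c => b.cost + c.cost + 1

end Test

/-- Programs. -/
inductive Prog where
  | skip
  | assign (x : ℕ) (e : Expr)
  | store (a : ℕ) (i e : Expr)
  | seq (c d : Prog)
  | branch (b : Test) (c d : Prog)
  | loop (b : Test) (c : Prog)

/-- `Exec c s s' t`: started in memory `s`, the program `c` halts in memory `s'` after exactly
`t` steps. -/
inductive Exec : Prog → Mem → Mem → ℕ → Prop where
  | skip (s : Mem) : Exec Prog.skip s s 1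
  | assign (x : ℕ) (e : Expr) (s : Mem) :
      Exec (Prog.assign x e) s (s.setVar x (e.eval s)) (e.cost + 1)
  | store (a : ℕ) (i e : Expr) (s : Mem) :
      Exec (Prog.store a i e) s (s.setArr a (i.eval s) (e.eval s)) (i.cost + e.cost + 1)
  | seq {c d : Prog} {s s₁ s₂ : Mem} {t₁ t₂ : ℕ} :
      Exec c s s₁ t₁ → Exec d s₁ s₂ t₂ → Exec (Prog.seq c d) s s₂ (t₁ + t₂)
  | branch_true {b : Test} {c d : Prog} {s s₁ : Mem} {t : ℕ} :
      b.holds s → Exec c s s₁ t → Exec (Prog.branch b c d) s s₁ (b.cost + 1 + t)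
  | branch_false {b : Test} {c d : Prog} {s s₁ : Mem} {t : ℕ} :
      ¬ b.holds s → Exec d s s₁ t → Exec (Prog.branch b c d) s s₁ (b.cost + 1 + t)
  | loop_false {b : Test} {c : Prog} {s : Mem} :
      ¬ b.holds s → Exec (Prog.loop b c) s s (b.cost + 1)
  | loop_true {b : Test} {c : Prog} {s s₁ s₂ : Mem} {t₁ t₂ : ℕ} :
      b.holds s → Exec c s s₁ t₁ → Exec (Prog.loop b c) s₁ s₂ t₂ →
      Exec (Prog.loop b c) s s₂ (b.cost + 1 + t₁ + t₂)

/-! ### Input and output -/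

/-- Input: variable `0` holds `n`; arrays `0`, `1`, `2` hold the processing times, the weights and
the 0/1-indicator of the r-jobs; everything else is `0`. -/
def Inst.input (I : Inst) : Mem where
  var x := if x = 0 then I.n else 0
  arr a j :=
    if h : j < I.n then
      if a = 0 then I.p ⟨j, h⟩
      else if a = 1 then I.w ⟨j, h⟩
      else if a = 2 then (if ⟨j, h⟩ ∈ I.R then 1 else 0)
      else 0
    else 0

/-- Output: variable `1` holds the number of listed sequences, and array `3` holds these
sequences one after the other, the `k`-th job of the `i`-th sequence being in cell `i * n + k`. -/
def Inst.Outputs (I : Inst) (s : Mem) (front : Fin (s.var 1) → I.Sequence) : Prop :=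
  ∀ (i : Fin (s.var 1)) (k : Fin I.n), s.arr 3 ((i : ℕ) * I.n + (k : ℕ)) = ((front i k : Fin I.n) : ℕ)

end ERSched

namespace ERSched

/-! ### A program logic for the random access machine -/

/-! Sort the jobs by nonincreasing ratio of weight to processing time. In a sequence, let `B` be the
set of jobs from the first to the last r-job. The total weighted starting time is a sum of pair
costs: `p i * w j` if `i` precedes `j`. Two jobs that both lie in `B`, or both outside, are cheapest
in sorted order. A job outside `B` lies entirely before or after it, so its cost against `B` is that
of a comparison with one composite job, and it should come first exactly if its ratio is at least
that of `B`. These jobs form an initial segment outside `B`, so some split `k` exists: jobs outside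
`B` go before it if their index is below `k`, and after it otherwise. All three blocks are sorted.
This is `exists_isSplit_startCost_le`; the middle block has size at most the original renting period
(`exists_isSplit`).

The cost of such a split schedule decouples (`IsSplit.startCost_eq`). For the first `k` jobs,
starting times depend only on the size `α` of the first block and on choices made among these jobs.
For the other jobs, times measured from the end depend only on the size `y` of the last block. Hence
one knapsack-like recursion `dp`, with the final block size guessed in advance as a parameter,
serves both sides, the second with reversed items. `trace_spec` shows that its values are attained,
`dp_le_blockCost` that they are lower bounds. Each table has `(P + 1) * (n + 1) * (P + 1)` entries.

For a given size `e` of the middle block, `k` and `α` determine `y = P - e - α`, so searching all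
triples `(e, k, α)` takes `O(n P ^ 2)` table lookups. Going through `e = 0, …, P` and emitting a
sequence exactly when the least value strictly drops yields the front (`PartialFront.skip`,
`PartialFront.push`, `PartialFront.isParetoFront`). Each output costs `O(n)`.

Two points need care on this machine. Products with weights and row addresses come from tables built
by repeated addition. Sorting must not cost `n ^ 2`, as `n` may exceed `P ^ 2`: jobs with processing
time `0` are ranked by a counter, and at most `P` jobs need a count over all jobs. The remaining
work is a program logic with step bounds (`Runs`), which gives `runs_paretoFront`. -/

@[simp] theorem Mem.setVar_var (s : Mem) (x v y : ℕ) :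
    (s.setVar x v).var y = if y = x then v else s.var y := by
  simp [Mem.setVar, Function.update_apply]

@[simp] theorem Mem.setVar_arr (s : Mem) (x v : ℕ) : (s.setVar x v).arr = s.arr := rfl

@[simp] theorem Mem.setArr_var (s : Mem) (a i v : ℕ) : (s.setArr a i v).var = s.var := rfl

theorem Mem.setArr_arr (s : Mem) (a i v b : ℕ) :
    (s.setArr a i v).arr b = if b = a then Function.update (s.arr a) i v else s.arr b := by
  simp only [Mem.setArr, Function.update_apply]

namespace Prog

/-- Whether the program may assign to variable `y`. -/
def writesVar : Prog → ℕ → Bool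
  | skip, _ => false
  | assign x _, y => x == y
  | store _ _ _, _ => false
  | seq c d, y => c.writesVar y || d.writesVar y
  | branch _ c d, y => c.writesVar y || d.writesVar y
  | loop _ c, y => c.writesVar y

/-- Whether the program may store into array `b`. -/
def writesArr : Prog → ℕ → Bool
  | skip, _ => false
  | assign _ _, _ => false
  | store a _ _, b => a == b
  | seq c d, b => c.writesArr b || d.writesArr b
  | branch _ c d, b => c.writesArr b || d.writesArr b
  | loop _ c, b => c.writesArr b

/-- Worst-case cost of a loop-free program. -/
def flatCost : Prog → ℕ
  | skip => 1
  | assign _ e => e.cost + 1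
  | store _ i e => i.cost + e.cost + 1
  | seq c d => c.flatCost + d.flatCost
  | branch b c d => b.cost + 1 + max c.flatCost d.flatCost
  | loop _ _ => 0

/-- Weakest precondition of a loop-free program. -/
def wp : Prog → (Mem → Prop) → Mem → Prop
  | skip, Q, s => Q s
  | assign x e, Q, s => Q (s.setVar x (e.eval s))
  | store a i e, Q, s => Q (s.setArr a (i.eval s) (e.eval s))
  | seq c d, Q, s => c.wp (d.wp Q) s
  | branch b c d, Q, s => (b.holds s → c.wp Q s) ∧ (¬ b.holds s → d.wp Q s)
  | loop _ _, _, _ => False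

/-- `for x = 0, …, (var y) - 1 do body`. -/
def forLoop (x y : ℕ) (body : Prog) : Prog :=
  seq (assign x (.const 0))
    (loop (.le (.add (.var x) (.const 1)) (.var y))
      (seq body (assign x (.add (.var x) (.const 1)))))

@[simp] theorem writesArr_forLoop (x y : ℕ) (c : Prog) (a : ℕ) :
    (forLoop x y c).writesArr a = c.writesArr a := by
  simp [forLoop, writesArr]

end Prog

/-- `s'` agrees with `s` outside of what `c` may write. -/
def Frame (c : Prog) (s s' : Mem) : Prop :=
  (∀ x, c.writesVar x = false → s'.var x = s.var x) ∧
    ∀ a, c.writesArr a = false → s'.arr a = s.arr a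

theorem Frame.refl (c : Prog) (s : Mem) : Frame c s s := ⟨fun _ _ => rfl, fun _ _ => rfl⟩

theorem Frame.trans {c : Prog} {s s₁ s₂ : Mem} (h : Frame c s s₁) (h' : Frame c s₁ s₂) :
    Frame c s s₂ :=
  ⟨fun x hx => (h'.1 x hx).trans (h.1 x hx), fun a ha => (h'.2 a ha).trans (h.2 a ha)⟩

theorem Frame.mono {c d : Prog} {s s' : Mem} (h : Frame c s s')
    (hv : ∀ x, d.writesVar x = false → c.writesVar x = false)
    (ha : ∀ x, d.writesArr x = false → c.writesArr x = false) : Frame d s s' :=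
  ⟨fun x hx => h.1 x (hv x hx), fun a hx => h.2 a (ha a hx)⟩

/-- This frame rule carries facts across program parts: `writesVar` and `writesArr` evaluate by
computation, so for concrete programs the side conditions later close by `rfl`. -/
theorem Exec.frame {c : Prog} {s s' : Mem} {t : ℕ} (h : Exec c s s' t) : Frame c s s' := by
  induction h with
  | skip s => exact Frame.refl _ _
  | assign x e s =>
    refine ⟨fun y hy => ?_, fun _ _ => rfl⟩
    simp only [Prog.writesVar, beq_eq_false_iff_ne, ne_eq] at hy
    simp [Ne.symm hy]
  | store a i e s =>
    refine ⟨fun _ _ => rfl, fun b hb => ?_⟩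
    simp only [Prog.writesArr, beq_eq_false_iff_ne, ne_eq] at hb
    simp [Mem.setArr_arr, Ne.symm hb]
  | seq _ _ h₁ h₂ =>
    exact (h₁.mono (by simp +contextual [Prog.writesVar])
      (by simp +contextual [Prog.writesArr])).trans
      (h₂.mono (by simp +contextual [Prog.writesVar]) (by simp +contextual [Prog.writesArr]))
  | branch_true _ _ h =>
    exact h.mono (by simp +contextual [Prog.writesVar]) (by simp +contextual [Prog.writesArr])
  | branch_false _ _ h =>
    exact h.mono (by simp +contextual [Prog.writesVar]) (by simp +contextual [Prog.writesArr])
  | loop_false _ => exact Frame.refl _ _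
  | loop_true _ _ _ h₁ h₂ =>
    exact Frame.trans (h₁.mono (by simp [Prog.writesVar]) (by simp [Prog.writesArr])) h₂

/-- Started in `s`, the program `c` halts within `T` steps in a memory that satisfies `Q`. -/
def Runs (c : Prog) (s : Mem) (T : ℕ) (Q : Mem → Prop) : Prop :=
  ∃ s' t, Exec c s s' t ∧ t ≤ T ∧ Q s'

/-! ### Hoare-style rules with step bounds. -/

namespace Runs

variable {c d : Prog} {s : Mem} {T T₁ T₂ : ℕ} {Q Q' : Mem → Prop}

theorem imp (h : Runs c s T₁ Q) (hT : T₁ ≤ T) (hQ : ∀ s', Frame c s s' → Q s' → Q' s') :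
    Runs c s T Q' := by
  obtain ⟨s', t, he, ht, hq⟩ := h
  exact ⟨s', t, he, ht.trans hT, hQ s' he.frame hq⟩

theorem seq (h : Runs c s T₁ Q) (h' : ∀ s', Frame c s s' → Q s' → Runs d s' T₂ Q') :
    Runs (.seq c d) s (T₁ + T₂) Q' := by
  obtain ⟨s₁, t₁, he₁, ht₁, hq₁⟩ := h
  obtain ⟨s₂, t₂, he₂, ht₂, hq₂⟩ := h' s₁ he₁.frame hq₁
  exact ⟨s₂, t₁ + t₂, he₁.seq he₂, by omega, hq₂⟩

theorem branch {b : Test} (h : b.holds s → Runs c s T Q) (h' : ¬ b.holds s → Runs d s T Q) :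
    Runs (.branch b c d) s (b.cost + 1 + T) Q := by
  by_cases hb : b.holds s
  · obtain ⟨s', t, he, ht, hq⟩ := h hb
    exact ⟨s', _, .branch_true hb he, by omega, hq⟩
  · obtain ⟨s', t, he, ht, hq⟩ := h' hb
    exact ⟨s', _, .branch_false hb he, by omega, hq⟩

theorem of_wp (h : c.wp Q s) : Runs c s c.flatCost Q := by
  induction c generalizing Q s with
  | skip => exact ⟨s, 1, .skip s, le_rfl, h⟩
  | assign x e => exact ⟨_, _, .assign x e s, le_rfl, h⟩
  | store a i e => exact ⟨_, _, .store a i e s, le_rfl, h⟩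
  | seq c d ihc ihd => exact (ihc h).seq fun s' _ h' => ihd h'
  | branch b c d ihc ihd =>
    exact branch (fun hb => (ihc (h.1 hb)).imp (le_max_left _ _) fun _ _ h => h)
      (fun hb => (ihd (h.2 hb)).imp (le_max_right _ _) fun _ _ h => h)
  | loop b c => exact h.elim

/-- The invariant is indexed by the number of completed rounds, and each round may have its own time
bound. The induction peels off the first round and shifts both families. -/
theorem loop {b : Test} (Inv : ℕ → Mem → Prop) {N : ℕ} {T : ℕ → ℕ} (h0 : Inv 0 s)
    (hN : ∀ s', Inv N s' → ¬ b.holds s')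
    (hstep : ∀ i s', i < N → Inv i s' → b.holds s' ∧ Runs c s' (T i) (Inv (i + 1))) :
    Runs (.loop b c) s (∑ i ∈ Finset.range N, (T i + b.cost + 1) + (b.cost + 1)) (Inv N) := by
  induction N generalizing s Inv T with
  | zero => exact ⟨s, _, .loop_false (hN s h0), by simp, h0⟩
  | succ N ih =>
    obtain ⟨hb, s₁, t₁, he₁, ht₁, hq₁⟩ := hstep 0 s N.succ_pos h0
    obtain ⟨s₂, t₂, he₂, ht₂, hq₂⟩ := ih (fun i => Inv (i + 1)) (T := fun i => T (i + 1)) hq₁ hN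
      (fun i s' hi h => hstep (i + 1) s' (by omega) h)
    refine ⟨s₂, _, .loop_true hb he₁ he₂, ?_, hq₂⟩
    rw [Finset.sum_range_succ']
    omega

/-- A round adds 10 steps to the body: 6 for the successful test and 4 for the increment. The final
8 are the failing test (6) and the initialization (2). `hinv` is needed since the counter changes
after the body has established the invariant. -/
theorem forLoop' {x y N : ℕ} {T : ℕ → ℕ} (Inv : ℕ → Mem → Prop) (hN : s.var y = N)
    (hx : c.writesVar x = false) (hxy : y ≠ x) (hy : c.writesVar y = false)
    (hinv : ∀ i s' v, Inv i s' → Inv i (s'.setVar x v)) (h0 : Inv 0 s)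
    (hstep : ∀ i s', i < N → s'.var x = i → Frame (Prog.forLoop x y c) s s' → Inv i s' →
      Runs c s' (T i) (Inv (i + 1))) :
    Runs (Prog.forLoop x y c) s (∑ i ∈ Finset.range N, (T i + 10) + 8) (Inv N) := by
  have key : Runs (.loop (.le (.add (.var x) (.const 1)) (.var y))
      (.seq c (.assign x (.add (.var x) (.const 1))))) (s.setVar x 0)
      (∑ i ∈ Finset.range N, (T i + 4 + 5 + 1) + (5 + 1))
      (fun s' => s'.var x = N ∧ Frame (Prog.forLoop x y c) s s' ∧ Inv N s') := by
    refine loop (fun i s' => s'.var x = i ∧ Frame (Prog.forLoop x y c) s s' ∧ Inv i s')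
      (T := fun i => T i + 4) ⟨by simp, ?_, hinv _ _ _ h0⟩ ?_ ?_
    · exact (Exec.assign x (.const 0) s).frame.mono
        (by simp +contextual [Prog.writesVar, Prog.forLoop])
        (by simp +contextual [Prog.writesArr])
    · rintro s' ⟨h1, h2, -⟩
      have := h2.1 y (by simp [Prog.forLoop, Prog.writesVar, hxy.symm, hy])
      simp only [Test.holds, Expr.eval]
      omega
    · rintro i s' hi ⟨h1, h2, h3⟩
      have := h2.1 y (by simp [Prog.forLoop, Prog.writesVar, hxy.symm, hy])
      refine ⟨by simp only [Test.holds, Expr.eval]; omega, ?_⟩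
      refine (hstep i s' hi h1 h2 h3).seq fun s'' hf hq => ?_
      refine ⟨_, _, .assign _ _ _, le_rfl, ?_, ?_, hinv _ _ _ hq⟩
      · simp [Expr.eval, hf.1 x hx, h1]
      · refine h2.trans (Frame.trans (hf.mono ?_ ?_)
          ((Exec.assign x (.add (.var x) (.const 1)) s'').frame.mono ?_ ?_)) <;>
        simp +contextual [Prog.forLoop, Prog.writesVar, Prog.writesArr]
  obtain ⟨s', t, he, ht, -, -, hq⟩ := key
  refine ⟨s', _, .seq (.assign x (.const 0) s) he, ?_, hq⟩
  simp only [Expr.cost]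
  simp only [add_assoc, Nat.reduceAdd] at ht ⊢
  omega

theorem forLoop {x y N : ℕ} (Inv : ℕ → Mem → Prop) (hN : s.var y = N)
    (hx : c.writesVar x = false) (hxy : y ≠ x) (hy : c.writesVar y = false)
    (hinv : ∀ i s' v, Inv i s' → Inv i (s'.setVar x v)) (h0 : Inv 0 s)
    (hstep : ∀ i s', i < N → s'.var x = i → Frame (Prog.forLoop x y c) s s' → Inv i s' →
      Runs c s' T (Inv (i + 1))) :
    Runs (Prog.forLoop x y c) s (N * (T + 10) + 8) (Inv N) := by
  simpa using forLoop' (T := fun _ => T) Inv hN hx hxy hy hinv h0 hstep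

theorem step (h : Runs c s T₁ Q) (h' : ∀ s', Frame c s s' → Q s' → Runs d s' T₂ Q')
    (hT : T₁ + T₂ ≤ T) : Runs (.seq c d) s T Q' :=
  (seq h h').imp hT fun _ _ hq => hq

theorem flat (h : c.wp Q s) (hT : c.flatCost ≤ T) : Runs c s T Q :=
  (of_wp h).imp hT fun _ _ hq => hq

theorem iterate {x y N T' : ℕ} (Inv : ℕ → Mem → Prop) (hN : s.var y = N)
    (hx : c.writesVar x = false) (hxy : y ≠ x) (hy : c.writesVar y = false)
    (hinv : ∀ i s' v, Inv i s' → Inv i (s'.setVar x v)) (h0 : Inv 0 s)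
    (hstep : ∀ i s', i < N → s'.var x = i → Frame (Prog.forLoop x y c) s s' → Inv i s' →
      Runs c s' T (Inv (i + 1)))
    (hT : N * (T + 10) + 8 ≤ T') (hQ : ∀ s', Frame (Prog.forLoop x y c) s s' → Inv N s' → Q s') :
    Runs (Prog.forLoop x y c) s T' Q :=
  (forLoop Inv hN hx hxy hy hinv h0 hstep).imp hT hQ

end Runs

/-! ### Two-block schedules and their dynamic program -/

/-- Total size of the first `i` items. -/
def tot (p : ℕ → ℕ) (i : ℕ) : ℕ := ∑ j ∈ Finset.range i, p j

/-- Total size of the selected ones among the first `i` items. -/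
def pre (p : ℕ → ℕ) (X : ℕ → Bool) (i : ℕ) : ℕ :=
  ∑ j ∈ Finset.range i, if X j then p j else 0

theorem pre_le_tot (p : ℕ → ℕ) (X : ℕ → Bool) (i : ℕ) : pre p X i ≤ tot p i :=
  Finset.sum_le_sum fun j _ => by split <;> simp

theorem pre_congr {p : ℕ → ℕ} {X Y : ℕ → Bool} {i : ℕ} (h : ∀ j < i, X j = Y j) :
    pre p X i = pre p Y i :=
  Finset.sum_congr rfl fun j hj => by rw [h j (Finset.mem_range.1 hj)]

theorem pre_succ (p : ℕ → ℕ) (X : ℕ → Bool) (i : ℕ) :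
    pre p X (i + 1) = pre p X i + if X i then p i else 0 := Finset.sum_range_succ _ _

/-- Cost of the first `i` items when the selected items form a first block, the other ones form a
second block that starts at position `α`, and item `j` at position `s` costs `K j s`. -/
def blockCost (p : ℕ → ℕ) (K : ℕ → ℕ → ℕ) (α : ℕ) (X : ℕ → Bool) (i : ℕ) : ℕ :=
  ∑ j ∈ Finset.range i, K j (if X j then pre p X j else α + (tot p j - pre p X j))

theorem blockCost_succ (p : ℕ → ℕ) (K : ℕ → ℕ → ℕ) (α : ℕ) (X : ℕ → Bool) (i : ℕ) :
    blockCost p K α X (i + 1) = blockCost p K α X i +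
      K i (if X i then pre p X i else α + (tot p i - pre p X i)) := Finset.sum_range_succ _ _

theorem blockCost_congr {p : ℕ → ℕ} {K : ℕ → ℕ → ℕ} {α : ℕ} {X Y : ℕ → Bool} {i : ℕ}
    (h : ∀ j < i, X j = Y j) : blockCost p K α X i = blockCost p K α Y i :=
  Finset.sum_congr rfl fun j hj => by
    have hj := Finset.mem_range.1 hj
    rw [h j hj, pre_congr fun l hl => h l (hl.trans hj)]

/-- The smaller of two values, where `0` stands for infinity. -/
def better (x y : ℕ) : ℕ := if y = 0 ∨ (x ≠ 0 ∧ x ≤ y) then x else y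

/-- `dp α i a` is one more than the least cost of the first `i` items when the first block has
size `a` and the second block starts at position `α`; it is `0` if this is impossible. Only items
with `r j = 0` may be in the first block. -/
def dp (p r : ℕ → ℕ) (K : ℕ → ℕ → ℕ) (α : ℕ) : ℕ → ℕ → ℕ
  | 0, a => if a = 0 then 1 else 0
  | i + 1, a => better
      (if dp p r K α i a = 0 then 0 else dp p r K α i a + K i (α + (tot p i - a)))
      (if r i = 0 ∧ p i ≤ a ∧ dp p r K α i (a - p i) ≠ 0
        then dp p r K α i (a - p i) + K i (a - p i) else 0)

/-- An optimal selection for `dp p r K α i a`. -/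
def trace (p r : ℕ → ℕ) (K : ℕ → ℕ → ℕ) (α : ℕ) : ℕ → ℕ → ℕ → Bool
  | 0, _, _ => false
  | i + 1, a, j =>
    if dp p r K α i a ≠ 0 ∧
        dp p r K α (i + 1) a = dp p r K α i a + K i (α + (tot p i - a)) then
      if j = i then false else trace p r K α i a j
    else
      if j = i then true else trace p r K α i (a - p i) j

section TwoBlock

variable {p r : ℕ → ℕ} {K : ℕ → ℕ → ℕ} {α : ℕ}

/-- No decisions are stored: the last item is left out whenever the entry equals the value of
leaving it out, and otherwise the entry can only come from taking it. -/
theorem trace_spec {i a : ℕ} (h : dp p r K α i a ≠ 0) :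
    pre p (trace p r K α i a) i = a ∧
      blockCost p K α (trace p r K α i a) i + 1 = dp p r K α i a ∧
      ∀ j < i, trace p r K α i a j = true → r j = 0 := by
  induction i generalizing a with
  | zero =>
    have ha : a = 0 := by by_contra ha; simp [dp, ha] at h
    subst ha
    simp [pre, blockCost, dp]
  | succ i ih =>
    by_cases hs : dp p r K α i a ≠ 0 ∧
        dp p r K α (i + 1) a = dp p r K α i a + K i (α + (tot p i - a))
    · obtain ⟨h1, h2, h3⟩ := ih hs.1
      have ht : ∀ j, trace p r K α (i + 1) a j =
          if j = i then false else trace p r K α i a j := fun j => by rw [trace, if_pos hs]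
      have hlt : ∀ j < i, trace p r K α (i + 1) a j = trace p r K α i a j :=
        fun j hj => by rw [ht, if_neg hj.ne]
      have hi : trace p r K α (i + 1) a i = false := by rw [ht, if_pos rfl]
      rw [pre_succ, blockCost_succ, pre_congr hlt, blockCost_congr hlt, hi, h1, hs.2]
      refine ⟨by simp, by simp; omega, fun j hj hj' => ?_⟩
      rw [ht] at hj'
      split at hj'
      · cases hj'
      · exact h3 j (by omega) hj'
    · have ht : ∀ j, trace p r K α (i + 1) a j =
          if j = i then true else trace p r K α i (a - p i) j := fun j => by rw [trace, if_neg hs]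
      have hlt : ∀ j < i, trace p r K α (i + 1) a j = trace p r K α i (a - p i) j :=
        fun j hj => by rw [ht, if_neg hj.ne]
      have hi : trace p r K α (i + 1) a i = true := by rw [ht, if_pos rfl]
      -- A nonzero entry that is not explained by leaving item `i` out must come from a feasible
      -- choice of taking it.
      have key : (r i = 0 ∧ p i ≤ a ∧ dp p r K α i (a - p i) ≠ 0) ∧
          dp p r K α (i + 1) a = dp p r K α i (a - p i) + K i (a - p i) := by
        have h' := h
        rw [dp, better] at h'
        by_cases ha : dp p r K α i a = 0
        · by_cases hc : r i = 0 ∧ p i ≤ a ∧ dp p r K α i (a - p i) ≠ 0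
          · exact ⟨hc, by rw [dp, better, if_neg (by simp [ha, hc]), if_pos hc]⟩
          · simp [ha, hc] at h'
        · have hd : ¬ (dp p r K α (i + 1) a = dp p r K α i a + K i (α + (tot p i - a))) :=
            fun hd => hs ⟨ha, hd⟩
          rw [dp, better, if_neg ha] at hd
          have hc : r i = 0 ∧ p i ≤ a ∧ dp p r K α i (a - p i) ≠ 0 := by
            by_contra hc
            simp [hc] at hd
          refine ⟨hc, ?_⟩
          rw [if_pos hc] at hd
          rw [dp, better, if_neg ha, if_pos hc]
          split at hd
          · exact absurd rfl hd
          · rw [if_neg (by assumption)]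
      obtain ⟨⟨hr, hp, hd⟩, he⟩ := key
      obtain ⟨h1, h2, h3⟩ := ih hd
      rw [pre_succ, blockCost_succ, pre_congr hlt, blockCost_congr hlt, hi, h1, he]
      refine ⟨by simp; omega, by simp; omega, fun j hj hj' => ?_⟩
      rw [ht] at hj'
      split at hj'
      · subst j; exact hr
      · exact h3 j (by omega) hj'

/-- Following the choices of `X` through the recursion never meets infinity, and each step can only
improve on the cost of `X`. -/
theorem dp_le_blockCost {X : ℕ → Bool} {i : ℕ} (hX : ∀ j < i, X j = true → r j = 0) :
    dp p r K α i (pre p X i) ≠ 0 ∧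
      dp p r K α i (pre p X i) ≤ blockCost p K α X i + 1 := by
  induction i with
  | zero => simp [pre, blockCost, dp]
  | succ i ih =>
    obtain ⟨h1, h2⟩ := ih fun j hj => hX j (by omega)
    rw [pre_succ, blockCost_succ]
    cases hx : X i
    · simp only [Bool.false_eq_true, if_false, add_zero]
      rw [dp, if_neg h1, better]
      split_ifs <;> omega
    · have := hX i (by omega) hx
      simp only [if_true]
      rw [dp, Nat.add_sub_cancel,
        if_pos (c := r i = 0 ∧ p i ≤ pre p X i + p i ∧ dp p r K α i (pre p X i) ≠ 0)
          ⟨this, by omega, h1⟩, better]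
      split_ifs <;> omega

/-! ### The cost of an order of the jobs -/

/-- Total weighted starting time when the jobs `0, …, n - 1` are processed in the order of
increasing keys. -/
def startCost (n : ℕ) (p w key : ℕ → ℕ) : ℕ :=
  ∑ j ∈ Finset.range n, w j * ∑ i ∈ Finset.range n, if key i < key j then p i else 0

/-- Key that sorts the jobs by class, and by index within each class. -/
def classKey (n : ℕ) (cls : ℕ → ℕ) (i : ℕ) : ℕ := cls i * n + i

theorem classKey_lt {n : ℕ} {cls : ℕ → ℕ} {i j : ℕ} (hi : i < n) (hj : j < n) :
    classKey n cls i < classKey n cls j ↔ cls i < cls j ∨ cls i = cls j ∧ i < j := by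
  unfold classKey
  rcases lt_trichotomy (cls i) (cls j) with h | h | h
  · have : (cls i + 1) * n ≤ cls j * n := Nat.mul_le_mul_right _ h
    rw [add_mul] at this
    constructor
    · exact fun _ => Or.inl h
    · intro _; omega
  · rw [h]; omega
  · have : (cls j + 1) * n ≤ cls i * n := Nat.mul_le_mul_right _ h
    rw [add_mul] at this
    constructor
    · intro _; omega
    · intro _; omega

theorem sum_range_lt {n m : ℕ} (h : m ≤ n) (f : ℕ → ℕ) :
    ∑ i ∈ Finset.range m, f i = ∑ i ∈ Finset.range n, if i < m then f i else 0 := by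
  rw [← Finset.sum_filter]
  refine Finset.sum_congr ?_ fun _ _ => rfl
  ext i; simp; omega

/-- Together with `sum_range_lt`, this turns all partial block sizes into indicator sums over the
same range, so that identities between them reduce to a case check for each job. -/
theorem sum_range_reflect_ge {n m : ℕ} (h : m ≤ n) (f : ℕ → ℕ) :
    ∑ i ∈ Finset.range m, f (n - 1 - i) = ∑ i ∈ Finset.range n, if n - m ≤ i then f i else 0 := by
  rw [sum_range_lt h (fun i => f (n - 1 - i)),
    ← Finset.sum_range_reflect (fun i => if n - m ≤ i then f i else 0)]
  refine Finset.sum_congr rfl fun i hi => ?_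
  have := Finset.mem_range.1 hi
  by_cases him : i < m
  · rw [if_pos him, if_pos (by omega)]
  · rw [if_neg him, if_neg (by omega)]

/-- Item costs of the part before the split: weighted starting times. -/
def costL (w : ℕ → ℕ) (j s : ℕ) : ℕ := w j * s

/-- Item costs of the part after the split, whose items are taken in reverse order. -/
def costR (n : ℕ) (p w : ℕ → ℕ) (j s : ℕ) : ℕ :=
  w (n - 1 - j) * (tot p n - p (n - 1 - j) - s)

/-- The sequence of items in reverse order. -/
def rev (n : ℕ) (p : ℕ → ℕ) (j : ℕ) : ℕ := p (n - 1 - j)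

/-- Class `0` before the split `k`, class `2` from `k` on, class `1` anywhere. -/
structure IsSplit (n k : ℕ) (cls : ℕ → ℕ) : Prop where
  le : k ≤ n
  le_two : ∀ i < n, cls i ≤ 2
  zero : ∀ i < n, cls i = 0 → i < k
  two : ∀ i < n, cls i = 2 → k ≤ i

theorem IsSplit.sum_one {n k : ℕ} {cls p : ℕ → ℕ} (h : IsSplit n k cls) :
    (∑ i ∈ Finset.range n, if cls i = 1 then p i else 0) + pre p (fun i => cls i == 0) k +
      pre (rev n p) (fun i => cls (n - 1 - i) == 2) (n - k) = tot p n := by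
  have hk := h.le
  unfold pre rev tot
  rw [sum_range_lt hk,
    sum_range_reflect_ge (Nat.sub_le n k) (fun i => if cls i == 2 then p i else 0),
    Nat.sub_sub_self hk, ← Finset.sum_add_distrib, ← Finset.sum_add_distrib]
  refine Finset.sum_congr rfl fun i hi => ?_
  have hi := Finset.mem_range.1 hi
  have h1 := h.le_two i hi
  have h2 := h.zero i hi
  have h3 := h.two i hi
  simp only [beq_iff_eq]
  split_ifs <;> omega

/-- With `α` and `y` the sizes of classes `0` and `2`, a class-`0` job is preceded by the earlier
jobs of its class, and a class-`1` job below `k` by `α` and the earlier class-`1` jobs, all of which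
are below `k`. From `k` on, count backwards: a class-`2` job is followed by the later jobs of its
class, a class-`1` job by `y` and the later class-`1` jobs. So neither part needs to know the
choices in the other. -/
theorem IsSplit.startCost_eq {n k : ℕ} {cls p w : ℕ → ℕ} (h : IsSplit n k cls) :
    startCost n p w (classKey n cls) =
      blockCost p (costL w) (pre p (fun i => cls i == 0) k) (fun i => cls i == 0) k +
      blockCost (rev n p) (costR n p w) (pre (rev n p) (fun i => cls (n - 1 - i) == 2) (n - k))
        (fun i => cls (n - 1 - i) == 2) (n - k) := by
  have hk := h.le
  have hR : blockCost (rev n p) (costR n p w)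
      (pre (rev n p) (fun i => cls (n - 1 - i) == 2) (n - k))
        (fun i => cls (n - 1 - i) == 2) (n - k) =
      ∑ j ∈ Finset.range (n - k), w (n - 1 - j) *
        ∑ i ∈ Finset.range n, if classKey n cls i < classKey n cls (n - 1 - j) then p i else 0 := by
    refine Finset.sum_congr rfl fun j' hj' => ?_
    have hj' := Finset.mem_range.1 hj'
    unfold costR
    congr 1
    obtain ⟨j, hj, rfl⟩ : ∃ j, j < n ∧ j' = n - 1 - j := ⟨n - 1 - j', by omega, by omega⟩
    have hkj : k ≤ j := by omega
    have hjj : n - 1 - (n - 1 - j) = j := by omega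
    simp only [hjj]
    have hle := pre_le_tot (rev n p) (fun i => cls (n - 1 - i) == 2) (n - 1 - j)
    have hm : n - 1 - j ≤ n := by omega
    have hnm : n - (n - 1 - j) = j + 1 := by omega
    have epre : pre (rev n p) (fun i => cls (n - 1 - i) == 2) (n - 1 - j) =
        ∑ i ∈ Finset.range n, if j + 1 ≤ i then (if cls i == 2 then p i else 0) else 0 := by
      unfold pre rev
      rw [sum_range_reflect_ge hm (fun i => if cls i == 2 then p i else 0), hnm]
    have etot : tot (rev n p) (n - 1 - j) =
        ∑ i ∈ Finset.range n, if j + 1 ≤ i then p i else 0 := by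
      unfold tot rev
      rw [sum_range_reflect_ge hm p, hnm]
    have ey : pre (rev n p) (fun i => cls (n - 1 - i) == 2) (n - k) =
        ∑ i ∈ Finset.range n, if k ≤ i then (if cls i == 2 then p i else 0) else 0 := by
      unfold pre rev
      rw [sum_range_reflect_ge (Nat.sub_le n k) (fun i => if cls i == 2 then p i else 0),
        Nat.sub_sub_self hk]
    have ej : p j = ∑ i ∈ Finset.range n, if i = j then p i else 0 := by
      rw [Finset.sum_ite_eq' _ _ p, if_pos (Finset.mem_range.2 hj)]
    have h0 := h.zero j hj
    have h2 := h.le_two j hj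
    by_cases hc : cls j = 2
    · simp only [hc, beq_self_eq_true, if_true]
      -- Work before the job, the job itself and work after it add up to the total. The additive
      -- form avoids truncated subtraction and can be checked term by term.
      have : (∑ i ∈ Finset.range n, if classKey n cls i < classKey n cls j then p i else 0) + p j +
          pre (rev n p) (fun i => cls (n - 1 - i) == 2) (n - 1 - j) = tot p n := by
        rw [epre, ej, tot, ← Finset.sum_add_distrib, ← Finset.sum_add_distrib]
        refine Finset.sum_congr rfl fun i hi => ?_
        have hi := Finset.mem_range.1 hi
        have h1 := h.le_two i hi
        rw [if_congr (classKey_lt hi hj) rfl rfl]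
        simp only [beq_iff_eq]
        rcases eq_or_ne i j with rfl | hij <;> split_ifs <;> omega
      omega
    · have hc1 : cls j = 1 := by omega
      simp only [hc1, show ((1 : ℕ) == 2) = false from rfl, Bool.false_eq_true, if_false]
      have : (∑ i ∈ Finset.range n, if classKey n cls i < classKey n cls j then p i else 0) + p j +
          pre (rev n p) (fun i => cls (n - 1 - i) == 2) (n - k) + tot (rev n p) (n - 1 - j) =
          tot p n + pre (rev n p) (fun i => cls (n - 1 - i) == 2) (n - 1 - j) := by
        rw [epre, ej, ey, etot, tot, ← Finset.sum_add_distrib, ← Finset.sum_add_distrib,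
          ← Finset.sum_add_distrib, ← Finset.sum_add_distrib]
        refine Finset.sum_congr rfl fun i hi => ?_
        have hi := Finset.mem_range.1 hi
        have h1 := h.le_two i hi
        have h3 := h.zero i hi
        have h4 := h.two i hi
        rw [if_congr (classKey_lt hi hj) rfl rfl]
        simp only [beq_iff_eq]
        rcases eq_or_ne i j with rfl | hij <;> split_ifs <;> omega
      omega
  have hL : blockCost p (costL w) (pre p (fun i => cls i == 0) k) (fun i => cls i == 0) k =
      ∑ j ∈ Finset.range k, w j *
        ∑ i ∈ Finset.range n, if classKey n cls i < classKey n cls j then p i else 0 := by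
    refine Finset.sum_congr rfl fun j hj => ?_
    have hjk := Finset.mem_range.1 hj
    have hj : j < n := by omega
    unfold costL
    congr 1
    have hle := pre_le_tot p (fun i => cls i == 0) j
    have epre : pre p (fun i => cls i == 0) j =
        ∑ i ∈ Finset.range n, if i < j then (if cls i == 0 then p i else 0) else 0 :=
      sum_range_lt hj.le _
    have etot : tot p j = ∑ i ∈ Finset.range n, if i < j then p i else 0 := sum_range_lt hj.le _
    have ea : pre p (fun i => cls i == 0) k =
        ∑ i ∈ Finset.range n, if i < k then (if cls i == 0 then p i else 0) else 0 :=
      sum_range_lt hk _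
    have h0 := h.two j hj
    have h2 := h.le_two j hj
    by_cases hc : cls j = 0
    · simp only [hc, beq_self_eq_true, if_true]
      rw [epre]
      refine Finset.sum_congr rfl fun i hi => ?_
      have hi := Finset.mem_range.1 hi
      rw [if_congr (classKey_lt hi hj) rfl rfl]
      simp only [beq_iff_eq]
      split_ifs <;> omega
    · have hc1 : cls j = 1 := by omega
      simp only [hc1, show ((1 : ℕ) == 0) = false from rfl, Bool.false_eq_true, if_false]
      have : (∑ i ∈ Finset.range n, if classKey n cls i < classKey n cls j then p i else 0) +
          pre p (fun i => cls i == 0) j = pre p (fun i => cls i == 0) k + tot p j := by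
        rw [epre, ea, etot, ← Finset.sum_add_distrib, ← Finset.sum_add_distrib]
        refine Finset.sum_congr rfl fun i hi => ?_
        have hi := Finset.mem_range.1 hi
        have h1 := h.le_two i hi
        have h3 := h.zero i hi
        have h4 := h.two i hi
        rw [if_congr (classKey_lt hi hj) rfl rfl]
        simp only [beq_iff_eq]
        split_ifs <;> omega
      omega
  rw [hL, hR, startCost, sum_range_lt hk, sum_range_reflect_ge (Nat.sub_le n k) (fun j => w j *
        ∑ i ∈ Finset.range n, if classKey n cls i < classKey n cls j then p i else 0),
    Nat.sub_sub_self hk, ← Finset.sum_add_distrib]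
  refine Finset.sum_congr rfl fun j hj => ?_
  split_ifs <;> omega

/-! ### Optimality of split schedules -/

theorem exists_threshold {n : ℕ} {g : ℕ → Prop} (h : ∀ i j, i < j → j < n → g j → g i) :
    ∃ k ≤ n, ∀ i < n, g i ↔ i < k := by
  induction n with
  | zero => exact ⟨0, le_rfl, by simp⟩
  | succ n ih =>
    obtain ⟨k, hk, hg⟩ := ih fun i j hij hj => h i j hij (by omega)
    by_cases hn : g n
    · refine ⟨n + 1, le_rfl, fun i hi => iff_of_true ?_ hi⟩
      rcases Nat.lt_succ_iff_lt_or_eq.1 hi with hi | rfl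
      · exact h i n hi (by omega) hn
      · exact hn
    · refine ⟨k, by omega, fun i hi => ?_⟩
      rcases Nat.lt_succ_iff_lt_or_eq.1 hi with hi | rfl
      · exact hg i hi
      · exact iff_of_false hn (by omega)

/-- Jobs sorted by nonincreasing ratio of weight and processing time, those with processing time
`0` first. -/
def RatioSorted (n : ℕ) (p w : ℕ → ℕ) : Prop :=
  ∀ i j, i < j → j < n → p i * w j ≤ p j * w i ∧ (p j = 0 → p i = 0)

/-- Cost that the pair `i, j` contributes if `i` is processed before `j`. -/
def pairCost (p w key : ℕ → ℕ) (i j : ℕ) : ℕ := if key i < key j then p i * w j else 0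

theorem startCost_eq_sum (n : ℕ) (p w key : ℕ → ℕ) :
    startCost n p w key = ∑ i ∈ Finset.range n, ∑ j ∈ Finset.range n, pairCost p w key i j := by
  rw [Finset.sum_comm, startCost]
  refine Finset.sum_congr rfl fun j _ => ?_
  rw [Finset.mul_sum]
  refine Finset.sum_congr rfl fun i _ => ?_
  rw [pairCost, mul_ite, mul_zero, mul_comm]

/-- Doubling avoids choosing an orientation for unordered pairs. The first sum on the right holds
the pairs on one side of `B`, the second the pairs that `B` separates. -/
theorem two_mul_sum_pairs (n : ℕ) (B : ℕ → Bool) (c : ℕ → ℕ → ℕ) :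
    2 * ∑ i ∈ Finset.range n, ∑ j ∈ Finset.range n, c i j =
      ∑ i ∈ Finset.range n, ∑ j ∈ Finset.range n, (if B i = B j then c i j + c j i else 0) +
      2 * ∑ i ∈ Finset.range n, if B i then 0 else
        ∑ j ∈ Finset.range n, if B j then c i j + c j i else 0 := by
  have h1 : ∑ i ∈ Finset.range n, (if B i then 0 else
        ∑ j ∈ Finset.range n, if B j then c i j + c j i else 0) =
      ∑ i ∈ Finset.range n, ∑ j ∈ Finset.range n,
        if ¬ B i ∧ B j then c i j + c j i else 0 := by
    refine Finset.sum_congr rfl fun i _ => ?_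
    cases B i <;> simp
  have h2 : ∑ i ∈ Finset.range n, ∑ j ∈ Finset.range n,
        (if ¬ B i ∧ B j then c i j + c j i else 0) =
      ∑ i ∈ Finset.range n, ∑ j ∈ Finset.range n,
        if B i ∧ ¬ B j then c i j + c j i else 0 := by
    rw [Finset.sum_comm]
    refine Finset.sum_congr rfl fun i _ => Finset.sum_congr rfl fun j _ => ?_
    cases B i <;> cases B j <;> simp [add_comm]
  have h3 : ∑ i ∈ Finset.range n, ∑ j ∈ Finset.range n, c i j =
      ∑ i ∈ Finset.range n, ∑ j ∈ Finset.range n, c j i := Finset.sum_comm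
  rw [h1, two_mul, two_mul]
  nth_rewrite 2 [h2]
  nth_rewrite 2 [h3]
  simp only [← Finset.sum_add_distrib]
  refine Finset.sum_congr rfl fun i _ => Finset.sum_congr rfl fun j _ => ?_
  cases B i <;> cases B j <;> simp

/-- An exchange argument done for all pairs at once: `B` acts on the outside jobs as a single job of
size `pB` and weight `wB`, so the threshold of the ratio `wB / pB` tells which of them should
precede it. -/
theorem exists_isSplit_startCost_le {n : ℕ} {p w key : ℕ → ℕ} (hs : RatioSorted n p w)
    (hkey : ∀ i < n, ∀ j < n, key i = key j → i = j) (B : ℕ → Bool)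
    (hB : ∀ c < n, B c = false → (∀ b < n, B b = true → key c < key b) ∨
      ∀ b < n, B b = true → key b < key c) :
    ∃ k cls, IsSplit n k cls ∧ (∀ i < n, cls i = 1 ↔ B i = true) ∧
      startCost n p w (classKey n cls) ≤ startCost n p w key := by
  set pB := ∑ i ∈ Finset.range n, if B i then p i else 0 with hpB
  set wB := ∑ i ∈ Finset.range n, if B i then w i else 0 with hwB
  -- The condition says that the job's ratio is at least that of the block, hence it passes to
  -- earlier jobs. Cancelling `p j` fails for `p j = 0`, which is why `RatioSorted` also puts jobs
  -- of processing time `0` first.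
  have hdown : ∀ i j, i < j → j < n → p j * wB ≤ pB * w j → p i * wB ≤ pB * w i := by
    intro i j hij hj h
    obtain ⟨h1, h2⟩ := hs i j hij hj
    rcases Nat.eq_zero_or_pos (p j) with h0 | h0
    · simp [h2 h0]
    · refine Nat.le_of_mul_le_mul_left ?_ h0
      calc p j * (p i * wB) = p i * (p j * wB) := by ring
        _ ≤ p i * (pB * w j) := Nat.mul_le_mul_left _ h
        _ = pB * (p i * w j) := by ring
        _ ≤ pB * (p j * w i) := Nat.mul_le_mul_left _ h1
        _ = p j * (pB * w i) := by ring
  obtain ⟨k, hk, hthr⟩ := exists_threshold hdown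
  set cls : ℕ → ℕ := fun i => if B i then 1 else if i < k then 0 else 2 with hcls
  have c1 : ∀ i, B i = true → cls i = 1 := fun i h => by simp [hcls, h]
  have c0 : ∀ i, B i = false → i < k → cls i = 0 := fun i h h' => by simp [hcls, h, h']
  have c2 : ∀ i, B i = false → ¬ i < k → cls i = 2 := fun i h h' => by simp [hcls, h, h']
  refine ⟨k, cls, ⟨hk, ?_, ?_, ?_⟩, ?_, ?_⟩
  · intro i _; simp only [hcls]; split_ifs <;> omega
  · intro i _ h; simp only [hcls] at h; split_ifs at h; assumption
  · intro i _ h; simp only [hcls] at h; split_ifs at h <;> omega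
  · intro i _; cases hb : B i <;> by_cases hik : i < k <;> simp [hcls, hb, hik]
  have key_same : ∀ i < n, ∀ j < n, B i = B j →
      pairCost p w (classKey n cls) i j + pairCost p w (classKey n cls) j i ≤
        pairCost p w key i j + pairCost p w key j i := by
    have aux : ∀ i < n, ∀ j < n, B i = B j → i < j →
        pairCost p w (classKey n cls) i j + pairCost p w (classKey n cls) j i ≤
          pairCost p w key i j + pairCost p w key j i := by
      intro i hi j hj hij hlt
      have hcl : cls i ≤ cls j := by
        simp only [hcls, hij]
        split_ifs <;> omega
      have h1 := (hs i j hlt hj).1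
      unfold pairCost
      rw [if_pos ((classKey_lt hi hj).2 (by omega)),
        if_neg (c := classKey n cls j < classKey n cls i)
          (fun h => by have := (classKey_lt hj hi).1 h; omega)]
      have := hkey i hi j hj
      split_ifs <;> omega
    intro i hi j hj hij
    rcases lt_trichotomy i j with h | rfl | h
    · exact aux i hi j hj hij h
    · simp [pairCost]
    · have := aux j hj i hi hij.symm h
      omega
  -- The joint cost of an outside job with all of `B` depends only on the side on which it lies: `p
  -- i * wB` before, `pB * w i` after.
  have hcross : ∀ i < n, B i = false → ∀ key' : ℕ → ℕ,
      ((∀ b < n, B b = true → key' i < key' b) →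
        (∑ j ∈ Finset.range n, if B j then pairCost p w key' i j + pairCost p w key' j i else 0) =
          p i * wB) ∧
      ((∀ b < n, B b = true → key' b < key' i) →
        (∑ j ∈ Finset.range n, if B j then pairCost p w key' i j + pairCost p w key' j i else 0) =
          pB * w i) := by
    intro i hi hBi key'
    constructor <;> intro h
    · rw [hwB, Finset.mul_sum]
      refine Finset.sum_congr rfl fun j hj => ?_
      cases hb : B j
      · simp
      · have := h j (Finset.mem_range.1 hj) hb
        simp [pairCost, this, this.le]
    · rw [hpB, Finset.sum_mul]
      refine Finset.sum_congr rfl fun j hj => ?_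
      cases hb : B j
      · simp
      · have := h j (Finset.mem_range.1 hj) hb
        simp [pairCost, this, this.le]
  have hmain : 2 * startCost n p w (classKey n cls) ≤ 2 * startCost n p w key := by
    rw [startCost_eq_sum, startCost_eq_sum, two_mul_sum_pairs n B, two_mul_sum_pairs n B]
    refine Nat.add_le_add (Finset.sum_le_sum fun i hi => Finset.sum_le_sum fun j hj => ?_)
      (Nat.mul_le_mul_left _ (Finset.sum_le_sum fun i hi => ?_))
    · split_ifs with h
      · exact key_same i (Finset.mem_range.1 hi) j (Finset.mem_range.1 hj) h
      · exact le_rfl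
    · have hi := Finset.mem_range.1 hi
      cases hBi : B i
      · simp only [Bool.false_eq_true, if_false]
        have hk' : (∑ j ∈ Finset.range n, if B j then
            pairCost p w (classKey n cls) i j + pairCost p w (classKey n cls) j i else 0) =
            if i < k then p i * wB else pB * w i := by
          split_ifs with h
          · refine (hcross i hi hBi _).1 fun b hb hBb => (classKey_lt hi hb).2 ?_
            rw [c0 i hBi h, c1 b hBb]; omega
          · refine (hcross i hi hBi _).2 fun b hb hBb => (classKey_lt hb hi).2 ?_
            rw [c2 i hBi h, c1 b hBb]; omega
        have hi' := hthr i hi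
        rw [hk']
        rcases hB i hi hBi with h | h
        · rw [(hcross i hi hBi key).1 h]
          split_ifs <;> omega
        · rw [(hcross i hi hBi key).2 h]
          split_ifs with h'
          · exact hi'.2 h'
          · exact le_rfl
      · simp
  omega

end TwoBlock

/-! ### Sorting by rank -/

/-- Strict total order of the jobs by nonincreasing ratio of weight and processing time, those
with processing time `0` first, ties broken by index. -/
def Prec (p w : ℕ → ℕ) (i j : ℕ) : Prop :=
  (p i = 0 ∧ (p j ≠ 0 ∨ i < j)) ∨
    (p i ≠ 0 ∧ p j ≠ 0 ∧ (w j * p i < w i * p j ∨ (w j * p i = w i * p j ∧ i < j)))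

open Classical in
/-- Position of job `j` in the sorted order. -/
noncomputable def rank (n : ℕ) (p w : ℕ → ℕ) (j : ℕ) : ℕ :=
  ((Finset.range n).filter fun i => Prec p w i j).card

theorem Prec.irrefl (p w : ℕ → ℕ) (i : ℕ) : ¬ Prec p w i i := by
  unfold Prec; omega

theorem Prec.total (p w : ℕ → ℕ) {i j : ℕ} (h : i ≠ j) : Prec p w i j ∨ Prec p w j i := by
  unfold Prec; omega

/-- For positive processing times, each cross-multiplied comparison is scaled by the processing time
missing from it, and that of the middle job is cancelled. -/
theorem Prec.trans {p w : ℕ → ℕ} {i j k : ℕ} (h : Prec p w i j) (h' : Prec p w j k) :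
    Prec p w i k := by
  unfold Prec at *
  rcases h with ⟨hi, h⟩ | ⟨hi, hj, h⟩
  · rcases h' with ⟨hj', h'⟩ | ⟨hj', hk, h'⟩ <;> omega
  rcases h' with ⟨hj', h'⟩ | ⟨_, hk, h'⟩
  · exact absurd hj' hj
  refine Or.inr ⟨hi, hk, ?_⟩
  have pi := Nat.pos_of_ne_zero hi
  have pj := Nat.pos_of_ne_zero hj
  have pk := Nat.pos_of_ne_zero hk
  have e1 : w k * p i * p j = w k * p j * p i := by ring
  have e2 : w j * p k * p i = w j * p i * p k := by ring
  have e3 : w i * p j * p k = w i * p k * p j := by ring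
  rcases h with h | ⟨h, hij⟩ <;> rcases h' with h' | ⟨h', hjk⟩
  · left
    refine Nat.lt_of_mul_lt_mul_right (a := p j) ?_
    have a1 := Nat.mul_lt_mul_of_pos_right h' pi
    have a2 := Nat.mul_lt_mul_of_pos_right h pk
    omega
  · left
    refine Nat.lt_of_mul_lt_mul_right (a := p j) ?_
    have a1 := congrArg (· * p i) h'
    have a2 := Nat.mul_lt_mul_of_pos_right h pk
    omega
  · left
    refine Nat.lt_of_mul_lt_mul_right (a := p j) ?_
    have a1 := Nat.mul_lt_mul_of_pos_right h' pi
    have a2 := congrArg (· * p k) h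
    omega
  · right
    refine ⟨Nat.eq_of_mul_eq_mul_right pj ?_, hij.trans hjk⟩
    have a1 := congrArg (· * p i) h'
    have a2 := congrArg (· * p k) h
    omega

theorem rank_lt_rank {n : ℕ} {p w : ℕ → ℕ} {i j : ℕ} (hi : i < n) (h : Prec p w i j) :
    rank n p w i < rank n p w j := by
  classical
  refine Finset.card_lt_card ((Finset.ssubset_iff_of_subset fun l hl => ?_).2 ⟨i, ?_, ?_⟩)
  · rw [Finset.mem_filter] at hl ⊢
    exact ⟨hl.1, hl.2.trans h⟩
  · exact Finset.mem_filter.2 ⟨Finset.mem_range.2 hi, h⟩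
  · exact fun hm => Prec.irrefl p w i (Finset.mem_filter.1 hm).2

theorem rank_injOn {n : ℕ} {p w : ℕ → ℕ} {i j : ℕ} (hi : i < n) (hj : j < n)
    (h : rank n p w i = rank n p w j) : i = j := by
  by_contra hij
  rcases Prec.total p w hij with h' | h'
  · exact (rank_lt_rank hi h').ne h
  · exact (rank_lt_rank hj h').ne' h

theorem rank_lt {n : ℕ} {p w : ℕ → ℕ} {j : ℕ} (hj : j < n) : rank n p w j < n := by
  classical
  have : rank n p w j < (Finset.range n).card := by
    refine Finset.card_lt_card ((Finset.ssubset_iff_of_subset (Finset.filter_subset _ _)).2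
      ⟨j, Finset.mem_range.2 hj, fun hm => Prec.irrefl p w j (Finset.mem_filter.1 hm).2⟩)
  simpa using this

/-- `o 0, …, o (n - 1)` are the jobs `0, …, n - 1` in sorted order. -/
structure SortedOrder (n : ℕ) (p w o : ℕ → ℕ) : Prop where
  lt : ∀ i < n, o i < n
  inj : ∀ i < n, ∀ j < n, o i = o j → i = j
  sorted : RatioSorted n (fun i => p (o i)) (fun i => w (o i))

/-- The rank is injective from the jobs to the positions, hence bijective by counting, so `o` is its
inverse and lists the jobs along `Prec`. -/
theorem sortedOrder_of_rank {n : ℕ} {p w o : ℕ → ℕ} (h : ∀ j < n, o (rank n p w j) = j) :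
    SortedOrder n p w o := by
  have hsurj : ∀ i < n, ∃ j < n, rank n p w j = i := by
    intro i hi
    have := Finset.surj_on_of_inj_on_of_card_le (s := Finset.range n) (t := Finset.range n)
      (fun j _ => rank n p w j) (fun j hj => Finset.mem_range.2 (rank_lt (Finset.mem_range.1 hj)))
      (fun a b ha hb hab => rank_injOn (Finset.mem_range.1 ha) (Finset.mem_range.1 hb) hab)
      le_rfl i (Finset.mem_range.2 hi)
    obtain ⟨j, hj, rfl⟩ := this
    exact ⟨j, Finset.mem_range.1 hj, rfl⟩
  have hr : ∀ i < n, o i < n ∧ rank n p w (o i) = i := by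
    intro i hi
    obtain ⟨j, hj, rfl⟩ := hsurj i hi
    rw [h j hj]
    exact ⟨hj, rfl⟩
  refine ⟨fun i hi => (hr i hi).1, fun i hi j hj hij => ?_, fun i j hij hj => ?_⟩
  · rw [← (hr i hi).2, hij, (hr j hj).2]
  · have hi := hij.trans hj
    have hne : o i ≠ o j := fun he => by
      have := (hr i hi).2
      rw [he, (hr j hj).2] at this
      omega
    rcases Prec.total p w hne with hp | hp
    · unfold Prec at hp
      rcases hp with ⟨h0, -⟩ | ⟨h0, h1, h2⟩
      · simp [h0]
      · refine ⟨?_, fun h => absurd h h1⟩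
        show p (o i) * w (o j) ≤ p (o j) * w (o i)
        rw [mul_comm, mul_comm (p (o j))]
        omega
    · have := rank_lt_rank (n := n) (hr j hj).1 hp
      rw [(hr i hi).2, (hr j hj).2] at this
      omega

theorem SortedOrder.image {n : ℕ} {p w o : ℕ → ℕ} (h : SortedOrder n p w o) :
    (Finset.range n).image o = Finset.range n := by
  refine Finset.eq_of_subset_of_card_le (fun j hj => ?_) ?_
  · obtain ⟨i, hi, rfl⟩ := Finset.mem_image.1 hj
    exact Finset.mem_range.2 (h.lt i (Finset.mem_range.1 hi))
  · rw [Finset.card_image_of_injOn]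
    intro i hi j hj hij
    exact h.inj i (by simpa using hi) j (by simpa using hj) hij

theorem SortedOrder.exists_eq {n : ℕ} {p w o : ℕ → ℕ} (h : SortedOrder n p w o) {j : ℕ}
    (hj : j < n) : ∃ i < n, o i = j := by
  have := Finset.mem_range.2 hj
  rw [← h.image] at this
  obtain ⟨i, hi, rfl⟩ := Finset.mem_image.1 this
  exact ⟨i, Finset.mem_range.1 hi, rfl⟩

theorem SortedOrder.sum_comp {n : ℕ} {p w o : ℕ → ℕ} (h : SortedOrder n p w o) (g : ℕ → ℕ) :
    ∑ i ∈ Finset.range n, g (o i) = ∑ j ∈ Finset.range n, g j := by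
  nth_rewrite 2 [← h.image]
  rw [Finset.sum_image]
  intro i hi j hj hij
  exact h.inj i (by simpa using hi) j (by simpa using hj) hij

/-! ### Sequences of an instance in terms of the sorted jobs -/

namespace Inst

variable {I : Inst}

theorem input_time (I : Inst) (j : Fin I.n) : I.input.arr 0 j = I.p j := by simp [input]

theorem input_weight (I : Inst) (j : Fin I.n) : I.input.arr 1 j = I.w j := by simp [input]

theorem input_needs (I : Inst) (j : Fin I.n) : I.input.arr 2 j = if j ∈ I.R then 1 else 0 := by
  simp [input]

theorem P_eq (I : Inst) : I.P = tot (I.input.arr 0) I.n := by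
  simp only [P, tot, Finset.sum_range, input_time]

/-- Position of job `j` in the sequence. -/
def position (σ : I.Sequence) (j : ℕ) : ℕ := if h : j < I.n then σ.symm ⟨j, h⟩ else 0

theorem position_coe (σ : I.Sequence) (j : Fin I.n) : position σ j = σ.symm j := by simp [position]

theorem position_inj (σ : I.Sequence) {i j : ℕ} (hi : i < I.n) (hj : j < I.n)
    (h : position σ i = position σ j) : i = j := by
  simp only [position, hi, hj, dif_pos] at h
  have := σ.symm.injective (Fin.ext h)
  simpa using this

theorem completion_eq (σ : I.Sequence) (j : Fin I.n) :
    completion σ j = ∑ i ∈ Finset.range I.n,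
      if position σ i ≤ position σ j then I.input.arr 0 i else 0 := by
  rw [Finset.sum_range, completion, Finset.sum_filter,
    ← Equiv.sum_comp σ (fun i : Fin I.n => if position σ i ≤ position σ j then _ else _)]
  refine Finset.sum_congr rfl fun k _ => ?_
  rw [position_coe, position_coe, input_time, Equiv.symm_apply_apply]
  rfl

theorem completion_eq_add (σ : I.Sequence) (j : Fin I.n) :
    completion σ j = (∑ i ∈ Finset.range I.n,
      if position σ i < position σ j then I.input.arr 0 i else 0) + I.p j := by
  have : I.p j = ∑ i ∈ Finset.range I.n, if i = (j : ℕ) then I.input.arr 0 i else 0 := by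
    rw [Finset.sum_ite_eq' _ _ (I.input.arr 0), if_pos (Finset.mem_range.2 j.2), input_time]
  rw [completion_eq, this, ← Finset.sum_add_distrib]
  refine Finset.sum_congr rfl fun i hi => ?_
  have := position_inj σ (Finset.mem_range.1 hi) j.2
  rcases eq_or_ne i (j : ℕ) with rfl | hij
  · simp
  · have : position σ i ≠ position σ j := fun h => hij (this h)
    simp only [hij, if_false, add_zero]
    split_ifs <;> omega

/-- The part of the total weighted completion time that does not depend on the sequence. -/
def constCost (I : Inst) : ℕ := ∑ j, I.w j * I.p j

/-- A completion time is a starting time plus the job's own processing time, and reindexing by `o`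
does not change sums over all jobs. -/
theorem twc_eq {o : ℕ → ℕ} (ho : SortedOrder I.n (I.input.arr 0) (I.input.arr 1) o)
    (σ : I.Sequence) :
    twc σ = startCost I.n (fun i => I.input.arr 0 (o i)) (fun i => I.input.arr 1 (o i))
      (fun i => position σ (o i)) + constCost I := by
  have h1 : ∀ j, ∑ i ∈ Finset.range I.n,
      (if position σ (o i) < position σ (o j) then I.input.arr 0 (o i) else 0) =
      ∑ i ∈ Finset.range I.n, if position σ i < position σ (o j) then I.input.arr 0 i else 0 :=
    fun j => ho.sum_comp fun i => if position σ i < position σ (o j) then I.input.arr 0 i else 0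
  simp only [startCost, h1]
  rw [ho.sum_comp fun j => I.input.arr 1 j * ∑ i ∈ Finset.range I.n,
    if position σ i < position σ j then I.input.arr 0 i else 0, Finset.sum_range, twc, constCost,
    ← Finset.sum_add_distrib]
  refine Finset.sum_congr rfl fun j _ => ?_
  rw [completion_eq_add, mul_add, input_weight]

end Inst

/-! ### Values of split schedules -/

/-- The dynamic program for the part before the split. -/
def dpL (p w r : ℕ → ℕ) : ℕ → ℕ → ℕ → ℕ := dp p r (costL w)

/-- The dynamic program for the part after the split. -/
def dpR (n : ℕ) (p w r : ℕ → ℕ) : ℕ → ℕ → ℕ → ℕ := dp (rev n p) (rev n r) (costR n p w)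

/-- The dynamic programs give the value `v` for the split `k`, first block of size `α`, last block
of size `y` and middle block of size `e`. -/
def IsValueAt (n : ℕ) (p w r : ℕ → ℕ) (k α y e v : ℕ) : Prop :=
  k ≤ n ∧ α + y + e = tot p n ∧ dpL p w r α k α ≠ 0 ∧ dpR n p w r y (n - k) y ≠ 0 ∧
    v = dpL p w r α k α + dpR n p w r y (n - k) y

/-- Some split schedule with middle block of size `e` has value `v`. -/
def IsValue (n : ℕ) (p w r : ℕ → ℕ) (e v : ℕ) : Prop := ∃ k α y, IsValueAt n p w r k α y e v

/-- The classes of an optimal split schedule. -/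
def splitClass (n : ℕ) (p w r : ℕ → ℕ) (k α y i : ℕ) : ℕ :=
  if i < k then if trace p r (costL w) α k α i then 0 else 1
  else if trace (rev n p) (rev n r) (costR n p w) y (n - k) y (n - 1 - i) then 2 else 1

/-- Total size of the middle block. -/
def midSize (n : ℕ) (p cls : ℕ → ℕ) : ℕ := ∑ i ∈ Finset.range n, if cls i = 1 then p i else 0

/-- Values are attained: the two backtracked selections fit together into one split schedule. Each
of the two table entries exceeds its cost by one, whence the `+ 2`. -/
theorem splitClass_spec {n : ℕ} {p w r : ℕ → ℕ} {k α y e v : ℕ}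
    (h : IsValueAt n p w r k α y e v) :
    IsSplit n k (splitClass n p w r k α y) ∧
      (∀ i < n, r i ≠ 0 → splitClass n p w r k α y i = 1) ∧
      midSize n p (splitClass n p w r k α y) = e ∧
      startCost n p w (classKey n (splitClass n p w r k α y)) + 2 = v := by
  obtain ⟨hk, he, hl, hr, rfl⟩ := h
  obtain ⟨l1, l2, l3⟩ := trace_spec hl
  obtain ⟨r1, r2, r3⟩ := trace_spec hr
  set cls := splitClass n p w r k α y with hcls
  have hs : IsSplit n k cls := by
    refine ⟨hk, fun i hi => ?_, fun i hi => ?_, fun i hi => ?_⟩ <;>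
      rw [hcls, splitClass] <;> split_ifs <;> first | omega | exact False.elim
  have eX : ∀ i < k, (cls i == 0) = trace p r (costL w) α k α i := by
    intro i hi
    rw [hcls, splitClass, if_pos hi]
    cases trace p r (costL w) α k α i <;> rfl
  have eY : ∀ i < n - k, (cls (n - 1 - i) == 2) =
      trace (rev n p) (rev n r) (costR n p w) y (n - k) y i := by
    intro i hi
    rw [hcls, splitClass, if_neg (by omega), show n - 1 - (n - 1 - i) = i by omega]
    cases trace (rev n p) (rev n r) (costR n p w) y (n - k) y i <;> rfl
  refine ⟨hs, fun i hi hri => ?_, ?_, ?_⟩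
  · rw [hcls, splitClass]
    split_ifs with h1 h2 h3
    · exact absurd (l3 i h1 h2) hri
    · rfl
    · have := r3 (n - 1 - i) (by omega) h3
      rw [rev, show n - 1 - (n - 1 - i) = i by omega] at this
      exact absurd this hri
    · rfl
  · have := hs.sum_one (p := p)
    rw [pre_congr eX, pre_congr eY, l1, r1] at this
    unfold midSize
    omega
  · rw [hs.startCost_eq, pre_congr eX, pre_congr eY, blockCost_congr eX, blockCost_congr eY, l1, r1]
    unfold dpL dpR
    omega

/-- The converse of `splitClass_spec`: evaluating the tables at the block sizes of the given
schedule does at least as well as this schedule. -/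
theorem IsSplit.isValue {n k : ℕ} {p w r cls : ℕ → ℕ} (h : IsSplit n k cls)
    (hr : ∀ i < n, r i ≠ 0 → cls i = 1) :
    ∃ v, IsValue n p w r (midSize n p cls) v ∧ v ≤ startCost n p w (classKey n cls) + 2 := by
  have hk := h.le
  obtain ⟨l1, l2⟩ := dp_le_blockCost (p := p) (r := r) (K := costL w)
    (α := pre p (fun i => cls i == 0) k) (X := fun i => cls i == 0) (i := k) fun j hj hj' => by
      by_contra hrj
      simp [hr j (by omega) hrj] at hj'
  obtain ⟨r1, r2⟩ := dp_le_blockCost (p := rev n p) (r := rev n r) (K := costR n p w)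
    (α := pre (rev n p) (fun i => cls (n - 1 - i) == 2) (n - k))
    (X := fun i => cls (n - 1 - i) == 2) (i := n - k) fun j hj hj' => by
      by_contra hrj
      simp [hr (n - 1 - j) (by omega) hrj] at hj'
  refine ⟨_, ⟨k, _, _, hk, ?_, l1, r1, rfl⟩, ?_⟩
  · have := h.sum_one (p := p)
    unfold midSize
    omega
  · rw [h.startCost_eq]
    unfold dpL dpR
    omega

theorem startCost_congr {n : ℕ} {p w key key' : ℕ → ℕ}
    (h : ∀ i < n, ∀ j < n, key i < key j ↔ key' i < key' j) :
    startCost n p w key = startCost n p w key' := by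
  refine Finset.sum_congr rfl fun j hj => ?_
  congr 1
  refine Finset.sum_congr rfl fun i hi => ?_
  rw [if_congr (h i (Finset.mem_range.1 hi) j (Finset.mem_range.1 hj)) rfl rfl]

/-! ### From split schedules to sequences and back. -/

namespace Inst

variable {I : Inst} {o : ℕ → ℕ}

/-- The sequence processes the sorted jobs class by class. -/
def Follows (o cls : ℕ → ℕ) (σ : I.Sequence) : Prop :=
  ∀ i < I.n, ∀ j < I.n, classKey I.n cls i < classKey I.n cls j →
    position σ (o i) < position σ (o j)

theorem classKey_inj {n : ℕ} {cls : ℕ → ℕ} {i j : ℕ} (hi : i < n) (hj : j < n)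
    (h : classKey n cls i = classKey n cls j) : i = j := by
  by_contra hij
  have h1 := classKey_lt (cls := cls) hi hj
  have h2 := classKey_lt (cls := cls) hj hi
  omega

theorem Follows.iff {cls : ℕ → ℕ} {σ : I.Sequence} (h : Follows o cls σ) {i j : ℕ} (hi : i < I.n)
    (hj : j < I.n) :
    position σ (o i) < position σ (o j) ↔ classKey I.n cls i < classKey I.n cls j := by
  refine ⟨fun hp => ?_, h i hi j hj⟩
  by_contra hlt
  rcases (not_lt.1 hlt).lt_or_eq with h' | h'
  · have := h j hj i hi h'
    omega
  · have := classKey_inj hj hi h'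
    subst this
    omega

/-- All r-jobs run inside the middle block, between `S0` and `S0` plus its size. Only an inequality
holds, since the block may begin or end with jobs that are not r-jobs. -/
theorem er_le_of_follows (ho : SortedOrder I.n (I.input.arr 0) (I.input.arr 1) o) {cls : ℕ → ℕ}
    {σ : I.Sequence} (h : Follows o cls σ)
    (hr : ∀ i < I.n, I.input.arr 2 (o i) ≠ 0 → cls i = 1) :
    er σ ≤ midSize I.n (fun i => I.input.arr 0 (o i)) cls := by
  set S0 := ∑ i ∈ Finset.range I.n, if cls i = 0 then I.input.arr 0 (o i) else 0 with hS0
  have key : ∀ j ∈ I.R, completion σ j ≤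
      S0 + midSize I.n (fun i => I.input.arr 0 (o i)) cls ∧ S0 + I.p j ≤ completion σ j := by
    intro j hj
    obtain ⟨i, hi, hij⟩ := ho.exists_eq j.2
    have hc : cls i = 1 := hr i hi (by rw [hij, input_needs, if_pos hj]; exact one_ne_zero)
    constructor
    · rw [completion_eq, ← ho.sum_comp fun l =>
        if position σ l ≤ position σ j then I.input.arr 0 l else 0, ← hij, hS0, midSize,
        ← Finset.sum_add_distrib]
      refine Finset.sum_le_sum fun l hl => ?_
      have hl := Finset.mem_range.1 hl
      have h1 := h i hi l hl
      rw [classKey_lt hi hl] at h1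
      split_ifs <;> omega
    · rw [completion_eq_add, ← ho.sum_comp fun l =>
        if position σ l < position σ j then I.input.arr 0 l else 0, ← hij]
      refine Nat.add_le_add_right (Finset.sum_le_sum fun l hl => ?_) _
      have hl := Finset.mem_range.1 hl
      have h1 := h l hl i hi
      rw [classKey_lt hl hi] at h1
      split_ifs <;> omega
  have h1 : I.R.sup' I.R_nonempty (fun j => (completion σ j : ℤ)) ≤
      S0 + midSize I.n (fun i => I.input.arr 0 (o i)) cls :=
    Finset.sup'_le _ _ fun j hj => by exact_mod_cast (key j hj).1
  have h2 : (S0 : ℤ) ≤ I.R.inf' I.R_nonempty (fun j => (completion σ j : ℤ) - (I.p j : ℤ)) :=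
    Finset.le_inf' _ _ fun j hj => by
      have := (key j hj).2
      omega
  unfold er
  omega

/-- The middle block consists of the jobs positioned between the first r-job `f` and the last r-job
`l`, so every other job is wholly before or after it. -/
theorem exists_isSplit (ho : SortedOrder I.n (I.input.arr 0) (I.input.arr 1) o) (σ : I.Sequence) :
    ∃ k cls, IsSplit I.n k cls ∧ (∀ i < I.n, I.input.arr 2 (o i) ≠ 0 → cls i = 1) ∧
      midSize I.n (fun i => I.input.arr 0 (o i)) cls ≤ er σ ∧
      startCost I.n (fun i => I.input.arr 0 (o i)) (fun i => I.input.arr 1 (o i))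
        (classKey I.n cls) + constCost I ≤ twc σ := by
  obtain ⟨f, hf, hfmin⟩ := Finset.exists_min_image I.R (fun j => position σ j) I.R_nonempty
  obtain ⟨l, hl, hlmax⟩ := Finset.exists_max_image I.R (fun j => position σ j) I.R_nonempty
  have hfl := hfmin l hl
  set B : ℕ → Bool := fun i =>
    decide (position σ f ≤ position σ (o i) ∧ position σ (o i) ≤ position σ l) with hBdef
  obtain ⟨k, cls, hs, hc, hcost⟩ := exists_isSplit_startCost_le ho.sorted
    (key := fun i => position σ (o i))
    (fun i hi j hj hij => ho.inj i hi j hj (position_inj σ (ho.lt i hi) (ho.lt j hj) hij)) B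
    (by
      intro c hc hBc
      simp only [hBdef, decide_eq_false_iff_not, decide_eq_true_eq] at hBc ⊢
      by_cases h : position σ f ≤ position σ (o c)
      · right; intro b hb hb'; omega
      · left; intro b hb hb'; omega)
  refine ⟨k, cls, hs, fun i hi hri => ?_, ?_, ?_⟩
  · rw [hc i hi]
    have hj : (⟨o i, ho.lt i hi⟩ : Fin I.n) ∈ I.R := by
      by_contra hn
      exact hri (by rw [show o i = ((⟨o i, ho.lt i hi⟩ : Fin I.n) : ℕ) from rfl, input_needs,
        if_neg hn])
    have h1 := hfmin _ hj
    have h2 := hlmax _ hj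
    simp only [hBdef, decide_eq_true_eq]
    exact ⟨h1, h2⟩
  · have h1 : (completion σ l : ℤ) ≤ I.R.sup' I.R_nonempty (fun j => (completion σ j : ℤ)) :=
      Finset.le_sup' (fun j => (completion σ j : ℤ)) hl
    have h2 : I.R.inf' I.R_nonempty (fun j => (completion σ j : ℤ) - (I.p j : ℤ)) ≤
        (completion σ f : ℤ) - (I.p f : ℤ) :=
      Finset.inf'_le (fun j => (completion σ j : ℤ) - (I.p j : ℤ)) hf
    -- Without idle time, the jobs from `f` to `l` fill the interval from the start of `f` to the
    -- completion of `l` exactly.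
    have h3 : midSize I.n (fun i => I.input.arr 0 (o i)) cls + completion σ f =
        completion σ l + I.p f := by
      rw [completion_eq_add σ f, completion_eq σ l, ← add_assoc]
      congr 1
      rw [← ho.sum_comp fun i => if position σ i < position σ f then I.input.arr 0 i else 0,
        ← ho.sum_comp fun i => if position σ i ≤ position σ l then I.input.arr 0 i else 0,
        midSize, ← Finset.sum_add_distrib]
      refine Finset.sum_congr rfl fun i hi => ?_
      have := hc i (Finset.mem_range.1 hi)
      simp only [hBdef, decide_eq_true_eq] at this
      rw [if_congr this rfl rfl]
      split_ifs <;> omega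
    unfold er
    omega
  · rw [twc_eq ho]
    omega

theorem exists_isValue_le (ho : SortedOrder I.n (I.input.arr 0) (I.input.arr 1) o)
    (σ : I.Sequence) :
    ∃ e v, IsValue I.n (fun i => I.input.arr 0 (o i)) (fun i => I.input.arr 1 (o i))
      (fun i => I.input.arr 2 (o i)) e v ∧ (e : ℤ) ≤ er σ ∧ v + constCost I ≤ twc σ + 2 := by
  obtain ⟨k, cls, hs, hr, he, hc⟩ := exists_isSplit ho σ
  obtain ⟨v, hv, hle⟩ := hs.isValue (p := fun i => I.input.arr 0 (o i))
    (w := fun i => I.input.arr 1 (o i)) hr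
  exact ⟨_, v, hv, he, by omega⟩

theorem twc_of_follows (ho : SortedOrder I.n (I.input.arr 0) (I.input.arr 1) o) {k α y e v : ℕ}
    (h : IsValueAt I.n (fun i => I.input.arr 0 (o i)) (fun i => I.input.arr 1 (o i))
      (fun i => I.input.arr 2 (o i)) k α y e v) {σ : I.Sequence}
    (hσ : Follows o (splitClass I.n (fun i => I.input.arr 0 (o i))
      (fun i => I.input.arr 1 (o i)) (fun i => I.input.arr 2 (o i)) k α y) σ) :
    er σ ≤ e ∧ twc σ + 2 = v + constCost I := by
  obtain ⟨-, h2, h3, h4⟩ := splitClass_spec h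
  refine ⟨(er_le_of_follows ho hσ h2).trans (by rw [h3]), ?_⟩
  rw [twc_eq ho, startCost_congr (key' := classKey I.n _) fun i hi j hj => hσ.iff hi hj]
  omega

/-! ### Building the Pareto front -/

/-- The first `cnt` sequences of `front` are the Pareto front of the sequences with renting period
shorter than `E`, and `best` is the least value that occurs for these. -/
structure PartialFront (val : ℕ → ℕ → Prop) (E cnt best : ℕ) (front : ℕ → I.Sequence) : Prop where
  lt : ∀ i < cnt, er (front i) < E
  le_of_le : ∀ i < cnt, ∀ τ : I.Sequence, er τ ≤ er (front i) → twc (front i) ≤ twc τ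
  lt_of_lt : ∀ i < cnt, ∀ τ : I.Sequence, er τ < er (front i) → twc (front i) < twc τ
  ne : ∀ i j, i < j → j < cnt → er (front i) ≠ er (front j)
  exists_le : ∀ τ : I.Sequence, er τ < E →
    ∃ i < cnt, er (front i) ≤ er τ ∧ twc (front i) ≤ twc τ
  best_le : ∀ e < E, ∀ v, val e v → best ≠ 0 ∧ best ≤ v
  best_eq : best ≠ 0 → ∃ i < cnt, twc (front i) + 2 = best + constCost I

variable {val : ℕ → ℕ → Prop} {E cnt best best' : ℕ} {front : ℕ → I.Sequence}

/-- Any single r-job shows that the renting period is nonnegative, so no sequence has to be covered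
yet. -/
theorem PartialFront.zero (hbest : best = 0) : PartialFront val 0 0 best front where
  lt := by simp
  le_of_le := by simp
  lt_of_lt := by simp
  ne := by simp
  exists_le τ h := by
    exfalso
    have h1 := Finset.le_sup' (fun j => (completion τ j : ℤ)) I.R_nonempty.choose_spec
    have h2 := Finset.inf'_le (fun j => (completion τ j : ℤ) - (I.p j : ℤ)) I.R_nonempty.choose_spec
    unfold er at h
    omega
  best_le := by simp
  best_eq h := absurd hbest h

/-- If `E` brings no smaller value, the listed sequence that attains `best` is at least as good as
every sequence of renting period `E`. -/
theorem PartialFront.skip (hval : ∀ τ : I.Sequence, ∃ e v, val e v ∧ (e : ℤ) ≤ er τ ∧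
      v + constCost I ≤ twc τ + 2)
    (h : PartialFront val E cnt best front) (hE : ∀ v, val E v → best ≠ 0 ∧ best ≤ v) :
    PartialFront val (E + 1) cnt best front := by
  have hle : ∀ e < E + 1, ∀ v, val e v → best ≠ 0 ∧ best ≤ v := by
    intro e he v hv
    rcases Nat.lt_succ_iff_lt_or_eq.1 he with he | rfl
    · exact h.best_le e he v hv
    · exact hE v hv
  refine ⟨fun i hi => (h.lt i hi).trans (by simp), h.le_of_le, h.lt_of_lt, h.ne, fun τ hτ => ?_,
    hle, h.best_eq⟩
  rcases lt_or_ge (er τ) E with hlt | hge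
  · exact h.exists_le τ hlt
  obtain ⟨e, v, hv, he, hc⟩ := hval τ
  obtain ⟨hb, hbv⟩ := hle e (by push_cast at hτ; omega) v hv
  obtain ⟨i, hi, hbi⟩ := h.best_eq hb
  exact ⟨i, hi, (h.lt i hi).le.trans hge, by omega⟩

/-- A strictly smaller value at `E` means that `σ` costs less than every sequence of renting period
below `E`, so it belongs to the front. -/
theorem PartialFront.push (hval : ∀ τ : I.Sequence, ∃ e v, val e v ∧ (e : ℤ) ≤ er τ ∧
      v + constCost I ≤ twc τ + 2)
    (h : PartialFront val E cnt best front) (hlt : best = 0 ∨ best' < best) (hpos : best' ≠ 0)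
    (hE : ∀ v, val E v → best' ≤ v) {σ : I.Sequence} (hσ : er σ ≤ E)
    (hσ' : twc σ + 2 = best' + constCost I) :
    PartialFront val (E + 1) (cnt + 1) best' (Function.update front cnt σ) := by
  have hle : ∀ e < E + 1, ∀ v, val e v → best' ≠ 0 ∧ best' ≤ v := by
    intro e he v hv
    rcases Nat.lt_succ_iff_lt_or_eq.1 he with he | rfl
    · have := h.best_le e he v hv
      omega
    · exact ⟨hpos, hE v hv⟩
  have hstrict : ∀ τ : I.Sequence, er τ < E → twc σ < twc τ := by
    intro τ hτ
    obtain ⟨e, v, hv, he, hc⟩ := hval τ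
    have := h.best_le e (by omega) v hv
    omega
  -- Only `er σ ≤ E` is given; if it were strict, `σ` would have to be strictly cheaper than itself.
  have heq : er σ = E := by
    by_contra hne
    exact lt_irrefl _ (hstrict σ (lt_of_le_of_ne hσ hne))
  have hweak : ∀ τ : I.Sequence, er τ ≤ E → twc σ ≤ twc τ := by
    intro τ hτ
    obtain ⟨e, v, hv, he, hc⟩ := hval τ
    have := hle e (by omega) v hv
    omega
  have hold : ∀ i < cnt, Function.update front cnt σ i = front i := fun i hi =>
    Function.update_of_ne hi.ne _ _
  have hnew : Function.update front cnt σ cnt = σ := Function.update_self _ _ _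
  refine ⟨fun i hi => ?_, fun i hi => ?_, fun i hi => ?_, fun i j hij hj => ?_, fun τ hτ => ?_,
    hle, fun _ => ⟨cnt, by omega, by rw [hnew, hσ']⟩⟩
  · rcases Nat.lt_succ_iff_lt_or_eq.1 hi with hi | rfl
    · rw [hold i hi]; exact (h.lt i hi).trans (by simp)
    · rw [hnew, heq]; simp
  · rcases Nat.lt_succ_iff_lt_or_eq.1 hi with hi | rfl
    · rw [hold i hi]; exact h.le_of_le i hi
    · rw [hnew, heq]; exact hweak
  · rcases Nat.lt_succ_iff_lt_or_eq.1 hi with hi | rfl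
    · rw [hold i hi]; exact h.lt_of_lt i hi
    · rw [hnew, heq]; exact hstrict
  · rcases Nat.lt_succ_iff_lt_or_eq.1 hj with hj | rfl
    · rw [hold i (by omega), hold j hj]; exact h.ne i j hij hj
    · rw [hold i hij, hnew, heq]; exact (h.lt i hij).ne
  · rcases lt_or_ge (er τ) E with hlt | hge
    · obtain ⟨i, hi, h1, h2⟩ := h.exists_le τ hlt
      exact ⟨i, by omega, by rw [hold i hi]; exact ⟨h1, h2⟩⟩
    · refine ⟨cnt, by omega, ?_⟩
      rw [hnew]
      exact ⟨hσ.trans hge, hweak τ (by push_cast at hτ; omega)⟩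

/-- Since all values occur below `E`, even a sequence with a longer renting period is matched by a
listed one. Uniqueness holds because the listed renting periods are pairwise distinct. -/
theorem PartialFront.isParetoFront (hval : ∀ τ : I.Sequence, ∃ e v, val e v ∧ (e : ℤ) ≤ er τ ∧
      v + constCost I ≤ twc τ + 2) (hbound : ∀ e v, val e v → e < E)
    (h : PartialFront val E cnt best front) :
    IsParetoFront (fun i : Fin cnt => front i) := by
  refine ⟨fun i τ hd => ?_, fun τ hτ => ?_⟩
  · obtain ⟨h1, h2, h3⟩ : Dominates τ (front i) := hd
    have a1 := h.le_of_le i i.2 τ h2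
    have a2 := h.lt_of_lt i i.2 τ
    rcases h3 with h3 | h3
    · omega
    · have := a2 h3; omega
  · obtain ⟨i, hi, h1, h2⟩ : ∃ i < cnt, er (front i) ≤ er τ ∧ twc (front i) ≤ twc τ := by
      rcases lt_or_ge (er τ) E with hlt | hge
      · exact h.exists_le τ hlt
      · obtain ⟨e, v, hv, he, hc⟩ := hval τ
        obtain ⟨hb, hbv⟩ := h.best_le e (hbound e v hv) v hv
        obtain ⟨i, hi, hbi⟩ := h.best_eq hb
        exact ⟨i, hi, (h.lt i hi).le.trans hge, by omega⟩
    have hnd := hτ (front i)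
    unfold Dominates at hnd
    have e1 : twc (front i) = twc τ := by
      by_contra hne; exact hnd ⟨h2, h1, Or.inl (by omega)⟩
    have e2 : er (front i) = er τ := by
      by_contra hne; exact hnd ⟨h2, h1, Or.inr (by omega)⟩
    refine ⟨⟨i, hi⟩, ⟨e1, e2⟩, fun j hj => ?_⟩
    rcases lt_trichotomy (j : ℕ) i with hij | hij | hij
    · exact absurd (hj.2.trans e2.symm) (h.ne j i hij hi)
    · exact Fin.ext hij
    · exact absurd (e2.trans hj.2.symm) (h.ne i j hij j.2)

end Inst

/-! ### Preparing the tables -/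

namespace Prog

infixr:60 " ⨟ " => Prog.seq

/-- Variables: `2` holds `P`, `3` holds `n + 1`, `4` holds `P + 1`, `5` holds `2 * P + 1`, and `12`
holds `3`. -/
def totals : Prog :=
  assign 2 (.const 0) ⨟
  forLoop 20 0 (assign 2 (.add (.var 2) (.arr 0 (.var 20)))) ⨟
  assign 3 (.add (.var 0) (.const 1)) ⨟
  assign 4 (.add (.var 2) (.const 1)) ⨟
  assign 5 (.add (.var 2) (.var 4)) ⨟
  assign 12 (.const 3)

/-- Array `a` gets the first multiples of variable `z`, as many as variable `y` says, and variable
`30` the next multiple. -/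
def multiples (a y z : ℕ) : Prog :=
  assign 30 (.const 0) ⨟
  forLoop 20 y (store a (.var 20) (.var 30) ⨟ assign 30 (.add (.var 30) (.var z)))

/-- Array `4` is the multiplication table of the weights; the row of job `j` starts in cell
`j * (2 * P + 1)`. -/
def products : Prog :=
  assign 30 (.const 0) ⨟
  forLoop 20 0 (
    assign 31 (.const 0) ⨟
    forLoop 21 5 (
      store 4 (.var 30) (.var 31) ⨟
      assign 31 (.add (.var 31) (.arr 1 (.var 20))) ⨟
      assign 30 (.add (.var 30) (.const 1))))

/-- Variable `34` is increased if job `var 21` precedes job `var 20` (with positive processing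
time) in the sorted order. -/
def countIfPrec : Prog :=
  assign 35 (.arr 4 (.add (.arr 5 (.var 20)) (.arr 0 (.var 21)))) ⨟
  assign 36 (.arr 4 (.add (.arr 5 (.var 21)) (.arr 0 (.var 20)))) ⨟
  branch (.conj (.neg (.eq (.arr 0 (.var 21)) (.const 0)))
      (.conj (.le (.var 36) (.var 35))
        (.neg (.conj (.eq (.var 35) (.var 36)) (.le (.add (.var 21) (.const 1)) (.var 20))))))
    skip (assign 34 (.add (.var 34) (.const 1)))

/-- Variable `34` gets the rank of job `var 20`; variable `33` counts the jobs with processing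
time `0`. -/
def computeRank : Prog :=
  branch (.eq (.arr 0 (.var 20)) (.const 0))
    (assign 34 (.var 33) ⨟ assign 33 (.add (.var 33) (.const 1)))
    (assign 34 (.const 0) ⨟ forLoop 21 0 countIfPrec)

/-- Array `6` gets the jobs in sorted order. -/
def sortJobs : Prog :=
  assign 33 (.const 0) ⨟
  forLoop 20 0 (computeRank ⨟ store 6 (.var 34) (.var 20))

/-- Array `7` gets the sorted jobs in reverse order. -/
def reverseJobs : Prog :=
  forLoop 20 0 (store 7 (.var 20) (.arr 6 (.sub (.sub (.var 0) (.const 1)) (.var 20))))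

/-- Array `b` gets the prefix sums of the processing times of the jobs listed in array `a`. -/
def prefixSums (a b : ℕ) : Prog :=
  assign 30 (.const 0) ⨟
  forLoop 20 3 (
    store b (.var 20) (.var 30) ⨟
    assign 30 (.add (.var 30) (.arr 0 (.arr a (.var 20)))))

end Prog

section Prepare

variable {s : Mem} {n P : ℕ} {p w : ℕ → ℕ}

theorem runs_totals (h0 : s.var 0 = n) (hp : s.arr 0 = p) :
    Runs Prog.totals s (n * 15 + 30) fun s' =>
      s'.var 2 = tot p n ∧ s'.var 3 = n + 1 ∧ s'.var 4 = tot p n + 1 ∧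
        s'.var 5 = 2 * tot p n + 1 ∧ s'.var 12 = 3 := by
  refine Runs.step (T₁ := 2) (T₂ := n * (5 + 10) + 8 + 18) (Q := fun s' => s'.var 2 = 0)
    (Runs.flat (by simp [Prog.wp, Expr.eval]) (by decide)) (fun s₁ f₁ q₁ => ?_) (by omega)
  refine Runs.step (T₁ := n * (5 + 10) + 8) (T₂ := 18) (Q := fun s' => s'.var 2 = tot p n)
    (Runs.iterate (N := n) (T := 5) (fun i s' => s'.var 2 = tot p i)
      (by rw [f₁.1 0 rfl, h0]) rfl (by decide) rfl (by simp) (by simp [tot, q₁]) ?_ le_rfl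
      fun _ _ h => h) (fun s₂ f₂ q₂ => Runs.flat ?_ (by decide)) le_rfl
  · intro i s' hi hv f q
    refine Runs.flat ?_ (by decide)
    simp [Prog.wp, Expr.eval, hv, f.2 0 rfl, f₁.2 0 rfl, hp, q, tot, Finset.sum_range_succ]
  · have := f₂.1 0 rfl
    have := f₁.1 0 rfl
    simp [Prog.wp, Expr.eval, q₂]
    omega

theorem runs_multiples {a y z N S : ℕ} (hN : s.var y = N) (hS : s.var z = S) (hy : y ≠ 20)
    (hy' : y ≠ 30) (hz : z ≠ 20) (hz' : z ≠ 30) :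
    Runs (Prog.multiples a y z) s (N * 17 + 10) fun s' =>
      s'.var 30 = N * S ∧ ∀ i < N, s'.arr a i = i * S := by
  refine Runs.step (T₁ := 2) (T₂ := N * (7 + 10) + 8) (Q := fun s' => s'.var 30 = 0)
    (Runs.flat (by simp [Prog.wp, Expr.eval]) (by decide)) (fun s₁ f₁ q₁ => ?_) (by omega)
  refine Runs.iterate (N := N) (T := 7)
    (fun i s' => s'.var 30 = i * S ∧ ∀ j < i, s'.arr a j = j * S)
    (by rw [f₁.1 y (by simpa [Prog.writesVar] using hy'.symm), hN]) rfl hy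
    (by simpa [Prog.writesVar] using hy'.symm) (by simp) (by simp [q₁]) ?_ le_rfl fun _ _ h => h
  intro i s' hi hv f q
  have hz1 : s'.var z = S := by
    rw [f.1 z (by simpa [Prog.forLoop, Prog.writesVar] using ⟨hz.symm, hz'.symm, hz.symm⟩),
      f₁.1 z (by simpa [Prog.writesVar] using hz'.symm), hS]
  refine Runs.flat ?_ (by simp [Prog.flatCost, Expr.cost])
  simp only [Prog.wp, Expr.eval, Mem.setVar_var, Mem.setArr_var, Mem.setVar_arr, Mem.setArr_arr,
    if_true, hv, q.1, hz1]
  refine ⟨by ring, fun j hj => ?_⟩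
  rcases Nat.lt_succ_iff_lt_or_eq.1 hj with hj | rfl
  · rw [Function.update_of_ne hj.ne, q.2 j hj]
  · rw [Function.update_self]

/-- Later `W = 2 * P + 1`: the tabulated position `α + (tot p i - a)` can be as large as `2 * P`,
even when it belongs to no actual schedule. -/
theorem runs_products {W : ℕ} (h0 : s.var 0 = n) (h5 : s.var 5 = W) (hw : s.arr 1 = w) :
    Runs Prog.products s (n * (W * 25 + 20) + 10) fun s' =>
      ∀ j < n, ∀ x < W, s'.arr 4 (j * W + x) = w j * x := by
  refine Runs.step (T₁ := 2) (T₂ := n * (W * 25 + 20) + 8) (Q := fun s' => s'.var 30 = 0)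
    (Runs.flat (by simp [Prog.wp, Expr.eval]) (by decide)) (fun s₁ f₁ q₁ => ?_) (by omega)
  refine Runs.iterate (N := n) (T := 2 + (W * (12 + 10) + 8))
    (fun i s' => s'.var 30 = i * W ∧ ∀ j < i, ∀ x < W, s'.arr 4 (j * W + x) = w j * x)
    (by rw [f₁.1 0 rfl, h0]) rfl (by decide) rfl (by simp) (by simp [q₁]) ?_
    (Nat.add_le_add_right (Nat.mul_le_mul_left _ (by omega)) _) fun _ _ h => h.2
  intro i s' hi hv f q
  refine Runs.step (T₁ := 2) (T₂ := W * (12 + 10) + 8) (Q := fun s' => s'.var 31 = 0)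
    (Runs.flat (by simp [Prog.wp, Expr.eval]) (by decide)) (fun s₂ f₂ q₂ => ?_) le_rfl
  refine Runs.iterate (N := W) (T := 12)
      (fun x s' => s'.var 30 = i * W + x ∧ s'.var 31 = w i * x ∧
        (∀ j < i, ∀ x < W, s'.arr 4 (j * W + x) = w j * x) ∧
        ∀ x' < x, s'.arr 4 (i * W + x') = w i * x') ?_ rfl (by decide) rfl (by simp) ?_ ?_ le_rfl ?_
  · rw [f₂.1 5 rfl, f.1 5 rfl, f₁.1 5 rfl, h5]
  · refine ⟨by rw [f₂.1 30 rfl, q.1, add_zero], by simp [q₂], ?_, by simp⟩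
    rw [f₂.2 4 rfl]
    exact q.2
  · intro x t hx hvx g qx
    have h20 : t.var 20 = i := by rw [g.1 20 rfl, f₂.1 20 rfl, hv]
    have h1 : t.arr 1 = w := by rw [g.2 1 rfl, f₂.2 1 rfl, f.2 1 rfl, f₁.2 1 rfl, hw]
    refine Runs.flat ?_ (by decide)
    simp only [Prog.wp, Expr.eval, Mem.setVar_var, Mem.setArr_var, Mem.setVar_arr, Mem.setArr_arr,
      if_true, qx.1, qx.2.1]
    refine ⟨by simp; ring, by simp [h1, h20]; ring, fun j hj x' hx' => ?_, fun x' hx' => ?_⟩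
    · have h2 : (j + 1) * W ≤ i * W := Nat.mul_le_mul_right _ hj
      rw [add_mul] at h2
      rw [Function.update_of_ne (by omega), qx.2.2.1 j hj x' hx']
    · rcases Nat.lt_succ_iff_lt_or_eq.1 hx' with hx' | rfl
      · rw [Function.update_of_ne (by omega), qx.2.2.2 x' hx']
      · rw [Function.update_self]
  · rintro t g ⟨q1, -, q3, q4⟩
    refine ⟨by rw [q1]; ring, fun j hj x hx => ?_⟩
    rcases Nat.lt_succ_iff_lt_or_eq.1 hj with hj | rfl
    · exact q3 j hj x hx
    · exact q4 x hx

open Classical in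
-- A job of processing time `0` is preceded exactly by the earlier such jobs, which variable `33`
-- counts, so it needs only constant time. Other jobs count their predecessors in `O(n)` steps.
theorem runs_computeRank {W j : ℕ} (hj : j < n) (h0 : s.var 0 = n) (h20 : s.var 20 = j)
    (hp : s.arr 0 = p) (h5 : ∀ i < n, s.arr 5 i = i * W)
    (h4 : ∀ i < n, ∀ x < W, s.arr 4 (i * W + x) = w i * x) (hW : ∀ i < n, p i < W)
    (h33 : s.var 33 = ((Finset.range j).filter fun i => p i = 0).card) :
    Runs Prog.computeRank s (20 + if p j = 0 then 0 else n * 70 + 10) fun s' =>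
      s'.var 34 = rank n p w j ∧
        s'.var 33 = ((Finset.range (j + 1)).filter fun i => p i = 0).card := by
  by_cases hz : p j = 0
  · have hr : rank n p w j = ((Finset.range j).filter fun i => p i = 0).card := by
      unfold rank
      congr 1
      ext i
      simp only [Finset.mem_filter, Finset.mem_range, Prec, hz]
      omega
    have e : ((Finset.range (j + 1)).filter fun i => p i = 0).card =
        ((Finset.range j).filter fun i => p i = 0).card + 1 := by
      rw [Finset.range_add_one, Finset.filter_insert, if_pos hz, Finset.card_insert_of_notMem]
      simp
    refine (Runs.branch (T := 10) (fun _ => Runs.flat ?_ (by decide)) fun h => ?_).imp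
      (by rw [if_pos hz]; decide) fun _ _ h => h
    · simp [Prog.wp, Expr.eval, h33, hr, e]
    · exact absurd (by simp [Test.holds, Expr.eval, h20, hp, hz]) h
  · have e : ((Finset.range (j + 1)).filter fun i => p i = 0).card =
        ((Finset.range j).filter fun i => p i = 0).card := by
      rw [Finset.range_add_one, Finset.filter_insert, if_neg hz]
    refine (Runs.branch (T := n * 70 + 10) (fun h => ?_) fun _ => ?_).imp
      (by rw [if_neg hz]; simp only [Test.cost, Expr.cost]; omega) fun _ _ h => h
    · exact absurd (by simpa [Test.holds, Expr.eval, h20, hp] using h) hz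
    refine Runs.step (T₁ := 2) (T₂ := n * (60 + 10) + 8) (Q := fun s' => s'.var 34 = 0)
      (Runs.flat (by simp [Prog.wp, Expr.eval]) (by decide)) (fun s₁ f₁ q₁ => ?_) (by omega)
    refine Runs.iterate (N := n) (T := 60)
      (fun i s' => s'.var 34 = ((Finset.range i).filter fun i => Prec p w i j).card)
      (by rw [f₁.1 0 rfl, h0]) rfl (by decide) rfl (by simp) (by simp [q₁]) ?_ le_rfl ?_
    · intro i t hi hv f q
      have t20 : t.var 20 = j := by rw [f.1 20 rfl, f₁.1 20 rfl, h20]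
      have t0 : t.arr 0 = p := by rw [f.2 0 rfl, f₁.2 0 rfl, hp]
      have t5 : t.arr 5 = s.arr 5 := by rw [f.2 5 rfl, f₁.2 5 rfl]
      have t4 : t.arr 4 = s.arr 4 := by rw [f.2 4 rfl, f₁.2 4 rfl]
      have e' : ((Finset.range (i + 1)).filter fun i => Prec p w i j).card =
          ((Finset.range i).filter fun i => Prec p w i j).card + if Prec p w i j then 1 else 0 := by
        rw [Finset.range_add_one, Finset.filter_insert]
        split_ifs
        · rw [Finset.card_insert_of_notMem]
          simp
        · rfl
      refine Runs.flat ?_ (by decide)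
      simp only [Prog.countIfPrec, Prog.wp, Expr.eval, Test.holds, Mem.setVar_var, Mem.setVar_arr,
        hv, t20, t0, t5, t4, h5 j hj,
        h4 j hj _ (hW i hi), q, e']
      simp [h5 i hi, h4 i hi _ (hW j hj)]
      refine ⟨fun h1 h2 h3 => ?_, fun h => ?_⟩ <;> unfold Prec <;> omega
    · intro t f q
      refine ⟨q, ?_⟩
      rw [f.1 33 rfl, f₁.1 33 rfl, h33, e]

/-- The `O(n)` count is charged to the units of processing time of the job. This gives `O(n + n P)`
steps in total, where counting for all jobs would give `n ^ 2`. -/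
theorem runs_sortJobs {W : ℕ} (h0 : s.var 0 = n)
    (hp : s.arr 0 = p) (h5 : ∀ i < n, s.arr 5 i = i * W)
    (h4 : ∀ i < n, ∀ x < W, s.arr 4 (i * W + x) = w i * x) (hW : ∀ i < n, p i < W) :
    Runs Prog.sortJobs s (n * 40 + tot p n * (n * 70 + 10) + 10) fun s' =>
      ∀ j < n, s'.arr 6 (rank n p w j) = j := by
  classical
  refine Runs.step (T₁ := 2) (T₂ := n * 40 + tot p n * (n * 70 + 10) + 8)
    (Q := fun s' => s'.var 33 = 0)
    (Runs.flat (by simp [Prog.wp, Expr.eval]) (by decide)) (fun s₁ f₁ q₁ => ?_) (by omega)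
  refine Runs.imp (Runs.forLoop' (N := n)
    (T := fun j => (20 + if p j = 0 then 0 else n * 70 + 10) + 3)
    (fun j s' => s'.var 33 = ((Finset.range j).filter fun i => p i = 0).card ∧
      ∀ i < j, s'.arr 6 (rank n p w i) = i)
    (by rw [f₁.1 0 rfl, h0]) rfl (by decide) rfl (by simp) (by simp [q₁]) ?_) ?_ fun _ _ h => h.2
  · intro j t hj hv f q
    refine Runs.seq (runs_computeRank (W := W) (n := n) (p := p) (w := w) hj ?_ hv ?_ ?_ ?_ hW q.1)
      fun t' f' q' => Runs.flat ?_ (by decide)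
    · rw [f.1 0 rfl, f₁.1 0 rfl, h0]
    · rw [f.2 0 rfl, f₁.2 0 rfl, hp]
    · rw [f.2 5 rfl, f₁.2 5 rfl]; exact h5
    · rw [f.2 4 rfl, f₁.2 4 rfl]; exact h4
    · simp only [Prog.wp, Expr.eval, Mem.setArr_var, Mem.setArr_arr, if_true, q'.1, f'.1 20 rfl, hv,
        f'.2 6 rfl]
      refine ⟨q'.2, fun i hi => ?_⟩
      rcases Nat.lt_succ_iff_lt_or_eq.1 hi with hi | rfl
      · rw [Function.update_of_ne, q.2 i hi]
        intro h
        exact hi.ne (rank_injOn (hi.trans hj) hj h)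
      · rw [Function.update_self]
  · have : ∑ j ∈ Finset.range n, ((20 + if p j = 0 then 0 else n * 70 + 10) + 3 + 10) ≤
        ∑ j ∈ Finset.range n, (40 + p j * (n * 70 + 10)) := by
      refine Finset.sum_le_sum fun j _ => ?_
      split_ifs with h
      · simp [h]
      · have : 1 * (n * 70 + 10) ≤ p j * (n * 70 + 10) :=
          Nat.mul_le_mul_right _ (Nat.pos_of_ne_zero h)
        omega
    have e : ∑ j ∈ Finset.range n, (40 + p j * (n * 70 + 10)) =
        n * 40 + tot p n * (n * 70 + 10) := by
      rw [Finset.sum_add_distrib, ← Finset.sum_mul]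
      simp [tot]
    omega

theorem runs_reverseJobs (h0 : s.var 0 = n) :
    Runs Prog.reverseJobs s (n * 18 + 8) fun s' => ∀ i < n, s'.arr 7 i = s.arr 6 (n - 1 - i) := by
  refine Runs.iterate (N := n) (T := 8) (fun i s' => ∀ j < i, s'.arr 7 j = s.arr 6 (n - 1 - j))
    h0 rfl (by decide) rfl (by simp) (by simp) ?_ (by omega) fun s' _ h => h
  intro i s' hi hv f q
  refine Runs.flat ?_ (by decide)
  simp only [Prog.wp, Expr.eval, Mem.setArr_arr, if_true, hv, f.1 0 rfl, f.2 6 rfl, h0]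
  intro j hj
  rcases Nat.lt_succ_iff_lt_or_eq.1 hj with hj | rfl
  · rw [Function.update_of_ne hj.ne, q j hj]
  · rw [Function.update_self]

theorem runs_prefixSums {a b : ℕ} {ps : ℕ → ℕ} (h3 : s.var 3 = n + 1) (hp : s.arr 0 = p)
    (hps : ∀ i < n, p (s.arr a i) = ps i) (hb0 : b ≠ 0) (hba : b ≠ a) :
    Runs (Prog.prefixSums a b) s ((n + 1) * 19 + 10) fun s' => ∀ i ≤ n, s'.arr b i = tot ps i := by
  refine Runs.step (T₁ := 2) (T₂ := (n + 1) * (9 + 10) + 8) (Q := fun s' => s'.var 30 = 0)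
    (Runs.flat (by simp [Prog.wp, Expr.eval]) (by decide)) (fun s₁ f₁ q₁ => ?_) (by omega)
  refine Runs.iterate (N := n + 1) (T := 9)
      -- The restriction `i ≤ n` is needed because the last round, after storing the full total,
      -- still adds an entry from beyond the end of the list.
      (fun i s' => (i ≤ n → s'.var 30 = tot ps i) ∧ ∀ j < i, s'.arr b j = tot ps j)
      (by rw [f₁.1 3 rfl, h3]) rfl (by decide) rfl (by simp) (by simp [q₁, tot]) ?_ le_rfl
      fun s' _ h i hi => h.2 i (by omega)
  intro i s' hi hv f q
  have e1 : s'.arr a = s.arr a := by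
    rw [f.2 a (by simpa [Prog.forLoop, Prog.writesArr] using hba), f₁.2 a rfl]
  have e2 : s'.arr 0 = p := by
    rw [f.2 0 (by simpa [Prog.forLoop, Prog.writesArr] using hb0), f₁.2 0 rfl, hp]
  have q0 := q.1 (by omega)
  refine Runs.flat ?_ (by simp [Prog.flatCost, Expr.cost])
  simp only [Prog.wp, Expr.eval, Mem.setVar_var, Mem.setArr_var, Mem.setVar_arr, Mem.setArr_arr,
    if_true, hv, if_neg hb0.symm, if_neg hba.symm, e1, e2, q0]
  refine ⟨fun hi' => ?_, fun j hj => ?_⟩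
  · simp [hps i (show i < n by omega), tot, Finset.sum_range_succ]
  · rcases Nat.lt_succ_iff_lt_or_eq.1 hj with hj | rfl
    · rw [Function.update_of_ne hj.ne, q.2 j hj]
    · rw [Function.update_self]

end Prepare

/-! ### The dynamic program and its backtracking -/

namespace Prog

/-- Variable `35` gets the job of item `var 38` of the list in array `a`, variable `36` its
processing time, and variable `39` the address of row `var 38` of the layer `var x` of a table. -/
def loadItem (a x : ℕ) : Prog :=
  assign 35 (.arr a (.var 38)) ⨟
  assign 36 (.arr 0 (.var 35)) ⨟
  assign 39 (.add (.arr 13 (.var x)) (.arr 12 (.var 38)))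

/-- Variable `37` gets the entry of the table `f` for `α = var 22`, `var 38 + 1` items, and first
block of size `var 24` if the last item is in the second block. -/
def stayOption (b f : ℕ) (cost : Expr → Expr) : Prog :=
  assign 40 (.arr f (.add (.var 39) (.var 24))) ⨟
  branch (.eq (.var 40) (.const 0)) (assign 37 (.const 0))
    (assign 37 (.add (.var 40) (cost (.add (.var 22) (.sub (.arr b (.var 38)) (.var 24))))))

/-- Variable `37` is improved to the entry of the table `f` for `α = var 22`, `var 38 + 1` items,
and first block of size `var 24` if the last item is in the first block. -/
def takeOption (f : ℕ) (cost : Expr → Expr) : Prog :=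
  branch (.conj (.eq (.arr 2 (.var 35)) (.const 0)) (.le (.var 36) (.var 24)))
    (assign 40 (.arr f (.add (.var 39) (.sub (.var 24) (.var 36)))) ⨟
      branch (.eq (.var 40) (.const 0)) skip
        (assign 40 (.add (.var 40) (cost (.sub (.var 24) (.var 36)))) ⨟
          branch (.conj (.neg (.eq (.var 37) (.const 0))) (.le (.var 37) (.var 40)))
            skip (assign 37 (.var 40))))
    skip

/-- Variable `37` gets the entry of the table `f` for `α = var 22`, `var 23` items, and first block
of size `var 24`. -/
def tableEntry (a b f : ℕ) (cost : Expr → Expr) : Prog :=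
  branch (.eq (.var 23) (.const 0))
    (branch (.eq (.var 24) (.const 0)) (assign 37 (.const 1)) (assign 37 (.const 0)))
    (assign 38 (.sub (.var 23) (.const 1)) ⨟ loadItem a 22 ⨟ stayOption b f cost ⨟
      takeOption f cost)

/-- Array `f` gets the table of the dynamic program for the items listed in array `a`, whose prefix
sums are in array `b`. -/
def fillTable (a b f : ℕ) (cost : Expr → Expr) : Prog :=
  forLoop 22 4 (forLoop 23 3 (forLoop 24 4 (
    tableEntry a b f cost ⨟
    store f (.add (.add (.arr 13 (.var 22)) (.arr 12 (.var 23))) (.var 24)) (.var 37))))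

/-- One step of the backtracking: array `c` records whether item `var 38` is selected, and variable
`41` is the size of the remaining first block. -/
def decideItem (b f c : ℕ) (cost : Expr → Expr) : Prog :=
  assign 40 (.arr f (.add (.var 39) (.var 41))) ⨟
  branch (.conj (.neg (.eq (.var 40) (.const 0)))
      (.eq (.arr f (.add (.add (.arr 13 (.var 42)) (.arr 12 (.add (.var 38) (.const 1))))
          (.var 41)))
        (.add (.var 40) (cost (.add (.var 42) (.sub (.arr b (.var 38)) (.var 41)))))))
    (store c (.var 38) (.const 0))
    (store c (.var 38) (.const 1) ⨟ assign 41 (.sub (.var 41) (.var 36)))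

/-- Array `c` gets the indicator of an optimal selection among the first `var 43` items when both
the first block and the start of the second block are `var 42`. -/
def backtrack (a b f c : ℕ) (cost : Expr → Expr) : Prog :=
  assign 41 (.var 42) ⨟
  forLoop 25 43 (
    assign 38 (.sub (.var 43) (.add (.var 25) (.const 1))) ⨟
    loadItem a 42 ⨟
    decideItem b f c cost)
end Prog

/-- The memory holds what the dynamic program needs for the items listed in array `a`, with prefix
sums in array `b`. -/
structure ItemData (s : Mem) (n P : ℕ) (p r : ℕ → ℕ) (K : ℕ → ℕ → ℕ) (a b : ℕ)
    (cost : Expr → Expr) : Prop where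
  v2 : s.var 2 = P
  v3 : s.var 3 = n + 1
  v4 : s.var 4 = P + 1
  time : ∀ i < n, s.arr 0 (s.arr a i) = p i
  needs : ∀ i < n, s.arr 2 (s.arr a i) = r i
  sums : ∀ i ≤ n, s.arr b i = tot p i
  tot_le : tot p n ≤ P
  rows : ∀ i < n + 1, s.arr 12 i = i * (P + 1)
  layers : ∀ i < P + 1, s.arr 13 i = i * ((n + 1) * (P + 1))
  eval_cost : ∀ i < n, ∀ t : Mem, t.var 2 = P → t.arr 4 = s.arr 4 → t.arr 5 = s.arr 5 →
    t.var 35 = s.arr a i → t.var 36 = p i → ∀ e : Expr, e.eval t ≤ 2 * P →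
    (cost e).eval t = K i (e.eval t)
  cost_le : ∀ e : Expr, (cost e).cost ≤ e.cost + 9

theorem ItemData.congr {s s' : Mem} {n P : ℕ} {p r : ℕ → ℕ} {K : ℕ → ℕ → ℕ} {a b : ℕ}
    {cost : Expr → Expr} (h : ItemData s n P p r K a b cost)
    (e2 : s'.var 2 = s.var 2) (e3 : s'.var 3 = s.var 3) (e4 : s'.var 4 = s.var 4)
    (ha : ∀ x ∈ [0, 2, 4, 5, 12, 13, a, b], s'.arr x = s.arr x) :
    ItemData s' n P p r K a b cost := by
  have a0 := ha 0 (by simp)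
  have a2 := ha 2 (by simp)
  have a4 := ha 4 (by simp)
  have a5 := ha 5 (by simp)
  have a12 := ha 12 (by simp)
  have a13 := ha 13 (by simp)
  have aa := ha a (by simp)
  have ab := ha b (by simp)
  obtain ⟨h1, h2, h3, h4, h5, h6, h7, h8, h9, h10, h11⟩ := h
  constructor <;> simpa only [e2, e3, e4, a0, a2, a4, a5, a12, a13, aa, ab]

/-- Address of an entry of a table. -/
def addr (n P α i a : ℕ) : ℕ := α * ((n + 1) * (P + 1)) + i * (P + 1) + a

/-- Addresses are mixed-radix numerals with digits in range, so distinct entries of a table never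
overwrite each other. -/
theorem addr_inj {n P α i a α' i' a' : ℕ} (hi : i ≤ n) (ha : a ≤ P) (hi' : i' ≤ n) (ha' : a' ≤ P)
    (h : addr n P α i a = addr n P α' i' a') : α = α' ∧ i = i' ∧ a = a' := by
  have key : ∀ {m x x' y y' : ℕ}, y < m → y' < m → x * m + y = x' * m + y' → x = x' ∧ y = y' := by
    intro m x x' y y' hy hy' h
    have hm : 0 < m := by omega
    have h1 := congrArg (· / m) h
    simp only [mul_comm _ m, Nat.mul_add_div hm, Nat.div_eq_of_lt hy, Nat.div_eq_of_lt hy'] at h1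
    have h1 : x = x' := by omega
    subst h1
    omega
  unfold addr at h
  have e1 : ∀ α i, α * ((n + 1) * (P + 1)) + i * (P + 1) = (α * (n + 1) + i) * (P + 1) := by
    intros; ring
  rw [e1, e1] at h
  obtain ⟨h1, h2⟩ := key (by omega) (by omega) h
  obtain ⟨h3, h4⟩ := key (by omega) (by omega) h1
  exact ⟨h3, h4, h2⟩

/-! ### Correctness and running time of table filling and backtracking. -/

section

variable {s : Mem} {n P : ℕ} {p r : ℕ → ℕ} {K : ℕ → ℕ → ℕ} {a b f : ℕ} {cost : Expr → Expr}

theorem ItemData.tot_le' (D : ItemData s n P p r K a b cost) {i : ℕ} (hi : i ≤ n) : tot p i ≤ P :=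
  (Finset.sum_le_sum_of_subset (Finset.range_subset_range.2 hi)).trans D.tot_le

theorem runs_stayOption (D : ItemData s n P p r K a b cost) {α i x : ℕ} (hα : α ≤ P) (hi : i < n)
    (h22 : s.var 22 = α) (h24 : s.var 24 = x) (h38 : s.var 38 = i)
    (h35 : s.var 35 = s.arr a i) (h36 : s.var 36 = p i)
    (hf : s.arr f (s.var 39 + x) = dp p r K α i x) :
    Runs (Prog.stayOption b f cost) s 50 fun s' => s'.var 37 =
      if dp p r K α i x = 0 then 0 else dp p r K α i x + K i (α + (tot p i - x)) := by
  have ht := D.tot_le' hi.le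
  have c1 := D.eval_cost i hi (s.setVar 40 (dp p r K α i x)) (by simp [D.v2]) rfl rfl
    (by simp [h35]) (by simp [h36]) (.add (.var 22) (.sub (.arr b (.var 38)) (.var 24)))
    (by simp [Expr.eval, h22, h38, h24, D.sums i hi.le]; omega)
  refine Runs.flat ?_ ?_
  · by_cases h0 : dp p r K α i x = 0
    · simp [Prog.stayOption, Prog.wp, Test.holds, Expr.eval, h24, hf, h0]
    · simp only [Prog.stayOption, Prog.wp, Test.holds, Expr.eval, h24, hf, Mem.setVar_var, c1]
      simp [h0, h22, h38, D.sums i hi.le]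
  · have c1 := D.cost_le (.add (.var 22) (.sub (.arr b (.var 38)) (.var 24)))
    simp only [Prog.stayOption, Prog.flatCost, Expr.cost, Test.cost] at c1 ⊢
    omega

theorem runs_takeOption (D : ItemData s n P p r K a b cost) {α i x v : ℕ} (hi : i < n)
    (hx : x ≤ P) (h24 : s.var 24 = x) (h37 : s.var 37 = v)
    (h35 : s.var 35 = s.arr a i) (h36 : s.var 36 = p i)
    (hf : s.arr f (s.var 39 + (x - p i)) = dp p r K α i (x - p i)) :
    Runs (Prog.takeOption f cost) s 60 fun s' => s'.var 37 =
      better v (if r i = 0 ∧ p i ≤ x ∧ dp p r K α i (x - p i) ≠ 0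
        then dp p r K α i (x - p i) + K i (x - p i) else 0) := by
  have c1 := D.eval_cost i hi (s.setVar 40 (dp p r K α i (x - p i))) (by simp [D.v2]) rfl rfl
    (by simp [h35]) (by simp [h36]) (.sub (.var 24) (.var 36))
    (by simp [Expr.eval, h24, h36]; omega)
  simp only [Expr.eval, Mem.setVar_var, h24, h36] at c1
  refine Runs.flat ?_ ?_
  · by_cases h1 : r i = 0 ∧ p i ≤ x
    · obtain ⟨h1, h2⟩ := h1
      by_cases h3 : dp p r K α i (x - p i) = 0
      · simp [Prog.takeOption, Prog.wp, Test.holds, Expr.eval, h24, h36, h35, D.needs i hi, hf, h1,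
          h2, h3, h37, better]
      · simp [Prog.takeOption, Prog.wp, Test.holds, Expr.eval, h24, h36, h35, D.needs i hi, hf, h1,
          h2, h3, h37, better, c1]
        omega
    · have h2 : ¬ (r i = 0 ∧ p i ≤ x ∧ dp p r K α i (x - p i) ≠ 0) := fun h => h1 ⟨h.1, h.2.1⟩
      simp only [Prog.takeOption, Prog.wp, Test.holds, Expr.eval, h24, h36, h35, D.needs i hi, h1,
        h2, h37, better, if_false]
      simp
  · have c1 := D.cost_le (.sub (.var 24) (.var 36))
    simp only [Prog.takeOption, Prog.flatCost, Expr.cost, Test.cost] at c1 ⊢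
    omega

theorem runs_loadItem (D : ItemData s n P p r K a b cost) {α i x : ℕ} (hα : α ≤ P) (hi : i < n)
    (hx : s.var x = α) (h38 : s.var 38 = i) (hx35 : x ≠ 35) (hx36 : x ≠ 36) :
    Runs (Prog.loadItem a x) s 15 fun s' =>
      s'.var 35 = s.arr a i ∧ s'.var 36 = p i ∧ ∀ y, s'.var 39 + y = addr n P α i y := by
  refine Runs.flat ?_ (by simp [Prog.loadItem, Prog.flatCost, Expr.cost])
  simp [Prog.loadItem, Prog.wp, Expr.eval, h38, hx, hx35, hx36, D.time i hi, D.rows i (by omega),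
    D.layers α (by omega), addr]

theorem runs_tableEntry (D : ItemData s n P p r K a b cost) {α i x : ℕ} (hα : α ≤ P) (hi : i ≤ n)
    (hx : x ≤ P) (h22 : s.var 22 = α) (h23 : s.var 23 = i) (h24 : s.var 24 = x)
    (hf : ∀ i' x', i = i' + 1 → x' ≤ P → s.arr f (addr n P α i' x') = dp p r K α i' x') :
    Runs (Prog.tableEntry a b f cost) s 150 fun s' => s'.var 37 = dp p r K α i x := by
  refine (Runs.branch (T := 130) (fun h => ?_) fun h => ?_).imp (by decide) fun _ _ h => h
  · have h : i = 0 := by simpa [Test.holds, Expr.eval, h23] using h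
    subst h
    refine Runs.flat ?_ (by decide)
    simp [Prog.wp, Expr.eval, Test.holds, h24, dp]
  have h : i ≠ 0 := by simpa [Test.holds, Expr.eval, h23] using h
  obtain ⟨i, rfl⟩ := Nat.exists_eq_succ_of_ne_zero h
  have hi : i < n := hi
  refine Runs.step (T₁ := 4) (T₂ := 126) (Q := fun s' => s'.var 38 = i)
    (Runs.flat (by simp [Prog.wp, Expr.eval, h23]) (by decide)) (fun s₁ f₁ q₁ => ?_) le_rfl
  have D₁ := D.congr (s' := s₁) (f₁.1 2 rfl) (f₁.1 3 rfl) (f₁.1 4 rfl) fun y _ => f₁.2 y rfl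
  refine Runs.step (runs_loadItem D₁ hα hi (by rw [f₁.1 22 rfl, h22]) q₁ (by decide) (by decide))
    (T₂ := 110) (fun s₂ f₂ q₂ => ?_) (by decide)
  have D₂ := D₁.congr (s' := s₂) (f₂.1 2 rfl) (f₂.1 3 rfl) (f₂.1 4 rfl) fun y _ => f₂.2 y rfl
  refine Runs.step (runs_stayOption D₂ hα hi (by rw [f₂.1 22 rfl, f₁.1 22 rfl, h22])
    (by rw [f₂.1 24 rfl, f₁.1 24 rfl, h24]) (by rw [f₂.1 38 rfl, q₁]) (by rw [q₂.1, f₂.2 a rfl])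
    q₂.2.1 (by rw [q₂.2.2, f₂.2 f rfl, f₁.2 f rfl, hf i x rfl hx])) (T₂ := 60)
    (fun s₃ f₃ q₃ => ?_) le_rfl
  have D₃ := D₂.congr (s' := s₃) (f₃.1 2 rfl) (f₃.1 3 rfl) (f₃.1 4 rfl) fun y _ => f₃.2 y rfl
  have := runs_takeOption (f := f) (α := α) D₃ hi hx
    (by rw [f₃.1 24 rfl, f₂.1 24 rfl, f₁.1 24 rfl, h24]) q₃
    (by rw [f₃.1 35 rfl, q₂.1, f₃.2 a rfl, f₂.2 a rfl]) (by rw [f₃.1 36 rfl, q₂.2.1])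
    (by rw [f₃.1 39 rfl, q₂.2.2, f₃.2 f rfl, f₂.2 f rfl, f₁.2 f rfl, hf i _ rfl (by omega)])
  rw [dp]
  exact this

theorem runs_fillTable (D : ItemData s n P p r K a b cost)
    (hf : ∀ y ∈ [0, 2, 4, 5, 12, 13, a, b], f ≠ y) :
    Runs (Prog.fillTable a b f cost) s ((P + 1) * ((n + 1) * ((P + 1) * 180 + 20) + 20) + 20)
      fun s' => ∀ α ≤ P, ∀ i ≤ n, ∀ x ≤ P, s'.arr f (addr n P α i x) = dp p r K α i x := by
  have hD : ∀ {c : Prog} {s' t : Mem}, Frame c s' t → c.writesVar 2 = false →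
      c.writesVar 3 = false → c.writesVar 4 = false → (∀ y, f ≠ y → c.writesArr y = false) →
      ItemData s' n P p r K a b cost →
      ItemData t n P p r K a b cost := fun h h2 h3 h4 h5 D' =>
    D'.congr (h.1 2 h2) (h.1 3 h3) (h.1 4 h4) fun y hy => h.2 y (h5 y (hf y hy))
  have hw : ∀ y, f ≠ y → (Prog.tableEntry a b f cost ⨟
      .store f (.add (.add (.arr 13 (.var 22)) (.arr 12 (.var 23))) (.var 24)) (.var 37)).writesArr y
        = false := fun y hy => beq_false_of_ne hy
  -- One invariant serves all three loops: the entries are filled by increasing address, and those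
  -- with address below `q` are correct. The end of a row or layer has the address at which the next
  -- one starts.
  let Inv : ℕ → Mem → Prop := fun q s' => ∀ α ≤ P, ∀ i ≤ n, ∀ x ≤ P, addr n P α i x < q →
    s'.arr f (addr n P α i x) = dp p r K α i x
  refine Runs.iterate (N := P + 1) (T := (n + 1) * ((P + 1) * 180 + 20) + 8)
    (fun α => Inv (addr n P α 0 0)) D.v4 rfl (by decide) rfl (fun _ _ _ h => h)
    (by simp [Inv, addr]) ?_
    (Nat.add_le_add (Nat.mul_le_mul_left _ (by omega)) (by omega)) ?_
  · intro α t₁ hα h22 f₁ q₁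
    have D₁ := hD f₁ rfl rfl rfl (fun y hy => by simp [hw y hy]) D
    refine Runs.iterate (N := n + 1) (T := (P + 1) * 180 + 8)
      (fun i => Inv (addr n P α i 0)) D₁.v3 rfl (by decide) rfl (fun _ _ _ h => h) q₁ ?_
      (Nat.add_le_add_right (Nat.mul_le_mul_left _ (by omega)) _) ?_
    · intro i t₂ hi h23 f₂ q₂
      have D₂ := hD f₂ rfl rfl rfl (fun y hy => by simp [hw y hy]) D₁
      refine Runs.iterate (N := P + 1) (T := 165)
        (fun x => Inv (addr n P α i x)) D₂.v4 rfl (by decide) rfl (fun _ _ _ h => h) q₂ ?_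
        (by omega) ?_
      · intro x t₃ hx h24 f₃ q₃
        have D₃ := hD f₃ rfl rfl rfl (fun y hy => by simp [hw y hy]) D₂
        have e22 : t₃.var 22 = α := by rw [f₃.1 22 rfl, f₂.1 22 rfl, h22]
        have e23 : t₃.var 23 = i := by rw [f₃.1 23 rfl, h23]
        refine Runs.step (runs_tableEntry D₃ (by omega) (by omega) (by omega) e22 e23 h24 ?_)
          (T₂ := 10) (fun t₄ f₄ q₄ => Runs.flat ?_
            (by simp [Prog.flatCost, Expr.cost])) (by omega)
        · rintro i' x' rfl hx'
          refine q₃ α (by omega) i' (by omega) x' hx' ?_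
          unfold addr
          rw [add_mul i']
          omega
        · have D₄ := hD f₄ rfl rfl rfl (fun _ _ => rfl) D₃
          simp only [Prog.wp, Expr.eval, q₄, f₄.1 22 rfl, f₄.1 23 rfl, f₄.1 24 rfl, e22, e23, h24,
            D₄.rows i hi, D₄.layers α hα]
          rw [show α * ((n + 1) * (P + 1)) + i * (P + 1) + x = addr n P α i x from rfl]
          intro α' hα' i' hi' x' hx' hlt
          rw [Mem.setArr_arr, if_pos rfl]
          by_cases heq : addr n P α' i' x' = addr n P α i x
          · obtain ⟨rfl, rfl, rfl⟩ := addr_inj hi' hx' (by omega) (by omega) heq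
            exact Function.update_self _ _ _
          · rw [Function.update_of_ne heq, f₄.2 f rfl]
            refine q₃ α' hα' i' hi' x' hx' ?_
            unfold addr at hlt heq ⊢
            omega
      · intro t g q
        have : addr n P α i (P + 1) = addr n P α (i + 1) 0 := by unfold addr; ring
        rwa [this] at q
    · intro t g q
      have : addr n P α (n + 1) 0 = addr n P (α + 1) 0 0 := by unfold addr; ring
      rwa [this] at q
  · intro t g q α hα i hi x hx
    refine q α hα i hi x hx ?_
    have h1 : (α + 1) * ((n + 1) * (P + 1)) ≤ (P + 1) * ((n + 1) * (P + 1)) :=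
      Nat.mul_le_mul_right _ (by omega)
    have h2 : (i + 1) * (P + 1) ≤ (n + 1) * (P + 1) := Nat.mul_le_mul_right _ (by omega)
    unfold addr
    rw [add_mul] at h1
    rw [add_mul i] at h2
    omega

/-- The test of the program is literally the case distinction of `trace`, with the optimal values
read from the table. -/
theorem runs_decideItem (D : ItemData s n P p r K a b cost) {α i x c : ℕ} (hα : α ≤ P)
    (hi : i < n) (hx : x ≤ P) (h42 : s.var 42 = α) (h41 : s.var 41 = x) (h38 : s.var 38 = i)
    (h35 : s.var 35 = s.arr a i) (h36 : s.var 36 = p i)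
    (h39 : s.arr f (s.var 39 + x) = dp p r K α i x)
    (hf : s.arr f (addr n P α (i + 1) x) = dp p r K α (i + 1) x) :
    Runs (Prog.decideItem b f c cost) s 60 fun s' =>
      s'.arr c = Function.update (s.arr c) i (if trace p r K α (i + 1) x i then 1 else 0) ∧
        s'.var 41 ≤ P ∧
        ∀ j < i, trace p r K α (i + 1) x j = trace p r K α i (s'.var 41) j := by
  have ht := D.tot_le' hi.le
  have c1 := D.eval_cost i hi (s.setVar 40 (dp p r K α i x)) (by simp [D.v2]) rfl rfl
    (by simp [h35]) (by simp [h36]) (.add (.var 42) (.sub (.arr b (.var 38)) (.var 41)))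
    (by simp [Expr.eval, h42, h38, h41, D.sums i hi.le]; omega)
  have c2 : Expr.eval (s.setVar 40 (dp p r K α i x))
      (.add (.var 42) (.sub (.arr b (.var 38)) (.var 41))) = α + (tot p i - x) := by
    simp [Expr.eval, h42, h38, h41, D.sums i hi.le]
  rw [c2] at c1
  refine Runs.flat ?_ ?_
  · simp only [Prog.decideItem, Prog.wp, Test.holds, Expr.eval, h41, h39, c1, Mem.setVar_var,
      Mem.setVar_arr]
    have e : (s.arr 13 α + s.arr 12 (i + 1)) + x = addr n P α (i + 1) x := by
      rw [D.layers α (by omega), D.rows (i + 1) (by omega), addr]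
    simp only [Nat.reduceEqDiff, if_true, if_false, h42, h38, e, hf, Mem.setArr_arr]
    constructor
    · intro hs
      refine ⟨?_, ?_, fun j hj => ?_⟩
      · rw [trace, if_pos hs, if_pos rfl]
        simp
      · simpa [h41] using hx
      · rw [trace, if_pos hs, if_neg hj.ne]
        simp [h41]
    · intro hs
      refine ⟨?_, ?_, fun j hj => ?_⟩
      · rw [trace, if_neg hs, if_pos rfl]
        simp
      · simp [h41, h36]; omega
      · rw [trace, if_neg hs, if_neg hj.ne]
        simp [h41, h36]
  · have c1 := D.cost_le (.add (.var 42) (.sub (.arr b (.var 38)) (.var 41)))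
    simp only [Prog.decideItem, Prog.flatCost, Expr.cost, Test.cost] at c1 ⊢
    omega

theorem runs_backtrack (D : ItemData s n P p r K a b cost) {α k c : ℕ} (hα : α ≤ P) (hk : k ≤ n)
    (h42 : s.var 42 = α) (h43 : s.var 43 = k)
    (hc : ∀ y ∈ [0, 2, 4, 5, 12, 13, a, b], c ≠ y) (hcf : c ≠ f)
    (hf : ∀ α ≤ P, ∀ i ≤ n, ∀ x ≤ P, s.arr f (addr n P α i x) = dp p r K α i x) :
    Runs (Prog.backtrack a b f c cost) s (k * 100 + 20) fun s' =>
      ∀ j < k, s'.arr c j = if trace p r K α k α j then 1 else 0 := by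
  refine Runs.step (T₁ := 2) (T₂ := k * 100 + 8) (Q := fun s' => s'.var 41 = α)
    (Runs.flat (by simp [Prog.wp, Expr.eval, h42]) (by decide)) (fun s₁ f₁ q₁ => ?_) (by omega)
  refine Runs.iterate (N := k) (T := 90)
    -- Round `t` decides item `k - 1 - t`. The undecided items follow the trace that starts from the
    -- remaining block size in variable `41`; the decided ones are already recorded.
    (fun t s' => s'.var 41 ≤ P ∧
      (∀ j < k - t, trace p r K α k α j = trace p r K α (k - t) (s'.var 41) j) ∧
      ∀ j < k, k - t ≤ j → s'.arr c j = if trace p r K α k α j then 1 else 0)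
    (by rw [f₁.1 43 rfl, h43]) rfl (by decide) rfl (by simp)
    ⟨by omega, by simp [q₁], by intro j h1 h2; omega⟩ ?_ (by omega)
    fun s' _ h j hj => h.2.2 j hj (by omega)
  intro t s₂ ht h25 f₂ q₂
  have D₂ := D.congr (s' := s₂) (by rw [f₂.1 2 rfl, f₁.1 2 rfl]) (by rw [f₂.1 3 rfl, f₁.1 3 rfl])
    (by rw [f₂.1 4 rfl, f₁.1 4 rfl]) fun y hy => by
      rw [f₂.2 y, f₁.2 y rfl]
      simp [Prog.loadItem, Prog.decideItem, Prog.writesArr, hc y hy]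
  have e2f : s₂.arr f = s.arr f := by
    rw [f₂.2 f, f₁.2 f rfl]
    simp [Prog.loadItem, Prog.decideItem, Prog.writesArr, hcf]
  have e242 : s₂.var 42 = α := by rw [f₂.1 42 rfl, f₁.1 42 rfl, h42]
  have e243 : s₂.var 43 = k := by rw [f₂.1 43 rfl, f₁.1 43 rfl, h43]
  obtain ⟨i, hi⟩ : ∃ i, k - t = i + 1 := ⟨k - t - 1, by omega⟩
  have hi' : k - (t + 1) = i := by omega
  have hin : i < n := by omega
  rw [hi] at q₂
  rw [hi']
  refine Runs.step (T₁ := 8) (T₂ := 75) (Q := fun s' => s'.var 38 = i)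
    (Runs.flat (by simp [Prog.wp, Expr.eval, h25, e243, hi']) (by decide)) (fun s₃ f₃ q₃ => ?_)
    (by omega)
  have D₃ := D₂.congr (s' := s₃) (f₃.1 2 rfl) (f₃.1 3 rfl) (f₃.1 4 rfl) fun y _ => f₃.2 y rfl
  refine Runs.step (runs_loadItem D₃ hα hin (by rw [f₃.1 42 rfl, e242]) q₃ (by decide)
    (by decide)) (T₂ := 60) (fun s₄ f₄ q₄ => ?_) le_rfl
  have D₄ := D₃.congr (s' := s₄) (f₄.1 2 rfl) (f₄.1 3 rfl) (f₄.1 4 rfl) fun y _ => f₄.2 y rfl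
  have e4f : s₄.arr f = s.arr f := by rw [f₄.2 f rfl, f₃.2 f rfl, e2f]
  have e4c : s₄.arr c = s₂.arr c := by rw [f₄.2 c rfl, f₃.2 c rfl]
  refine (runs_decideItem (f := f) (c := c) (x := s₂.var 41) D₄ hα hin q₂.1
    (by rw [f₄.1 42 rfl, f₃.1 42 rfl, e242]) (by rw [f₄.1 41 rfl, f₃.1 41 rfl])
    (by rw [f₄.1 38 rfl, q₃]) (by rw [q₄.1, f₄.2 a rfl]) q₄.2.1
    (by rw [q₄.2.2, e4f, hf α hα i hin.le _ q₂.1])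
    (by rw [e4f, hf α hα (i + 1) hin _ q₂.1])).imp le_rfl ?_
  rintro s₅ - ⟨h1, h2, h3⟩
  refine ⟨h2, fun j hj => ?_, fun j hj hij => ?_⟩
  · rw [q₂.2.1 j (by omega), h3 j hj]
  · rw [h1, e4c]
    rcases hij.lt_or_eq with h | rfl
    · rw [Function.update_of_ne h.ne', q₂.2.2 j hj h]
    · rw [Function.update_self, q₂.2.1 i (by omega)]

end

/-! ### Listing the jobs of a split schedule -/

/-- The sorted jobs of the classes below `c`, class by class. -/
def classList (n : ℕ) (cls : ℕ → ℕ) : ℕ → List ℕ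
  | 0 => []
  | c + 1 => classList n cls c ++ (List.range n).filter (fun i => cls i = c)

theorem mem_classList {n : ℕ} {cls : ℕ → ℕ} {c i : ℕ} :
    i ∈ classList n cls c ↔ i < n ∧ cls i < c := by
  induction c with
  | zero => simp [classList]
  | succ c ih =>
    simp only [classList, List.mem_append, ih, List.mem_filter, List.mem_range, decide_eq_true_eq]
    omega

theorem pairwise_classList (n : ℕ) (cls : ℕ → ℕ) (c : ℕ) :
    (classList n cls c).Pairwise fun i j => classKey n cls i < classKey n cls j := by
  induction c with
  | zero => exact List.Pairwise.nil
  | succ c ih =>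
    rw [classList, List.pairwise_append]
    refine ⟨ih, ?_, fun i hi j hj => ?_⟩
    · refine (List.pairwise_lt_range.filter _).imp_of_mem fun {i j} hi hj hij => ?_
      simp only [List.mem_filter, List.mem_range, decide_eq_true_eq] at hi hj
      exact (classKey_lt hi.1 hj.1).2 (by omega)
    · rw [mem_classList] at hi
      simp only [List.mem_filter, List.mem_range, decide_eq_true_eq] at hj
      exact (classKey_lt hi.1 hj.1).2 (by omega)

theorem length_classList {n : ℕ} {cls : ℕ → ℕ} {c : ℕ} (h : ∀ i < n, cls i < c) :
    (classList n cls c).length = n := by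
  have h1 : (classList n cls c).Nodup :=
    (pairwise_classList n cls c).imp fun h => by rintro rfl; exact lt_irrefl _ h
  rw [← List.toFinset_card_of_nodup h1]
  have : (classList n cls c).toFinset = Finset.range n := by
    ext i
    simp only [List.mem_toFinset, mem_classList, Finset.mem_range]
    exact ⟨fun h => h.1, fun hi => ⟨hi, h i hi⟩⟩
  rw [this, Finset.card_range]

/-- The class list contains each index once, so reading it through `o` is an injective self-map of
the finite set of jobs, hence a permutation. -/
theorem Inst.exists_follows {I : Inst} {o cls : ℕ → ℕ}
    (ho : SortedOrder I.n (I.input.arr 0) (I.input.arr 1) o) (hcls : ∀ i < I.n, cls i < 3) :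
    ∃ σ : I.Sequence, Inst.Follows o cls σ ∧
      ∀ (k : Fin I.n) (x : ℕ), (classList I.n cls 3)[(k : ℕ)]? = some x → (σ k : ℕ) = o x := by
  have hlen : (classList I.n cls 3).length = I.n := length_classList hcls
  have hmem : ∀ i, i ∈ classList I.n cls 3 ↔ i < I.n := fun i =>
    mem_classList.trans ⟨fun h => h.1, fun h => ⟨h, hcls i h⟩⟩
  have hpair := List.pairwise_iff_getElem.1 (pairwise_classList I.n cls 3)
  generalize classList I.n cls 3 = L at hlen hmem hpair ⊢
  have hlt : ∀ k : Fin I.n, (k : ℕ) < L.length := fun k => by rw [hlen]; exact k.2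
  have hget : ∀ k : Fin I.n, L[(k : ℕ)]'(hlt k) < I.n := fun k =>
    (hmem _).1 (List.getElem_mem _)
  let f : Fin I.n → Fin I.n := fun k => ⟨o (L[(k : ℕ)]'(hlt k)), ho.lt _ (hget k)⟩
  have hf : Function.Injective f := by
    intro k k' h
    have h1 := ho.inj _ (hget k) _ (hget k') (congrArg Fin.val h)
    rcases lt_trichotomy (k : ℕ) k' with h2 | heq | h2
    · have := hpair k k' (hlt k) (hlt k') h2
      simp [h1] at this
    · exact Fin.ext heq
    · have := hpair k' k (hlt k') (hlt k) h2
      simp [h1] at this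
  let σ : I.Sequence := Equiv.ofBijective f (Finite.injective_iff_bijective.1 hf)
  have hpos : ∀ (k : ℕ) (hk : k < L.length), Inst.position σ (o L[k]) = k := by
    intro k hk
    have h1 : o L[k] = (σ ⟨k, hlen.subst hk⟩ : ℕ) := rfl
    rw [h1, Inst.position_coe, Equiv.symm_apply_apply]
  refine ⟨σ, fun i hi j hj hij => ?_, fun k x hx => ?_⟩
  · obtain ⟨a, ha, rfl⟩ := List.getElem_of_mem ((hmem i).2 hi)
    obtain ⟨b, hb, rfl⟩ := List.getElem_of_mem ((hmem j).2 hj)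
    rw [hpos a ha, hpos b hb]
    by_contra hab
    rcases (not_lt.1 hab).lt_or_eq with h | rfl
    · have := hpair b a hb ha h
      omega
    · omega
  · obtain ⟨h1, h2⟩ := List.getElem?_eq_some_iff.1 hx
    rw [← h2]
    rfl

namespace Prog

/-- Item costs before the split: weight of job `var 35` times position. -/
def exprL (e : Expr) : Expr := .arr 4 (.add (.arr 5 (.var 35)) e)

/-- Item costs after the split. -/
def exprR (e : Expr) : Expr :=
  .arr 4 (.add (.arr 5 (.var 35)) (.sub (.sub (.var 2) (.var 36)) e))

/-- Array `16` gets the classes of the sorted jobs for the split `var 9`, from the selections in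
the arrays `14` and `15`. -/
def classify : Prog :=
  forLoop 20 0
    (branch (.le (.add (.var 20) (.const 1)) (.var 9))
      (store 16 (.var 20) (.sub (.const 1) (.arr 14 (.var 20))))
      (store 16 (.var 20)
        (.add (.const 1) (.arr 15 (.sub (.sub (.var 0) (.const 1)) (.var 20))))))

/-- The jobs are appended to the output class by class; the next free cell is `var 7`. -/
def listJobs : Prog :=
  forLoop 26 12 (forLoop 20 0
    (branch (.eq (.arr 16 (.var 20)) (.var 26))
      (store 3 (.var 7) (.arr 6 (.var 20)) ⨟ assign 7 (.add (.var 7) (.const 1)))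
      skip))

/-- Output of the split schedule for the split `var 9` with first block of size `var 10` and last
block of size `var 11`. -/
def emit : Prog :=
  assign 42 (.var 10) ⨟
  assign 43 (.var 9) ⨟
  backtrack 6 8 10 14 exprL ⨟
  assign 42 (.var 11) ⨟
  assign 43 (.sub (.var 0) (.var 9)) ⨟
  backtrack 7 9 11 15 exprR ⨟
  classify ⨟
  listJobs ⨟
  assign 1 (.add (.var 1) (.const 1))

end Prog

/-- The memory holds all tables. -/
structure Ready (s : Mem) (n P : ℕ) (p w r o : ℕ → ℕ) : Prop where
  v0 : s.var 0 = n
  v12 : s.var 12 = 3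
  jobs : s.arr 6 = o
  tot_eq : tot p n = P
  left : ItemData s n P p r (costL w) 6 8 Prog.exprL
  right : ItemData s n P (rev n p) (rev n r) (costR n p w) 7 9 Prog.exprR
  tableL : ∀ α ≤ P, ∀ i ≤ n, ∀ x ≤ P, s.arr 10 (addr n P α i x) = dpL p w r α i x
  tableR : ∀ α ≤ P, ∀ i ≤ n, ∀ x ≤ P, s.arr 11 (addr n P α i x) = dpR n p w r α i x

theorem Ready.congr {s s' : Mem} {n P : ℕ} {p w r o : ℕ → ℕ} (h : Ready s n P p w r o) {c : Prog}
    (hf : Frame c s s') (hv : ([0, 2, 3, 4, 12].all fun x => !c.writesVar x) = true)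
    (ha : ([0, 2, 4, 5, 6, 7, 8, 9, 10, 11, 12, 13].all fun x => !c.writesArr x) = true) :
    Ready s' n P p w r o := by
  simp only [List.all_cons, List.all_nil, Bool.and_true, Bool.and_eq_true,
    Bool.not_eq_true'] at hv ha
  obtain ⟨v0, v2, v3, v4, v12⟩ := hv
  obtain ⟨a0, a2, a4, a5, a6, a7, a8, a9, a10, a11, a12, a13⟩ := ha
  refine ⟨by rw [hf.1 0 v0, h.v0], by rw [hf.1 12 v12, h.v12], by rw [hf.2 6 a6, h.jobs], h.tot_eq,
    h.left.congr (hf.1 2 v2) (hf.1 3 v3) (hf.1 4 v4) ?_,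
    h.right.congr (hf.1 2 v2) (hf.1 3 v3) (hf.1 4 v4) ?_, by rw [hf.2 10 a10]; exact h.tableL,
    by rw [hf.2 11 a11]; exact h.tableR⟩
  all_goals
    intro x hx
    simp only [List.mem_cons, List.not_mem_nil, or_false] at hx
    rcases hx with rfl | rfl | rfl | rfl | rfl | rfl | rfl | rfl <;> exact hf.2 _ (by assumption)

/-! ### Writing one optimal sequence to the output. -/

section Emit

variable {s : Mem} {n P : ℕ} {p w r o : ℕ → ℕ}

theorem runs_classify {k α y : ℕ} (h0 : s.var 0 = n) (h9 : s.var 9 = k) (hk : k ≤ n)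
    (h14 : ∀ j < k, s.arr 14 j = if trace p r (costL w) α k α j then 1 else 0)
    (h15 : ∀ j < n - k, s.arr 15 j =
      if trace (rev n p) (rev n r) (costR n p w) y (n - k) y j then 1 else 0) :
    Runs Prog.classify s (n * 40 + 8) fun s' =>
      ∀ i < n, s'.arr 16 i = splitClass n p w r k α y i := by
  refine Runs.iterate (N := n) (T := 30)
    (fun i s' => ∀ j < i, s'.arr 16 j = splitClass n p w r k α y j) h0 rfl (by decide) rfl
    (by simp) (by simp) ?_ le_rfl fun _ _ h => h
  intro i t hi hv f q
  have key : ∀ v, v = splitClass n p w r k α y i → ∀ j < i + 1,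
      Function.update (t.arr 16) i v j = splitClass n p w r k α y j := by
    rintro v rfl j hj
    rcases Nat.lt_succ_iff_lt_or_eq.1 hj with hj | rfl
    · rw [Function.update_of_ne hj.ne, q j hj]
    · rw [Function.update_self]
  refine Runs.flat ?_ (by decide)
  simp only [Prog.wp, Test.holds, Expr.eval, hv, f.1 9 rfl, f.1 0 rfl, f.2 14 rfl, f.2 15 rfl, h9,
    h0, Mem.setArr_arr, if_true]
  refine ⟨fun h => key _ ?_, fun h => key _ ?_⟩
  · rw [h14 i h, splitClass, if_pos (show i < k from h)]
    split_ifs <;> rfl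
  · rw [h15 (n - 1 - i) (by omega), splitClass, if_neg (show ¬ i < k from h)]
    split_ifs <;> rfl

theorem runs_listJobs {cls : ℕ → ℕ} {q : ℕ} (h0 : s.var 0 = n) (h12 : s.var 12 = 3)
    (h6 : s.arr 6 = o) (h16 : ∀ i < n, s.arr 16 i = cls i) (h7 : s.var 7 = q) :
    Runs Prog.listJobs s (3 * (n * 30 + 20) + 8) fun s' =>
      s'.var 7 = q + (classList n cls 3).length ∧
      (∀ x < q, s'.arr 3 x = s.arr 3 x) ∧
      ∀ k x, (classList n cls 3)[k]? = some x → s'.arr 3 (q + k) = o x := by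
  -- `L` is the part of the class list that has been written so far; the cells below `q`, which hold
  -- earlier output, stay unchanged.
  let Inv : List ℕ → Mem → Prop := fun L s' => s'.var 7 = q + L.length ∧
    (∀ x < q, s'.arr 3 x = s.arr 3 x) ∧ ∀ k x, L[k]? = some x → s'.arr 3 (q + k) = o x
  have hv : ∀ (L : List ℕ) (s' : Mem) (x v : ℕ), x ≠ 7 → Inv L s' → Inv L (s'.setVar x v) := by
    intro L s' x v hx h
    simpa [Inv, hx.symm] using h
  refine Runs.iterate (N := 3) (T := n * (20 + 10) + 8) (fun c => Inv (classList n cls c)) h12 rfl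
    (by decide) rfl (fun i s' v => hv _ s' 26 v (by decide)) (by simp [Inv, classList, h7]) ?_
    (by omega) fun _ _ h => h
  intro c t hc h26 f I₁
  refine Runs.iterate (N := n) (T := 20)
    (fun i => Inv (classList n cls c ++ (List.range i).filter (fun i => cls i = c)))
    (by rw [f.1 0 rfl, h0]) rfl (by decide) rfl (fun i s' v => hv _ s' 20 v (by decide))
    (by simpa using I₁) ?_ le_rfl fun _ _ h => h
  intro i t' hi h20 f' I₂
  rw [List.range_succ, List.filter_append, ← List.append_assoc]
  set L := classList n cls c ++ (List.range i).filter (fun i => cls i = c) with hL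
  have e16 : t'.arr 16 i = cls i := by rw [f'.2 16 rfl, f.2 16 rfl, h16 i hi]
  refine Runs.flat ?_ (by decide)
  simp only [Prog.wp, Test.holds, Expr.eval, h20, f'.1 26 rfl, h26, e16]
  refine ⟨fun h => ?_, fun h => by simpa [h] using I₂⟩
  obtain ⟨I₃, I₄, I₅⟩ := I₂
  have e6 : t'.arr 6 i = o i := by rw [f'.2 6 rfl, f.2 6 rfl, h6]
  simp only [List.filter_singleton, h, decide_true, e6]
  refine ⟨by simp [I₃, add_assoc], fun x hx => ?_, fun k x hk => ?_⟩
  · simp only [Mem.setVar_arr, Mem.setArr_arr, if_true]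
    rw [Function.update_of_ne (by omega), I₄ x hx]
  · simp only [Mem.setVar_arr, Mem.setArr_arr, if_true]
    rcases lt_trichotomy k L.length with hlt | rfl | hgt
    · rw [Function.update_of_ne (by omega), I₅ k x]
      simpa [List.getElem?_append, hlt] using hk
    · have : x = i := by simpa [List.getElem?_append, eq_comm] using hk
      rw [I₃, Function.update_self, this]
    · rw [List.getElem?_eq_none (by simp; omega)] at hk
      cases hk

theorem runs_emit (D : Ready s n P p w r o) {k α y e v q : ℕ}
    (hval : IsValueAt n p w r k α y e v) (h9 : s.var 9 = k) (h10 : s.var 10 = α)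
    (h11 : s.var 11 = y) (h7 : s.var 7 = q) :
    Runs Prog.emit s (n * 400 + 200) fun s' =>
      s'.var 1 = s.var 1 + 1 ∧ s'.var 7 = q + n ∧ (∀ x < q, s'.arr 3 x = s.arr 3 x) ∧
      ∀ i x, (classList n (splitClass n p w r k α y) 3)[i]? = some x → s'.arr 3 (q + i) = o x := by
  have hk : k ≤ n := hval.1
  have htot := hval.2.1
  rw [D.tot_eq] at htot
  refine Runs.step (T₁ := 2) (T₂ := n * 400 + 198) (Q := fun s' => s'.var 42 = α)
    (Runs.flat (by simp [Prog.wp, Expr.eval, h10]) (by decide)) (fun s₁ f₁ q₁ => ?_) (by omega)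
  have D₁ := D.congr f₁ rfl rfl
  refine Runs.step (T₁ := 2) (T₂ := n * 400 + 196) (Q := fun s' => s'.var 43 = k)
    (Runs.flat (by simp [Prog.wp, Expr.eval, f₁.1 9 rfl, h9]) (by decide)) (fun s₂ f₂ q₂ => ?_)
    (by omega)
  have D₂ := D₁.congr f₂ rfl rfl
  refine Runs.step (runs_backtrack (f := 10) (c := 14) (α := α) (k := k) D₂.left (by omega) hk
    (by rw [f₂.1 42 rfl, q₁]) q₂ (by decide) (by decide) D₂.tableL) (T₂ := n * 300 + 176)
    (fun s₃ f₃ q₃ => ?_) (by omega)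
  have D₃ := D₂.congr f₃ rfl rfl
  refine Runs.step (T₁ := 2) (T₂ := n * 300 + 174) (Q := fun s' => s'.var 42 = y)
    (Runs.flat (by simp [Prog.wp, Expr.eval, f₃.1 11 rfl, f₂.1 11 rfl, f₁.1 11 rfl, h11])
      (by decide)) (fun s₄ f₄ q₄ => ?_) (by omega)
  have D₄ := D₃.congr f₄ rfl rfl
  have e9 : s₄.var 9 = k := by rw [f₄.1 9 rfl, f₃.1 9 rfl, f₂.1 9 rfl, f₁.1 9 rfl, h9]
  refine Runs.step (T₁ := 4) (T₂ := n * 300 + 170) (Q := fun s' => s'.var 43 = n - k)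
    (Runs.flat (by simp [Prog.wp, Expr.eval, e9, D₄.v0]) (by decide)) (fun s₅ f₅ q₅ => ?_)
    (by omega)
  have D₅ := D₄.congr f₅ rfl rfl
  refine Runs.step (runs_backtrack (f := 11) (c := 15) (α := y) (k := n - k) D₅.right (by omega)
    (by omega) (by rw [f₅.1 42 rfl, q₄]) q₅ (by decide) (by decide) D₅.tableR)
    (T₂ := n * 200 + 150) (fun s₆ f₆ q₆ => ?_) (by omega)
  have D₆ := D₅.congr f₆ rfl rfl
  refine Runs.step (runs_classify (p := p) (w := w) (r := r) (α := α) (y := y) D₆.v0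
    (by rw [f₆.1 9 rfl, f₅.1 9 rfl, e9]) hk
    (by rw [f₆.2 14 rfl, f₅.2 14 rfl, f₄.2 14 rfl]; exact q₃) q₆) (T₂ := n * 100 + 100)
    (fun s₇ f₇ q₇ => ?_) (by omega)
  have D₇ := D₆.congr f₇ rfl rfl
  refine Runs.step (runs_listJobs (o := o) D₇.v0 D₇.v12 D₇.jobs q₇ (q := q)
    (by rw [f₇.1 7 rfl, f₆.1 7 rfl, f₅.1 7 rfl, f₄.1 7 rfl, f₃.1 7 rfl, f₂.1 7 rfl,
      f₁.1 7 rfl, h7]))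
    (T₂ := 4) (fun s₈ f₈ q₈ => Runs.flat ?_ (by decide)) (by omega)
  have e1 : s₈.var 1 = s.var 1 := by
    rw [f₈.1 1 rfl, f₇.1 1 rfl, f₆.1 1 rfl, f₅.1 1 rfl, f₄.1 1 rfl, f₃.1 1 rfl, f₂.1 1 rfl,
      f₁.1 1 rfl]
  have e3 : s₇.arr 3 = s.arr 3 := by
    rw [f₇.2 3 rfl, f₆.2 3 rfl, f₅.2 3 rfl, f₄.2 3 rfl, f₃.2 3 rfl, f₂.2 3 rfl, f₁.2 3 rfl]
  have hlen : (classList n (splitClass n p w r k α y) 3).length = n :=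
    length_classList fun i hi => by
      have := (splitClass_spec hval).1.le_two i hi
      omega
  rw [hlen, e3] at q₈
  simpa [Prog.wp, Expr.eval, e1] using q₈

end Emit

/-! ### The algorithm -/

namespace Prog

/-- The split schedule for the split `var 28` with first block of size `var 29` and middle block of
size `var 27` is compared with the best one so far: variable `6` is its value, the variables
`9`, `10`, `11` describe it, and variable `8` tells whether it was found for this `var 27`. -/
def trySplit : Prog :=
  branch (.le (.add (.var 29) (.var 27)) (.var 2))
    (assign 44 (.sub (.sub (.var 2) (.var 27)) (.var 29)) ⨟
      assign 45 (.arr 10 (.add (.add (.arr 13 (.var 29)) (.arr 12 (.var 28))) (.var 29))) ⨟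
      assign 46 (.arr 11
        (.add (.add (.arr 13 (.var 44)) (.arr 12 (.sub (.var 0) (.var 28)))) (.var 44))) ⨟
      branch (.conj (.neg (.eq (.var 45) (.const 0))) (.neg (.eq (.var 46) (.const 0))))
        (assign 45 (.add (.var 45) (.var 46)) ⨟
          branch (.conj (.neg (.eq (.var 6) (.const 0))) (.le (.var 6) (.var 45))) skip
            (assign 6 (.var 45) ⨟ assign 8 (.const 1) ⨟ assign 9 (.var 28) ⨟
              assign 10 (.var 29) ⨟ assign 11 (.var 44)))
        skip)
    skip

/-- All split schedules with middle block of size `var 27` are tried. -/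
def search : Prog := forLoop 28 3 (forLoop 29 4 trySplit)

/-- The Pareto front is listed in the order of increasing renting periods. -/
def listFront : Prog :=
  assign 1 (.const 0) ⨟
  assign 6 (.const 0) ⨟
  assign 7 (.const 0) ⨟
  forLoop 27 4 (
    assign 8 (.const 0) ⨟
    search ⨟
    branch (.eq (.var 8) (.const 1)) emit skip)

/-- Everything but the tables of the dynamic programs is computed. -/
def prepare : Prog :=
  totals ⨟
  multiples 5 0 5 ⨟
  products ⨟
  multiples 12 3 4 ⨟
  assign 32 (.var 30) ⨟
  multiples 13 4 32 ⨟
  sortJobs ⨟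
  reverseJobs ⨟
  prefixSums 6 8 ⨟
  prefixSums 7 9

/-- The algorithm. -/
def paretoFront : Prog :=
  prepare ⨟
  fillTable 6 8 10 exprL ⨟
  fillTable 7 9 11 exprR ⨟
  listFront

end Prog

/-! ### Minimizing over all split schedules with a given middle block. -/

section Search

variable {s : Mem} {n P : ℕ} {p w r o : ℕ → ℕ}

/-- State of the search after all splits before `k`, and for `k` all first blocks of size less than
`α`, when `b` was the best value before. -/
def Searched (n : ℕ) (p w r : ℕ → ℕ) (e b k α : ℕ) (s : Mem) : Prop :=
  ((s.var 8 = 0 ∧ s.var 6 = b) ∨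
    (s.var 8 = 1 ∧ s.var 6 ≠ 0 ∧ (b = 0 ∨ s.var 6 < b) ∧
      IsValueAt n p w r (s.var 9) (s.var 10) (s.var 11) e (s.var 6))) ∧
  ∀ k' α' y v, IsValueAt n p w r k' α' y e v → (k' < k ∨ k' = k ∧ α' < α) →
    s.var 6 ≠ 0 ∧ s.var 6 ≤ v

theorem runs_trySplit (D : Ready s n P p w r o) {e b k α : ℕ} (hk : k ≤ n)
    (h27 : s.var 27 = e) (h28 : s.var 28 = k) (h29 : s.var 29 = α)
    (h : Searched n p w r e b k α s) :
    Runs Prog.trySplit s 80 (Searched n p w r e b k (α + 1)) := by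
  -- If the pair `k, α` admits no value, the searched range may be extended by it without changing
  -- the memory.
  have hno : (∀ y v, ¬ IsValueAt n p w r k α y e v) → Searched n p w r e b k (α + 1) s :=
    fun hn => ⟨h.1, fun k' α' y v hv hlt => by
      rcases hlt with hlt | ⟨rfl, hlt⟩
      · exact h.2 k' α' y v hv (Or.inl hlt)
      rcases Nat.lt_succ_iff_lt_or_eq.1 hlt with hlt | rfl
      · exact h.2 k' α' y v hv (Or.inr ⟨rfl, hlt⟩)
      · exact absurd hv (hn y v)⟩
  have hset : ∀ (x v : ℕ), 40 < x → ∀ t, Searched n p w r e b k (α + 1) t →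
      Searched n p w r e b k (α + 1) (t.setVar x v) := by
    intro x v hx t ht
    have h6 : 6 ≠ x := by omega
    have h8 : 8 ≠ x := by omega
    have h9 : 9 ≠ x := by omega
    have h10 : 10 ≠ x := by omega
    have h11 : 11 ≠ x := by omega
    simpa [Searched, h6, h8, h9, h10, h11] using ht
  have htot := D.tot_eq
  refine Runs.flat ?_ (by decide)
  by_cases hle : α + e ≤ P
  swap
  · simp only [Prog.trySplit, Prog.wp, Test.holds, Expr.eval, h27, h29, D.left.v2, hle]
    refine ⟨fun h => h.elim, fun _ => hno fun y v hv => ?_⟩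
    have := hv.2.1
    omega
  obtain ⟨y, hy⟩ : ∃ y, P - e - α = y := ⟨_, rfl⟩
  have eL : s.arr 10 (s.arr 13 α + s.arr 12 k + α) = dpL p w r α k α := by
    rw [D.left.layers α (by omega), D.left.rows k (by omega)]
    exact D.tableL α (by omega) k hk α (by omega)
  have eR : s.arr 11 (s.arr 13 y + s.arr 12 (n - k) + y) = dpR n p w r y (n - k) y := by
    rw [D.left.layers y (by omega), D.left.rows (n - k) (by omega)]
    exact D.tableR y (by omega) (n - k) (by omega) y (by omega)
  simp only [Prog.trySplit, Prog.wp, Test.holds, Expr.eval, h27, h28, h29, D.left.v2, D.v0, hle, hy,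
    eL, eR, Mem.setVar_var, Mem.setVar_arr, Nat.reduceEqDiff, if_true, if_false]
  refine ⟨fun _ => ⟨fun hne => ?_, fun hne => ?_⟩, fun h => absurd trivial h⟩
  · have hv : IsValueAt n p w r k α y e (dpL p w r α k α + dpR n p w r y (n - k) y) :=
      ⟨hk, by omega, hne.1, hne.2, rfl⟩
    -- The three block sizes add up to `P`, so `k`, `α` and `e` leave a single candidate for `y` and
    -- for the value.
    have huniq : ∀ y' v', IsValueAt n p w r k α y' e v' →
        v' = dpL p w r α k α + dpR n p w r y (n - k) y := by
      intro y' v' h'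
      have h1 := h'.2.1
      have h2 := hv.2.1
      have : y' = y := by omega
      subst this
      exact h'.2.2.2.2
    refine ⟨fun hb => ?_, fun hb => ?_⟩
    · refine hset _ _ (by decide) _ (hset _ _ (by decide) _ (hset _ _ (by decide) _
        (hset _ _ (by decide) _ ⟨h.1, fun k' α' y' v' hv' hlt => ?_⟩)))
      rcases hlt with hlt | ⟨rfl, hlt⟩
      · exact h.2 k' α' y' v' hv' (Or.inl hlt)
      rcases Nat.lt_succ_iff_lt_or_eq.1 hlt with hlt | rfl
      · exact h.2 k' α' y' v' hv' (Or.inr ⟨rfl, hlt⟩)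
      · rw [huniq y' v' hv']
        exact hb
    · have hpos := hne.1
      refine ⟨Or.inr ?_, fun k' α' y' v' hv' hlt => ?_⟩
      · simp only [Mem.setVar_var, Nat.reduceEqDiff, if_true, if_false]
        refine ⟨trivial, by omega, ?_, hv⟩
        rcases h.1 with ⟨-, h6⟩ | ⟨-, h6, hlt, -⟩
        · omega
        · omega
      · simp only [Mem.setVar_var, Nat.reduceEqDiff, if_true, if_false]
        refine ⟨by omega, ?_⟩
        rcases hlt with hlt | ⟨rfl, hlt⟩
        · have := h.2 k' α' y' v' hv' (Or.inl hlt)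
          omega
        rcases Nat.lt_succ_iff_lt_or_eq.1 hlt with hlt | rfl
        · have := h.2 k' α' y' v' hv' (Or.inr ⟨rfl, hlt⟩)
          omega
        · rw [huniq y' v' hv']
  · refine hset _ _ (by decide) _ (hset _ _ (by decide) _ (hset _ _ (by decide) _
      (hno fun y' v' hv' => hne ?_)))
    have h1 := hv'.2.1
    have : y' = y := by omega
    subst this
    exact ⟨hv'.2.2.1, hv'.2.2.2.1⟩

theorem runs_search (D : Ready s n P p w r o) {e b : ℕ} (h27 : s.var 27 = e) (h8 : s.var 8 = 0)
    (h6 : s.var 6 = b) :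
    Runs Prog.search s ((n + 1) * ((P + 1) * 90 + 18) + 8) fun s' =>
      ((s'.var 8 = 0 ∧ s'.var 6 = b) ∨
        (s'.var 8 = 1 ∧ s'.var 6 ≠ 0 ∧ (b = 0 ∨ s'.var 6 < b) ∧
          IsValueAt n p w r (s'.var 9) (s'.var 10) (s'.var 11) e (s'.var 6))) ∧
      ∀ v, IsValue n p w r e v → s'.var 6 ≠ 0 ∧ s'.var 6 ≤ v := by
  refine Runs.iterate (N := n + 1) (T := (P + 1) * 90 + 8)
    (fun k => Searched n p w r e b k 0) D.left.v3 rfl (by decide) rfl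
    (fun i s' v h => by simpa [Searched] using h)
    ⟨Or.inl ⟨h8, h6⟩, fun k' α' y v _ h => by omega⟩ ?_ le_rfl ?_
  · intro k t hk h28 f q
    have D' := D.congr f rfl rfl
    refine Runs.iterate (N := P + 1) (T := 80)
      (fun α => Searched n p w r e b k α) D'.left.v4 rfl (by decide) rfl
      (fun i s' v h => by simpa [Searched] using h) q ?_ le_rfl ?_
    · intro α t' hα h29 f' q'
      exact runs_trySplit (D'.congr f' rfl rfl) (by omega) (by rw [f'.1 27 rfl, f.1 27 rfl, h27])
        (by rw [f'.1 28 rfl, h28]) h29 q'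
    · intro t' _ q'
      -- A first block has size at most `P`, so after the sizes `0, …, P` the split `k` is
      -- exhausted.
      refine ⟨q'.1, fun k' α' y v hv hlt => q'.2 k' α' y v hv ?_⟩
      have := hv.2.1
      have := D.tot_eq
      omega
  · rintro t f ⟨q1, q2⟩
    exact ⟨q1, fun v ⟨k, α, y, hv⟩ => q2 k α y v hv (Or.inl (Nat.lt_succ_of_le hv.1))⟩

end Search

/-! ### The complete algorithm and its running time. -/

section Main

variable {I : Inst}

/-- Each of the `P + 1` rounds spends `O(n P)` steps (plus lower-order terms) on the search and
`O(n)` on a possible output. Every output appends exactly `n` jobs, which keeps the write position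
in variable `7` at a multiple of `n` without multiplication. -/
theorem runs_listFront {s : Mem} {o : ℕ → ℕ}
    (ho : SortedOrder I.n (I.input.arr 0) (I.input.arr 1) o)
    (D : Ready s I.n I.P (fun i => I.input.arr 0 (o i)) (fun i => I.input.arr 1 (o i))
      (fun i => I.input.arr 2 (o i)) o) :
    Runs Prog.listFront s
      ((I.P + 1) * ((I.n + 1) * ((I.P + 1) * 90 + 18) + (I.n * 400 + 250)) + 20) fun s' =>
      ∃ front : Fin (s'.var 1) → I.Sequence, I.Outputs s' front ∧ Inst.IsParetoFront front := by
  set pS := fun i => I.input.arr 0 (o i) with hpS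
  set wS := fun i => I.input.arr 1 (o i) with hwS
  set rS := fun i => I.input.arr 2 (o i) with hrS
  have hval : ∀ τ : I.Sequence, ∃ e v, IsValue I.n pS wS rS e v ∧ (e : ℤ) ≤ Inst.er τ ∧
      v + I.constCost ≤ Inst.twc τ + 2 := Inst.exists_isValue_le ho
  have hbound : ∀ e v, IsValue I.n pS wS rS e v → e < I.P + 1 := by
    rintro e v ⟨k, α, y, h⟩
    have h1 := h.2.1
    have h2 := D.tot_eq
    omega
  refine Runs.step (T₁ := 2)
    (T₂ := (I.P + 1) * ((I.n + 1) * ((I.P + 1) * 90 + 18) + (I.n * 400 + 250)) + 18)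
    (Q := fun s' => s'.var 1 = 0)
    (Runs.flat (by simp [Prog.wp, Expr.eval]) (by decide)) (fun s₁ f₁ q₁ => ?_) (by omega)
  refine Runs.step (T₁ := 2)
    (T₂ := (I.P + 1) * ((I.n + 1) * ((I.P + 1) * 90 + 18) + (I.n * 400 + 250)) + 16)
    (Q := fun s' => s'.var 6 = 0)
    (Runs.flat (by simp [Prog.wp, Expr.eval]) (by decide)) (fun s₂ f₂ q₂ => ?_) (by omega)
  refine Runs.step (T₁ := 2)
    (T₂ := (I.P + 1) * ((I.n + 1) * ((I.P + 1) * 90 + 18) + (I.n * 400 + 250)) + 14)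
    (Q := fun s' => s'.var 7 = 0)
    (Runs.flat (by simp [Prog.wp, Expr.eval]) (by decide)) (fun s₃ f₃ q₃ => ?_) (by omega)
  have D₃ := ((D.congr f₁ rfl rfl).congr f₂ rfl rfl).congr f₃ rfl rfl
  have e1 : s₃.var 1 = 0 := by rw [f₃.1 1 rfl, f₂.1 1 rfl, q₁]
  have e6 : s₃.var 6 = 0 := by rw [f₃.1 6 rfl, q₂]
  refine Runs.iterate (N := I.P + 1)
    (T := (I.n + 1) * ((I.P + 1) * 90 + 18) + (I.n * 400 + 230))
    (fun e s' => s'.var 7 = s'.var 1 * I.n ∧ ∃ front : ℕ → I.Sequence,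
      Inst.PartialFront (IsValue I.n pS wS rS) e (s'.var 1) (s'.var 6) front ∧
      ∀ i < s'.var 1, ∀ k : Fin I.n, s'.arr 3 (i * I.n + k) = (front i k : ℕ))
    D₃.left.v4 rfl (by decide) rfl (fun i s' v h => by simpa using h) ?_ ?_ ?_ ?_
  · refine ⟨by rw [q₃, e1, zero_mul], fun _ => 1, ?_, by simp [e1]⟩
    rw [e1]
    exact Inst.PartialFront.zero e6
  · rintro e t he h27 f ⟨h7, front, hfront, hout⟩
    have Dt := D₃.congr f rfl rfl
    refine Runs.step (T₁ := 2)
      (T₂ := (I.n + 1) * ((I.P + 1) * 90 + 18) + (I.n * 400 + 220)) (Q := fun s' => s'.var 8 = 0)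
      (Runs.flat (by simp [Prog.wp, Expr.eval]) (by decide)) (fun t₁ g₁ p₁ => ?_) (by omega)
    have Dt₁ := Dt.congr g₁ rfl rfl
    refine Runs.step (runs_search Dt₁ (e := e) (b := t.var 6) (by rw [g₁.1 27 rfl, h27]) p₁
      (g₁.1 6 rfl)) (T₂ := I.n * 400 + 212) (fun t₂ g₂ p₂ => ?_) (by omega)
    have Dt₂ := Dt₁.congr g₂ rfl rfl
    have e1 : t₂.var 1 = t.var 1 := by rw [g₂.1 1 rfl, g₁.1 1 rfl]
    have e3 : t₂.arr 3 = t.arr 3 := by rw [g₂.2 3 rfl, g₁.2 3 rfl]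
    have e7 : t₂.var 7 = t.var 1 * I.n := by rw [g₂.1 7 rfl, g₁.1 7 rfl, h7]
    obtain ⟨p₃, p₄⟩ := p₂
    refine (Runs.branch (T := I.n * 400 + 200) (fun hb => ?_) fun hb => ?_).imp
      (by simp only [Test.cost, Expr.cost]; omega) fun _ _ h => h
    · have hb : t₂.var 8 = 1 := hb
      obtain ⟨-, h6, hlt, hv⟩ : t₂.var 8 = 1 ∧ t₂.var 6 ≠ 0 ∧ (t.var 6 = 0 ∨ t₂.var 6 < t.var 6) ∧
          IsValueAt I.n pS wS rS (t₂.var 9) (t₂.var 10) (t₂.var 11) e (t₂.var 6) :=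
        p₃.resolve_left fun h => by omega
      refine (runs_emit Dt₂ hv rfl rfl rfl e7).imp le_rfl ?_
      rintro t₃ g₃ ⟨u1, u7, uold, unew⟩
      obtain ⟨σ, hσ, hσL⟩ := Inst.exists_follows ho
        (cls := splitClass I.n pS wS rS (t₂.var 9) (t₂.var 10) (t₂.var 11)) fun i hi => by
          have := (splitClass_spec hv).1.le_two i hi
          omega
      obtain ⟨her, htwc⟩ := Inst.twc_of_follows ho hv hσ
      have e6 : t₃.var 6 = t₂.var 6 := g₃.1 6 rfl
      have hlen : (classList I.n
          (splitClass I.n pS wS rS (t₂.var 9) (t₂.var 10) (t₂.var 11)) 3).length = I.n :=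
        length_classList fun i hi => by
          have := (splitClass_spec hv).1.le_two i hi
          omega
      refine ⟨by rw [u7, u1, e1, add_mul, one_mul], Function.update front (t.var 1) σ, ?_, ?_⟩
      · rw [u1, e1, e6]
        exact hfront.push hval hlt h6 (fun v hv' => (p₄ v hv').2) her htwc
      · intro i hi k
        rw [u1, e1] at hi
        rcases Nat.lt_succ_iff_lt_or_eq.1 hi with hi | rfl
        -- Earlier sequences occupy cells below the old write position and are not touched.
        · have : (i + 1) * I.n ≤ t.var 1 * I.n := Nat.mul_le_mul_right _ hi
          rw [add_mul] at this
          have hk := k.2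
          rw [uold _ (by omega), e3, hout i hi k, Function.update_of_ne hi.ne]
        · obtain ⟨x, hx⟩ : ∃ x, (classList I.n
              (splitClass I.n pS wS rS (t₂.var 9) (t₂.var 10) (t₂.var 11)) 3)[(k : ℕ)]? = some x :=
            ⟨_, List.getElem?_eq_getElem (hlen.symm ▸ k.2)⟩
          rw [unew k x hx, Function.update_self, hσL k x hx]
    · obtain ⟨-, h6⟩ : t₂.var 8 = 0 ∧ t₂.var 6 = t.var 6 :=
        p₃.resolve_right fun h => hb h.1
      refine Runs.flat ?_ (by simp [Prog.flatCost])
      refine ⟨by rw [e7, e1], front, ?_, by rw [e1, e3]; exact hout⟩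
      rw [e1, h6]
      exact hfront.skip hval fun v hv => by rw [← h6]; exact p₄ v hv
  · exact Nat.add_le_add (Nat.mul_le_mul_left _ (by omega)) (by omega)
  · rintro t - ⟨-, front, hfront, hout⟩
    exact ⟨fun i => front i, fun i k => hout i i.2 k, hfront.isParetoFront hval hbound⟩

theorem runs_prepare (I : Inst) :
    Runs Prog.prepare I.input (1000 * ((I.n + 1) * (I.P + 1) ^ 2)) fun s =>
      SortedOrder I.n (I.input.arr 0) (I.input.arr 1) (s.arr 6) ∧ s.var 0 = I.n ∧ s.var 12 = 3 ∧
      ItemData s I.n I.P (fun i => I.input.arr 0 (s.arr 6 i)) (fun i => I.input.arr 2 (s.arr 6 i))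
        (costL fun i => I.input.arr 1 (s.arr 6 i)) 6 8 Prog.exprL ∧
      ItemData s I.n I.P (rev I.n fun i => I.input.arr 0 (s.arr 6 i))
        (rev I.n fun i => I.input.arr 2 (s.arr 6 i))
        (costR I.n (fun i => I.input.arr 0 (s.arr 6 i)) fun i => I.input.arr 1 (s.arr 6 i))
        7 9 Prog.exprR := by
  obtain ⟨n, hn⟩ : ∃ n, n = I.n := ⟨_, rfl⟩
  obtain ⟨P, hP⟩ : ∃ P, P = I.P := ⟨_, rfl⟩
  obtain ⟨p, hp⟩ : ∃ p, p = I.input.arr 0 := ⟨_, rfl⟩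
  obtain ⟨w, hw⟩ : ∃ w, w = I.input.arr 1 := ⟨_, rfl⟩
  obtain ⟨r, hr⟩ : ∃ r, r = I.input.arr 2 := ⟨_, rfl⟩
  obtain ⟨s0, hs0⟩ : ∃ s0, s0 = I.input := ⟨_, rfl⟩
  have htot : tot p n = P := by rw [hp, hn, hP, Inst.P_eq]
  have h0 : s0.var 0 = n := by rw [hs0, hn]; rfl
  rw [← hs0] at hp hw hr
  rw [← hs0, ← hn, ← hP, ← hp, ← hw, ← hr]
  -- Expanded into monomials, the common budget `U` lets the time bounds below be compared linearly,
  -- with each monomial as an atom.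
  have hU : (n + 1) * (P + 1) ^ 2 = n * P ^ 2 + 2 * (n * P) + n + P ^ 2 + 2 * P + 1 := by ring
  obtain ⟨U, hUdef⟩ : ∃ U, U = (n + 1) * (P + 1) ^ 2 := ⟨_, rfl⟩
  rw [← hUdef] at hU ⊢
  have hpP : ∀ i < n, p i ≤ P := fun i hi => by
    rw [← htot]
    exact Finset.single_le_sum (f := p) (fun _ _ => Nat.zero_le _) (Finset.mem_range.2 hi)
  refine Runs.step ((runs_totals h0 hp.symm).imp (T := 30 * U) (by omega) fun _ _ h => h)
    (T₂ := 900 * U) (fun s1 f1 q1 => ?_) (by omega)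
  rw [htot] at q1
  obtain ⟨v2, v3, v4, v5, v12⟩ := q1
  refine Runs.step ((runs_multiples (a := 5) (N := n) (S := 2 * P + 1) (by rw [f1.1 0 rfl, h0]) v5
    (by decide) (by decide) (by decide) (by decide)).imp (T := 20 * U) (by omega) fun _ _ h => h)
    (T₂ := 850 * U) (fun s2 f2 q2 => ?_) (by omega)
  refine Runs.step ((runs_products (n := n) (w := w) (W := 2 * P + 1) (by rw [f2.1 0 rfl, f1.1 0
      rfl, h0])
    (by rw [f2.1 5 rfl, v5]) (by rw [f2.2 1 rfl, f1.2 1 rfl, hw])).imp (T := 70 * U)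
    (by rw [show n * ((2 * P + 1) * 25 + 20) = 50 * (n * P) + 45 * n by ring]; omega)
    fun _ _ h => h) (T₂ := 750 * U) (fun s3 f3 q3 => ?_) (by omega)
  refine Runs.step ((runs_multiples (a := 12) (N := n + 1) (S := P + 1) (by rw [f3.1 3 rfl, f2.1 3
      rfl, v3])
    (by rw [f3.1 4 rfl, f2.1 4 rfl, v4])
    (by decide) (by decide) (by decide) (by decide)).imp (T := 50 * U) (by omega) fun _ _ h => h)
    (T₂ := 700 * U) (fun s4 f4 q4 => ?_) (by omega)
  -- The multiple left over in variable `30` is the size `(n + 1) * (P + 1)` of one layer, and thus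
  -- the stride for array `13`.
  refine Runs.step (T₁ := 2 * U) (Q := fun t => t.var 32 = (n + 1) * (P + 1))
    ((Runs.flat (T := 2) (by simp [Prog.wp, Expr.eval, q4.1]) (by decide)).imp (by omega)
      fun _ _ h => h) (T₂ := 650 * U) (fun s5 f5 q5 => ?_) (by omega)
  refine Runs.step ((runs_multiples (a := 13) (N := P + 1) (S := (n + 1) * (P + 1))
    (by rw [f5.1 4 rfl, f4.1 4 rfl, f3.1 4 rfl, f2.1 4 rfl, v4]) q5
    (by decide) (by decide) (by decide) (by decide)).imp (T := 50 * U) (by omega) fun _ _ h => h)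
    (T₂ := 600 * U) (fun s6 f6 q6 => ?_) (by omega)
  have e5 : s6.arr 5 = s2.arr 5 := by rw [f6.2 5 rfl, f5.2 5 rfl, f4.2 5 rfl, f3.2 5 rfl]
  have e4 : s6.arr 4 = s3.arr 4 := by rw [f6.2 4 rfl, f5.2 4 rfl, f4.2 4 rfl]
  have e0 : s6.arr 0 = p := by rw [f6.2 0 rfl, f5.2 0 rfl, f4.2 0 rfl, f3.2 0 rfl, f2.2 0 rfl, f1.2
      0 rfl, hp]
  have en : s6.var 0 = n := by rw [f6.1 0 rfl, f5.1 0 rfl, f4.1 0 rfl, f3.1 0 rfl, f2.1 0 rfl, f1.1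
      0 rfl, h0]
  have hpW : ∀ i < n, p i < 2 * P + 1 := fun i hi => by
    have := hpP i hi
    omega
  refine Runs.step ((runs_sortJobs (n := n) (p := p) (w := w) (W := 2 * P + 1)
    en e0 (e5 ▸ q2.2) (e4 ▸ q3) hpW).imp (T := 200 * U)
    (by rw [htot, show P * (n * 70 + 10) = 70 * (n * P) + 10 * P by ring]; omega) fun _ _ h => h)
    (T₂ := 400 * U) (fun s7 f7 q7 => ?_) (by omega)
  have ho := sortedOrder_of_rank q7
  have htot' : tot (fun i => p (s7.arr 6 i)) n = P := by rw [← htot]; exact ho.sum_comp p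
  refine Runs.step ((runs_reverseJobs (n := n) (by rw [f7.1 0 rfl, f6.1 0 rfl, f5.1 0 rfl, f4.1 0
      rfl, f3.1 0 rfl, f2.1 0 rfl, f1.1 0 rfl, h0])).imp (T := 30 * U) (by omega)
    fun _ _ h => h) (T₂ := 300 * U) (fun s8 f8 q8 => ?_) (by omega)
  refine Runs.step ((runs_prefixSums (n := n) (p := p) (a := 6) (b := 8)
    (ps := fun i => p (s7.arr 6 i)) (by rw [f8.1 3 rfl, f7.1 3 rfl, f6.1 3 rfl, f5.1 3 rfl, f4.1 3
        rfl, f3.1 3 rfl, f2.1 3 rfl, v3]) (by rw [f8.2 0 rfl, f7.2 0 rfl, f6.2 0 rfl, f5.2 0 rfl,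
    f4.2 0 rfl, f3.2 0 rfl, f2.2 0 rfl, f1.2 0 rfl, hp])
    (fun i _ => by rw [f8.2 6 rfl]) (by decide) (by decide)).imp (T := 50 * U) (by omega)
    fun _ _ h => h) (T₂ := 100 * U) (fun s9 f9 q9 => ?_) (by omega)
  refine (runs_prefixSums (n := n) (p := p) (a := 7) (b := 9)
    (ps := rev n fun i => p (s7.arr 6 i)) (by rw [f9.1 3 rfl, f8.1 3 rfl, f7.1 3 rfl, f6.1 3 rfl,
        f5.1 3 rfl, f4.1 3 rfl, f3.1 3 rfl, f2.1 3 rfl, v3]) (by rw [f9.2 0 rfl, f8.2 0 rfl, f7.2 0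
    rfl, f6.2 0 rfl, f5.2 0 rfl, f4.2 0 rfl, f3.2 0 rfl, f2.2 0 rfl, f1.2 0 rfl, hp])
    (fun i hi => by rw [f9.2 7 rfl, q8 i hi]; rfl) (by decide) (by decide)).imp (by omega) ?_
  intro s10 f10 q10
  have a6 : s10.arr 6 = s7.arr 6 := by rw [f10.2 6 rfl, f9.2 6 rfl, f8.2 6 rfl]
  have a4 : s10.arr 4 = s3.arr 4 := by rw [f10.2 4 rfl, f9.2 4 rfl, f8.2 4 rfl, f7.2 4 rfl, f6.2 4
      rfl, f5.2 4 rfl, f4.2 4 rfl]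
  have a5 : s10.arr 5 = s2.arr 5 := by rw [f10.2 5 rfl, f9.2 5 rfl, f8.2 5 rfl, f7.2 5 rfl, f6.2 5
      rfl, f5.2 5 rfl, f4.2 5 rfl, f3.2 5 rfl]
  have a7 : ∀ i < n, s10.arr 7 i = s7.arr 6 (n - 1 - i) := by rw [f10.2 7 rfl, f9.2 7 rfl]; exact q8
  have a8 : s10.arr 8 = s9.arr 8 := by rw [f10.2 8 rfl]
  have a12 : s10.arr 12 = s4.arr 12 := by rw [f10.2 12 rfl, f9.2 12 rfl, f8.2 12 rfl, f7.2 12 rfl,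
      f6.2 12 rfl, f5.2 12 rfl]
  have a13 : s10.arr 13 = s6.arr 13 := by rw [f10.2 13 rfl, f9.2 13 rfl, f8.2 13 rfl, f7.2 13 rfl]
  have a0 : s10.arr 0 = p := by rw [f10.2 0 rfl, f9.2 0 rfl, f8.2 0 rfl, f7.2 0 rfl, f6.2 0 rfl,
      f5.2 0 rfl, f4.2 0 rfl, f3.2 0 rfl, f2.2 0 rfl, f1.2 0 rfl, hp]
  have a2 : s10.arr 2 = r := by rw [f10.2 2 rfl, f9.2 2 rfl, f8.2 2 rfl, f7.2 2 rfl, f6.2 2 rfl,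
      f5.2 2 rfl, f4.2 2 rfl, f3.2 2 rfl, f2.2 2 rfl, f1.2 2 rfl, hr]
  have b2 : s10.var 2 = P := by rw [f10.1 2 rfl, f9.1 2 rfl, f8.1 2 rfl, f7.1 2 rfl, f6.1 2 rfl,
      f5.1 2 rfl, f4.1 2 rfl, f3.1 2 rfl, f2.1 2 rfl, v2]
  have b3 : s10.var 3 = n + 1 := by rw [f10.1 3 rfl, f9.1 3 rfl, f8.1 3 rfl, f7.1 3 rfl, f6.1 3
      rfl, f5.1 3 rfl, f4.1 3 rfl, f3.1 3 rfl, f2.1 3 rfl, v3]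
  have b4 : s10.var 4 = P + 1 := by rw [f10.1 4 rfl, f9.1 4 rfl, f8.1 4 rfl, f7.1 4 rfl, f6.1 4
      rfl, f5.1 4 rfl, f4.1 4 rfl, f3.1 4 rfl, f2.1 4 rfl, v4]
  have hrev : tot (rev n fun i => p (s7.arr 6 i)) n = P := by
    rw [← htot']
    exact Finset.sum_range_reflect (fun i => p (s7.arr 6 i)) n
  rw [a6]
  refine ⟨ho, by rw [f10.1 0 rfl, f9.1 0 rfl, f8.1 0 rfl, f7.1 0 rfl, f6.1 0 rfl, f5.1 0 rfl, f4.1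
      0 rfl, f3.1 0 rfl, f2.1 0 rfl, f1.1 0 rfl, h0], by rw [f10.1 12 rfl, f9.1 12 rfl, f8.1 12
  rfl, f7.1 12 rfl, f6.1 12 rfl, f5.1 12 rfl, f4.1 12 rfl, f3.1 12 rfl, f2.1 12 rfl, v12], ?_, ?_⟩
  · refine ⟨b2, b3, b4,
      fun i _ => by rw [a6, a0], fun i _ => by rw [a6, a2],
      a8 ▸ q9, htot'.le, a12 ▸ q4.2,
      a13 ▸ q6.2, ?_, fun e => by simp only [Prog.exprL, Expr.cost]; omega⟩
    intro i hi t t2 t4 t5 t35 t36 e he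
    have hj := ho.lt i hi
    simp only [Prog.exprL, Expr.eval, t4, t5, t35, a6, a4, a5]
    rw [q2.2 _ hj, q3 _ hj _ (by omega), costL]
  · refine ⟨b2, b3, b4,
      fun i hi => by rw [a7 i hi, a0, rev],
      fun i hi => by rw [a7 i hi, a2, rev],
      q10, hrev.le, a12 ▸ q4.2,
      a13 ▸ q6.2, ?_, fun e => by simp only [Prog.exprR, Expr.cost]; omega⟩
    intro i hi t t2 t4 t5 t35 t36 e he
    have hj := ho.lt (n - 1 - i) (by omega)
    simp only [Prog.exprR, Expr.eval, t2, t4, t5, t35, t36, a7 i hi, a4, a5]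
    rw [q2.2 _ hj, q3 _ hj _ (by omega), costR, htot', rev]

theorem runs_paretoFront (I : Inst) :
    Runs Prog.paretoFront I.input (3000 * ((I.n + 1) * (I.P + 1) ^ 2)) fun s =>
      ∃ front : Fin (s.var 1) → I.Sequence, I.Outputs s front ∧ Inst.IsParetoFront front := by
  have hU : (I.n + 1) * (I.P + 1) ^ 2 =
      I.n * I.P ^ 2 + 2 * (I.n * I.P) + I.n + I.P ^ 2 + 2 * I.P + 1 := by ring
  have hF : (I.P + 1) * ((I.n + 1) * ((I.P + 1) * 180 + 20) + 20) + 20 ≤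
      300 * ((I.n + 1) * (I.P + 1) ^ 2) := by
    rw [hU, show (I.P + 1) * ((I.n + 1) * ((I.P + 1) * 180 + 20) + 20) =
      180 * (I.n * I.P ^ 2) + 380 * (I.n * I.P) + 200 * I.n + 180 * I.P ^ 2 + 400 * I.P + 220 by
        ring]
    omega
  have hM : (I.P + 1) * ((I.n + 1) * ((I.P + 1) * 90 + 18) + (I.n * 400 + 250)) + 20 ≤
      1000 * ((I.n + 1) * (I.P + 1) ^ 2) := by
    rw [hU, show (I.P + 1) * ((I.n + 1) * ((I.P + 1) * 90 + 18) + (I.n * 400 + 250)) =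
      90 * (I.n * I.P ^ 2) + 598 * (I.n * I.P) + 508 * I.n + 90 * I.P ^ 2 + 448 * I.P + 358 by
        ring]
    omega
  refine Runs.step (runs_prepare I) (T₂ := 2000 * ((I.n + 1) * (I.P + 1) ^ 2))
    (fun s1 f1 q1 => ?_) (by omega)
  obtain ⟨ho, v0, v12, L1, R1⟩ := q1
  refine Runs.step ((runs_fillTable (f := 10) L1 (by decide)).imp hF fun _ _ h => h)
    (T₂ := 1500 * ((I.n + 1) * (I.P + 1) ^ 2)) (fun s2 f2 q2 => ?_) (by omega)
  have L2 := L1.congr (f2.1 2 rfl) (f2.1 3 rfl) (f2.1 4 rfl) fun x hx =>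
    f2.2 x (by revert x; decide)
  have R2 := R1.congr (f2.1 2 rfl) (f2.1 3 rfl) (f2.1 4 rfl) fun x hx =>
    f2.2 x (by revert x; decide)
  refine Runs.step ((runs_fillTable (f := 11) R2 (by decide)).imp hF fun _ _ h => h)
    (T₂ := 1000 * ((I.n + 1) * (I.P + 1) ^ 2)) (fun s3 f3 q3 => ?_) (by omega)
  have L3 := L2.congr (f3.1 2 rfl) (f3.1 3 rfl) (f3.1 4 rfl) fun x hx =>
    f3.2 x (by revert x; decide)
  have R3 := R2.congr (f3.1 2 rfl) (f3.1 3 rfl) (f3.1 4 rfl) fun x hx =>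
    f3.2 x (by revert x; decide)
  refine (runs_listFront ho ⟨by rw [f3.1 0 rfl, f2.1 0 rfl, v0], by rw [f3.1 12 rfl, f2.1 12 rfl,
      v12], by rw [f3.2 6 rfl, f2.2 6 rfl], ?_,
    L3, R3, by rw [f3.2 10 rfl]; exact q2, q3⟩).imp hM fun _ _ h => h
  rw [Inst.P_eq]
  exact ho.sum_comp (I.input.arr 0)

end Main

end ERSched

theorem mainTheorem8 :
    ∃ (prog : ERSched.Prog) (C : ℕ), ∀ I : ERSched.Inst,
      ∃ (s : ERSched.Mem) (t : ℕ),
        ERSched.Exec prog I.input s t ∧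
        t ≤ C * (I.n * (max I.P 1) ^ 2) ∧
        ∃ front : Fin (s.var 1) → I.Sequence,
          I.Outputs s front ∧ ERSched.Inst.IsParetoFront front := by
  -- Replacing `n + 1` by `2 * n` and `P + 1` by `2 * max P 1` costs a factor `2 * 4`, and `3000 * 8
  -- = 24000`. The former needs a job to exist, which the nonempty set of r-jobs ensures.
  refine ⟨ERSched.Prog.paretoFront, 24000, fun I => ?_⟩
  obtain ⟨s, t, he, ht, hq⟩ := ERSched.runs_paretoFront I
  refine ⟨s, t, he, ht.trans ?_, hq⟩
  have hn : I.n + 1 ≤ 2 * I.n := by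
    have := I.R_nonempty.choose.pos
    omega
  have hP : I.P + 1 ≤ 2 * max I.P 1 := by omega
  calc 3000 * ((I.n + 1) * (I.P + 1) ^ 2)
      ≤ 3000 * ((2 * I.n) * (2 * max I.P 1) ^ 2) := by gcongr
    _ = 24000 * (I.n * (max I.P 1) ^ 2) := by ring
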